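/- Let $m\ge 1$, $N\ge 0$, let $\pi\colon E\to M$ be a smooth fibre bundle with $\dim M=m$, $\dim E=m+N$, $E$ Hausdorff and $\sigma$-compact (for instance connected and paracompact), and let $\omega$ be a volume form on $M$. Let $J^1E$ be the first jet bundle of $\pi$; its points over $y\in E$ are the linear sections $\bar y\colon T_{\pi(y)}M\to T_yE$ of $T_y\pi$, with natural coordinates $(x^\alpha,y^A,v^A_\alpha)$. Let $\mathcal L=\pounds\,\omega$ be a Lagrangian density, where $\pounds\in C^\infty(J^1E)$ is arbitrary (regular or not). *Multimomentum bundle and Legendre map.* Let $\mathcal M\pi=\Lambda^m_1T^*E$ be the bundle of $m$-forms on $E$ that vanish when two of their arguments are $\pi$-vertical. Let $q\colon\mathcal M\pi\to E$ and $p=\pi\circ q\colon\mathcal M\pi\to M$ be the projections, $\Theta$ the canonical $m$-form, $\Theta_w=q^*w$, and $\Omega=-d\Theta$. The extended Legendre map $\mathfrak F\colon J^1E\to\mathcal M\pi$ over $E$ sends $\bar y$ to the form at $y$ whose pull-back to $J^1E$ is the Poincaré–Cartan form $$\frac{\partial\pounds}{\partial v^A_\nu}\,(dy^A-v^A_\alpha\,dx^\alpha)\wedge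 i\Big(\frac{\partial}{\partial x^\nu}\Big)\omega+\pounds\,\omega .$$ *Operators.* Let $S\subseteq J^1E$ be open. All objects are smooth, and "along $\mathfrak F$" means that the value at $\bar y$ lies over $\mathfrak F(\bar y)$. 1. An extended $m$-vector field operator on $S$ is an $m$-vector field $K\colon S\to\Lambda^mT\mathcal M\pi$ along $\mathfrak F$ that is nowhere zero, locally decomposable (locally $K=X_1\wedge\dots\wedge X_m$ with smooth vector fields $X_\alpha$ along $\mathfrak F$), $p$-transverse ($i(K)(p^*\omega)\ne 0$ everywhere), satisfies $\mathfrak F^*[i(K)(\Omega\circ\mathfrak F)]=0$, and is semi-holonomic ($\Lambda^m(Tq)\,K(\bar y)=\bar y(b_1)\wedge\dots\wedge \bar y(b_m)$ for some basis $(b_\alpha)$ of $T_{\pi(y)}M$). The class of $K$ consists of all $fK$ with $f$ smooth and nowhere zero. 2. An extended jet field operator on $S$ is a map $Y\colon S\to J^1\mathcal M\pi$ along $\mathfrak F$ (so $Y(\bar y)\colon T_{\pi(y)}M\to T_{\mathfrak F(\bar y)}\mathcal M\pi$ is a linear section of $Tp$) that is orientable (its images are spanned by a nowhere zero locally decomposable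 $m$-vector field along $\mathfrak F$), satisfies $\Omega(Y(Z_1),\dots,Y(Z_m),T\mathfrak F(W))=0$ for all $Z_i\in T_{\pi(y)}M$ and $W\in T_{\bar y}J^1E$, and is semi-holonomic ($Tq\circ Y(\bar y)=\bar y$). 3. An extended connection operator on $S$ is a section $H\colon S\to p^*T^*M\otimes T\mathcal M\pi$ along $\mathfrak F$ that is an orientable Ehresmann connection form ($i(H)\xi=\xi$ for every $p$-semibasic covector $\xi$), satisfies $\mathfrak F^*[i(H)(\Omega\circ\mathfrak F)-(m-1)(\Omega\circ\mathfrak F)]=0$, and is semi-holonomic ($Tq\circ H(\bar y)=\bar y$). $K$, $Y$ and $H$ are associated if $Y=H$ as linear maps $T_{\pi(y)}M\to T_{\mathfrak F(\bar y)}\mathcal M\pi$ and $K(\bar y)$ is everywhere the exterior product of the image under $H$ of a basis of $T_{\pi(y)}M$. **Theorem (existence and local multiplicity).** (i) There exist, globally on $J^1E$, a class of extended $m$-vector field operators and an extended jet field operator and an extended connection operator associated with it. (ii) In a local natural chart they depend on $N(m^2-1)$ arbitrary functions. Precisely, for every natural (fibred) chart $(x^\alpha,y^A)$ of $E$ with domain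 $U$, there are smooth sections $H_0$ and $G_1,\dots,G_{N(m^2-1)}$ of $p^*T^*M\otimes T\mathcal M\pi$ along $\mathfrak F$ over $J^1E|_U$, with the $G_i$ pointwise linearly independent, such that for every open $S\subseteq J^1E|_U$ the following holds, where $H_g:=H_0+\sum_i g_iG_i$: - $K$ is an extended $m$-vector field operator on $S$ if and only if $K=f\cdot H_g(\partial/\partial x^1)\wedge\dots\wedge H_g(\partial/\partial x^m)$ for some smooth functions $g_i$ on $S$ and some smooth nowhere zero function $f$ on $S$; - $Y$ is an extended jet field operator on $S$ if and only if $Y=H_g$ for some smooth functions $g_i$ on $S$; - $H$ is an extended connection operator on $S$ associated with an extended $m$-vector field operator on $S$ if and only if $H=H_g$ for some smooth functions $g_i$ on $S$. -/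

import Mathlib

open Set
open scoped Manifold ContDiff Topology

noncomputable section

/-- A smooth atlas on a bare type `T` with values in a normed space `X`: it makes `T` a smooth
manifold, with the topology generated by the charts. -/
structure SmoothAtlas (X T : Type*) [NormedAddCommGroup X] [NormedSpace ℝ X] where
  charts : Set (PartialEquiv T X)
  chart : T → PartialEquiv T X
  mem_source : ∀ t, t ∈ (chart t).source
  chart_mem : ∀ t, chart t ∈ charts
  open_source : ∀ e ∈ charts, ∀ e' ∈ charts, IsOpen (e.symm.trans e').source
  contDiffOn : ∀ e ∈ charts, ∀ e' ∈ charts,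
    ContDiffOn ℝ ∞ (e.symm.trans e') (e.symm.trans e').source

namespace SmoothAtlas

variable {X T : Type*} [NormedAddCommGroup X] [NormedSpace ℝ X] (A : SmoothAtlas X T)

/-- The associated topological gluing data. -/
def core : ChartedSpaceCore X T where
  atlas := A.charts
  chartAt := A.chart
  mem_chart_source := A.mem_source
  chart_mem_atlas := A.chart_mem
  open_source e e' he he' := A.open_source e he e' he'
  continuousOn_toFun e e' he he' := (A.contDiffOn e he e' he').continuousOn

theorem isManifold :
    letI := A.core.toTopologicalSpace
    letI := A.core.toChartedSpace
    IsManifold 𝓘(ℝ, X) ∞ T := by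
  let := A.core.toTopologicalSpace
  let := A.core.toChartedSpace
  apply isManifold_of_contDiffOn
  rintro e e' he he'
  simp only [atlas, ChartedSpace.atlas, mem_iUnion, mem_singleton_iff] at he he'
  obtain ⟨f, hf, rfl⟩ := he
  obtain ⟨f', hf', rfl⟩ := he'
  have := A.contDiffOn f hf f' hf'
  simp only [modelWithCornersSelf_coe, modelWithCornersSelf_coe_symm, Function.id_comp,
    Function.comp_id, range_id, inter_univ, preimage_id]
  exact this

end SmoothAtlas

section ChartDerivatives

variable {X N : Type*} [NormedAddCommGroup X] [NormedSpace ℝ X] [TopologicalSpace N]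
  [ChartedSpace X N]

/-- The differential at `x` of a chart `e`, identifying `T_x N` with the model space. -/
def chartD (e : OpenPartialHomeomorph N X) (x : N) : TangentSpace 𝓘(ℝ, X) x →L[ℝ] X :=
  mfderiv 𝓘(ℝ, X) 𝓘(ℝ, X) e x

/-- The inverse of `chartD`. -/
def chartDinv (e : OpenPartialHomeomorph N X) (x : N) : X →L[ℝ] TangentSpace 𝓘(ℝ, X) x :=
  (chartD e x).inverse

variable {e e' : OpenPartialHomeomorph N X}

theorem mdiff_of_mem (he : e ∈ IsManifold.maximalAtlas 𝓘(ℝ, X) ∞ N) :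
    e.MDifferentiable 𝓘(ℝ, X) 𝓘(ℝ, X) :=
  ⟨fun x hx => ((contMDiffOn_of_mem_maximalAtlas he x hx).mdifferentiableWithinAt (by simp)),
   fun x hx => ((contMDiffOn_symm_of_mem_maximalAtlas he x hx).mdifferentiableWithinAt (by simp))⟩

theorem chartD_invertible (he : e ∈ IsManifold.maximalAtlas 𝓘(ℝ, X) ∞ N)
    {x : N} (hx : x ∈ e.source) : (chartD e x).IsInvertible :=
  ⟨(mdiff_of_mem he).mfderiv hx, rfl⟩

theorem chartD_chartDinv (he : e ∈ IsManifold.maximalAtlas 𝓘(ℝ, X) ∞ N)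
    {x : N} (hx : x ∈ e.source) (v : X) :
    chartD e x (chartDinv e x v) = v :=
  (chartD_invertible he hx).self_apply_inverse v

theorem chartDinv_chartD (he : e ∈ IsManifold.maximalAtlas 𝓘(ℝ, X) ∞ N)
    {x : N} (hx : x ∈ e.source) (v : TangentSpace 𝓘(ℝ, X) x) :
    chartDinv e x (chartD e x v) = v :=
  (chartD_invertible he hx).inverse_apply_self v

theorem contDiffOn_transition (he : e ∈ IsManifold.maximalAtlas 𝓘(ℝ, X) ∞ N)
    (he' : e' ∈ IsManifold.maximalAtlas 𝓘(ℝ, X) ∞ N) :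
    ContDiffOn ℝ ∞ (e' ∘ e.symm) (e.symm.trans e').source := by
  rw [← contMDiffOn_iff_contDiffOn]
  refine (contMDiffOn_of_mem_maximalAtlas he').comp
    ((contMDiffOn_symm_of_mem_maximalAtlas he).mono ?_) ?_
  · intro x hx; simp at hx; exact hx.1
  · intro x hx; simp at hx; exact hx.2

theorem contDiffOn_fderiv_transition (he : e ∈ IsManifold.maximalAtlas 𝓘(ℝ, X) ∞ N)
    (he' : e' ∈ IsManifold.maximalAtlas 𝓘(ℝ, X) ∞ N) :
    ContDiffOn ℝ ∞ (fderiv ℝ (e' ∘ e.symm)) (e.symm.trans e').source :=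
  (contDiffOn_transition he he').fderiv_of_isOpen (e.symm.trans e').open_source (by simp)

theorem chartD_comp_chartDinv (he : e ∈ IsManifold.maximalAtlas 𝓘(ℝ, X) ∞ N)
    (he' : e' ∈ IsManifold.maximalAtlas 𝓘(ℝ, X) ∞ N) {x : N} (hx : x ∈ e.source) (hx' : x ∈ e'.source) :
    (chartD e' x).comp (chartDinv e x) = fderiv ℝ (e' ∘ e.symm) (e x) := by
  have h : chartD e' x = (fderiv ℝ (e' ∘ e.symm) (e x)).comp (chartD e x) := by
    have hz : e x ∈ (e.symm.trans e').source := by simp [hx, hx']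
    have h1 : MDifferentiableAt 𝓘(ℝ, X) 𝓘(ℝ, X) (e' ∘ e.symm) (e x) :=
      (((contDiffOn_transition he he').contDiffAt
        ((e.symm.trans e').open_source.mem_nhds hz)).differentiableAt
          (by simp)).mdifferentiableAt
    have h2 := mfderiv_comp x h1 ((mdiff_of_mem he).mdifferentiableAt hx)
    rw [mfderiv_eq_fderiv] at h2
    unfold chartD
    refine Eq.trans ?_ h2
    apply Filter.EventuallyEq.mfderiv_eq
    filter_upwards [e.open_source.mem_nhds hx] with y hy
    simp [hy]
  rw [h]
  ext v
  simp [chartD_chartDinv he hx]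

end ChartDerivatives

section Fibred

variable {V F M B : Type*} [NormedAddCommGroup V] [NormedSpace ℝ V]
  [NormedAddCommGroup F] [NormedSpace ℝ F]
  [TopologicalSpace M] [ChartedSpace V M] [TopologicalSpace B] [ChartedSpace (V × F) B]

/-- Natural (adapted) coordinates `(x, y)` for `p : B → M`: a chart `top` of `B` and a chart `base`
of `M` in which `p` is the projection `(x, y) ↦ x`. -/
structure AdaptedChart (p : B → M) where
  top : OpenPartialHomeomorph B (V × F)
  base : OpenPartialHomeomorph M V
  top_mem : top ∈ IsManifold.maximalAtlas 𝓘(ℝ, V × F) ∞ B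
  base_mem : base ∈ IsManifold.maximalAtlas 𝓘(ℝ, V) ∞ M
  mapsTo : ∀ b ∈ top.source, p b ∈ base.source
  fst_eq : ∀ b ∈ top.source, (top b).1 = base (p b)

variable (V F M B) in
/-- A fibred manifold: a map `p : B → M` with natural coordinates around every point of `B`. -/
structure FibredManifold where
  proj : B → M
  exists_chart : ∀ b : B, ∃ c : AdaptedChart (V := V) (F := F) proj, b ∈ c.top.source

variable (P : FibredManifold V F M B)

/-- The tangent map of the projection. -/
def FibredManifold.dproj (b : B) :
    TangentSpace 𝓘(ℝ, V × F) b →L[ℝ] TangentSpace 𝓘(ℝ, V) (P.proj b) :=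
  mfderiv 𝓘(ℝ, V × F) 𝓘(ℝ, V) P.proj b

variable {P} in
theorem AdaptedChart.chartD_dproj (c : AdaptedChart (V := V) (F := F) P.proj) {b : B}
    (hb : b ∈ c.top.source) (v : TangentSpace 𝓘(ℝ, V × F) b) :
    chartD c.base (P.proj b) (P.dproj b v) = (chartD c.top b v).1 := by
  have hz := c.mapsTo b hb
  have ht := (mdiff_of_mem c.top_mem).mdifferentiableAt hb
  have hs : MDifferentiableAt 𝓘(ℝ, V) 𝓘(ℝ, V) c.base.symm (c.top b).1 := by
    rw [c.fst_eq b hb]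
    exact (mdiff_of_mem c.base_mem).mdifferentiableAt_symm (c.base.map_source hz)
  have hf : MDifferentiableAt 𝓘(ℝ, V × F) 𝓘(ℝ, V) (Prod.fst : V × F → V) (c.top b) :=
    differentiableAt_fst.mdifferentiableAt
  have hp : MDifferentiableAt 𝓘(ℝ, V × F) 𝓘(ℝ, V) P.proj b := by
    refine (hs.comp b (hf.comp b ht)).congr_of_eventuallyEq ?_
    filter_upwards [c.top.open_source.mem_nhds hb] with y hy
    simp [c.fst_eq y hy, c.mapsTo y hy]
  have hb' := (mdiff_of_mem c.base_mem).mdifferentiableAt hz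
  have e1 := mfderiv_comp b hb' hp
  have e2 := mfderiv_comp b hf ht
  have e3 : mfderiv 𝓘(ℝ, V × F) 𝓘(ℝ, V) (c.base ∘ P.proj) b =
      mfderiv 𝓘(ℝ, V × F) 𝓘(ℝ, V) (Prod.fst ∘ c.top) b := by
    apply Filter.EventuallyEq.mfderiv_eq
    filter_upwards [c.top.open_source.mem_nhds hb] with y hy
    simp [c.fst_eq y hy]
  have e4 : mfderiv 𝓘(ℝ, V × F) 𝓘(ℝ, V) (Prod.fst : V × F → V) (c.top b) =
    ContinuousLinearMap.fst ℝ V F := by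
    rw [mfderiv_eq_fderiv, fderiv_fst]
  rw [e4] at e2
  exact DFunLike.congr_fun (e1.symm.trans (e3.trans e2)) v

/-- The fibre at `b` of the first jet bundle `J¹B → B`: the `1`-jet at `x = p b` of a local section
through `b` is its tangent map, a linear section `T_x M → T_b B` of `T_b p`. -/
def JetAt (b : B) : Type _ :=
  {l : TangentSpace 𝓘(ℝ, V) (P.proj b) →L[ℝ] TangentSpace 𝓘(ℝ, V × F) b //
    (P.dproj b).comp l = ContinuousLinearMap.id ℝ _}

/-- The first jet bundle `J¹B` of the fibred manifold `p : B → M`. -/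
structure Jet1 where
  pt : B
  val : JetAt P pt

variable {P}

namespace AdaptedChart

variable (c c' : AdaptedChart (V := V) (F := F) P.proj)

/-- The coordinates `v = (v^A_α)` of a jet: its expression in the charts is `u ↦ (u, v u)`. -/
def jetCoord (j : Jet1 P) : V →L[ℝ] F :=
  (ContinuousLinearMap.snd ℝ V F).comp
    ((chartD c.top j.pt).comp (j.val.1.comp (chartDinv c.base (P.proj j.pt))))

/-- The jet at `b` with coordinates `v = A`. -/
def jetOfCoord {b : B} (hb : b ∈ c.top.source) (A : V →L[ℝ] F) : JetAt P b :=
  ⟨(chartDinv c.top b).comp (((ContinuousLinearMap.id ℝ V).prod A).comp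
    (chartD c.base (P.proj b))), by
    ext u
    apply (chartD_invertible c.base_mem (c.mapsTo b hb)).injective
    simp [c.chartD_dproj hb, chartD_chartDinv c.top_mem hb]⟩

theorem chartD_jet {j : Jet1 P} (hj : j.pt ∈ c.top.source) (u : V) :
    chartD c.top j.pt (j.val.1 (chartDinv c.base (P.proj j.pt) u)) = (u, c.jetCoord j u) := by
  refine Prod.ext ?_ rfl
  rw [← c.chartD_dproj hj]
  have := DFunLike.congr_fun j.val.2 (chartDinv c.base (P.proj j.pt) u)
  simp only [ContinuousLinearMap.comp_apply] at this
  rw [this]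
  exact chartD_chartDinv c.base_mem (c.mapsTo _ hj) u

@[simp]
theorem jetCoord_jetOfCoord {b : B} (hb : b ∈ c.top.source) (A : V →L[ℝ] F) :
    c.jetCoord ⟨b, c.jetOfCoord hb A⟩ = A := by
  ext u
  simp [jetCoord, jetOfCoord, chartD_chartDinv c.top_mem hb,
    chartD_chartDinv c.base_mem (c.mapsTo b hb)]

theorem jet_ext {j j' : Jet1 P} (hj : j.pt ∈ c.top.source) (h : j.pt = j'.pt)
    (h' : c.jetCoord j = c.jetCoord j') : j = j' := by
  obtain ⟨b, l⟩ := j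
  obtain ⟨b', l'⟩ := j'
  obtain rfl : b = b' := h
  congr 1
  apply Subtype.ext
  ext u
  have key : chartD c.top b (l.1 u) = chartD c.top b (l'.1 u) := by
    have e1 := c.chartD_jet (j := ⟨b, l⟩) hj (chartD c.base (P.proj b) u)
    have e2 := c.chartD_jet (j := ⟨b, l'⟩) hj (chartD c.base (P.proj b) u)
    simp only [chartDinv_chartD c.base_mem (c.mapsTo b hj)] at e1 e2
    rw [e1, e2, h']
  exact (chartD_invertible c.top_mem hj).injective key

theorem snd_chartD_eq {b : B} (hc : b ∈ c.top.source) (hc' : b ∈ c'.top.source) (A : V →L[ℝ] F) :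
    c'.jetCoord ⟨b, c.jetOfCoord hc A⟩ = (ContinuousLinearMap.snd ℝ V F).comp
      ((fderiv ℝ (c'.top ∘ c.top.symm) (c.top b)).comp
        (((ContinuousLinearMap.id ℝ V).prod A).comp
          (fderiv ℝ (c.base ∘ c'.base.symm) (c'.base (P.proj b))))) := by
  rw [← chartD_comp_chartDinv c.top_mem c'.top_mem hc hc',
    ← chartD_comp_chartDinv c'.base_mem c.base_mem (c'.mapsTo b hc') (c.mapsTo b hc)]
  rfl

end AdaptedChart

instance (b : B) : Nonempty (JetAt P b) := by
  obtain ⟨c, hc⟩ := P.exists_chart b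
  exact ⟨c.jetOfCoord hc 0⟩

open Classical in
/-- Natural coordinates `(x, y, v)` of the first jet bundle. -/
def AdaptedChart.jetChart (c : AdaptedChart (V := V) (F := F) P.proj) :
    PartialEquiv (Jet1 P) ((V × F) × (V →L[ℝ] F)) where
  toFun j := (c.top j.pt, c.jetCoord j)
  invFun q := ⟨c.top.symm q.1,
    if h : q.1 ∈ c.top.target then c.jetOfCoord (c.top.map_target h) q.2
    else Classical.arbitrary _⟩
  source := {j | j.pt ∈ c.top.source}
  target := c.top.target ×ˢ univ
  map_source' j hj := ⟨c.top.map_source hj, mem_univ _⟩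
  map_target' q hq := c.top.map_target hq.1
  left_inv' j hj := by
    have hj' : c.top j.pt ∈ c.top.target := c.top.map_source hj
    have e : c.top.symm (c.top j.pt) = j.pt := c.top.left_inv hj
    refine c.jet_ext (by simpa [e] using hj) e ?_
    simp only [hj', dif_pos, AdaptedChart.jetCoord_jetOfCoord]
  right_inv' q hq := by
    simp only [hq.1, dif_pos, AdaptedChart.jetCoord_jetOfCoord, c.top.right_inv hq.1]

theorem AdaptedChart.jetChart_transition (c c' : AdaptedChart (V := V) (F := F) P.proj)
    (q : (V × F) × (V →L[ℝ] F)) (hq : q ∈ (c.jetChart.symm.trans c'.jetChart).source) :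
    c.jetChart.symm.trans c'.jetChart q = ((c'.top ∘ c.top.symm) q.1,
      (ContinuousLinearMap.snd ℝ V F).comp ((fderiv ℝ (c'.top ∘ c.top.symm) q.1).comp
        (((ContinuousLinearMap.id ℝ V).prod q.2).comp
          (fderiv ℝ (c.base ∘ c'.base.symm) ((c'.top ∘ c.top.symm) q.1).1)))) := by
  have h1 : q.1 ∈ c.top.target := hq.1.1
  have h2 : c.top.symm q.1 ∈ c'.top.source := hq.2
  refine Prod.ext rfl ?_
  change c'.jetCoord ⟨c.top.symm q.1, _⟩ = _
  simp only [h1, dif_pos]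
  rw [AdaptedChart.snd_chartD_eq c c' (c.top.map_target h1) h2, c.top.right_inv h1,
    Function.comp_apply, c'.fst_eq _ h2]

theorem AdaptedChart.jetChart_transition_source
    (c c' : AdaptedChart (V := V) (F := F) P.proj) :
    (c.jetChart.symm.trans c'.jetChart).source = (c.top.symm.trans c'.top).source ×ˢ univ := by
  ext q
  exact ⟨fun h => ⟨⟨h.1.1, h.2⟩, trivial⟩, fun h => ⟨⟨h.1.1, trivial⟩, h.1.2⟩⟩

variable (P) in
open Classical in
/-- The natural charts of `J¹`. -/
def jetAtlas : SmoothAtlas ((V × F) × (V →L[ℝ] F)) (Jet1 P) where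
  charts := range (AdaptedChart.jetChart (P := P))
  chart j := (P.exists_chart j.pt).choose.jetChart
  mem_source j := (P.exists_chart j.pt).choose_spec
  chart_mem j := mem_range_self _
  open_source := by
    rintro _ ⟨c, rfl⟩ _ ⟨c', rfl⟩
    rw [AdaptedChart.jetChart_transition_source]
    exact (c.top.symm.trans c'.top).open_source.prod isOpen_univ
  contDiffOn := by
    rintro _ ⟨c, rfl⟩ _ ⟨c', rfl⟩
    refine ContDiffOn.congr ?_ (c.jetChart_transition c')
    have hm : MapsTo Prod.fst (c.jetChart.symm.trans c'.jetChart).source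
        (c.top.symm.trans c'.top).source := by
      intro q hq
      exact ⟨hq.1.1, hq.2⟩
    have t1 : ContDiffOn ℝ ∞ (fun q : (V × F) × (V →L[ℝ] F) => (c'.top ∘ c.top.symm) q.1)
        (c.jetChart.symm.trans c'.jetChart).source :=
      (contDiffOn_transition c.top_mem c'.top_mem).comp contDiff_fst.contDiffOn hm
    have t2 : ContDiffOn ℝ ∞
        (fun q : (V × F) × (V →L[ℝ] F) => fderiv ℝ (c'.top ∘ c.top.symm) q.1)
        (c.jetChart.symm.trans c'.jetChart).source :=
      (contDiffOn_fderiv_transition c.top_mem c'.top_mem).comp contDiff_fst.contDiffOn hm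
    have t3 : ContDiffOn ℝ ∞ (fun q : (V × F) × (V →L[ℝ] F) =>
        fderiv ℝ (c.base ∘ c'.base.symm) ((c'.top ∘ c.top.symm) q.1).1)
        (c.jetChart.symm.trans c'.jetChart).source := by
      refine (contDiffOn_fderiv_transition c'.base_mem c.base_mem).comp
        (contDiff_fst.comp_contDiffOn t1) ?_
      intro q hq
      have h1 : q.1 ∈ c.top.target := hq.1.1
      have h2 : c.top.symm q.1 ∈ c'.top.source := hq.2
      have h3 := c'.mapsTo _ h2
      have h4 := c.mapsTo _ (c.top.map_target h1)
      simp [c'.fst_eq _ h2, h3, h4]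
    have t4 : ContDiffOn ℝ ∞ (fun q : (V × F) × (V →L[ℝ] F) =>
        (ContinuousLinearMap.id ℝ V).prod q.2)
        (c.jetChart.symm.trans c'.jetChart).source := by
      have : (fun q : (V × F) × (V →L[ℝ] F) => (ContinuousLinearMap.id ℝ V).prod q.2) =
          fun q => ContinuousLinearMap.inl ℝ V F + (ContinuousLinearMap.inr ℝ V F).comp q.2 := by
        funext q; ext u <;> simp
      rw [this]
      exact (contDiff_const.add (contDiff_const.clm_comp contDiff_snd)).contDiffOn
    exact t1.prodMk (contDiffOn_const.clm_comp (t2.clm_comp (t4.clm_comp t3)))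

instance : TopologicalSpace (Jet1 P) := (jetAtlas P).core.toTopologicalSpace

instance : ChartedSpace ((V × F) × (V →L[ℝ] F)) (Jet1 P) := (jetAtlas P).core.toChartedSpace

instance : IsManifold 𝓘(ℝ, (V × F) × (V →L[ℝ] F)) ∞ (Jet1 P) := (jetAtlas P).isManifold


section Momentum

/-- The `m`-forms on `X` that vanish when two of their arguments lie in the kernel of `T`. -/
def twoVerticalForms {X Y : Type*} [AddCommGroup X] [Module ℝ X] [TopologicalSpace X]
    [AddCommGroup Y] [Module ℝ Y] [TopologicalSpace Y] (m : ℕ) (T : X →L[ℝ] Y) :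
    Submodule ℝ (X [⋀^Fin m]→L[ℝ] ℝ) where
  carrier := {w | ∀ (Z : Fin m → X) (i j : Fin m), i ≠ j → T (Z i) = 0 → T (Z j) = 0 → w Z = 0}
  add_mem' h h' Z i j hij hi hj := by simp [h Z i j hij hi hj, h' Z i j hij hi hj]
  zero_mem' := by simp
  smul_mem' a w h Z i j hij hi hj := by simp [h Z i j hij hi hj]

variable (P) in
/-- The fibre at `b` of the extended multimomentum bundle `𝓜p = Λ₁ᵐ T*B`: the `m`-forms on `T_b B`
that vanish on any two vertical vectors. -/
abbrev MomentumAt (m : ℕ) (b : B) : Type _ := twoVerticalForms m (P.dproj b)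

variable (V F) in
/-- The typical fibre of the extended multimomentum bundle. -/
abbrev MomentumModel (m : ℕ) : Type _ := twoVerticalForms m (ContinuousLinearMap.fst ℝ V F)

variable (P) in
/-- The extended multimomentum bundle `𝓜p = Λ₁ᵐ T*B` of the fibred manifold `p : B → M`. -/
structure Momentum (m : ℕ) where
  pt : B
  form : MomentumAt P m pt

variable {m : ℕ}

namespace AdaptedChart

variable (c c' : AdaptedChart (V := V) (F := F) P.proj)

/-- The coordinates at `b` of a form: its expression in the chart. -/
def momentumCoord {b : B} (hb : b ∈ c.top.source) (w : MomentumAt P m b) : MomentumModel V F m :=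
  ⟨w.1.compContinuousLinearMap (chartDinv c.top b), by
    intro Z i j hij hi hj
    refine w.2 _ i j hij ?_ ?_ <;>
    · apply (chartD_invertible c.base_mem (c.mapsTo b hb)).injective
      rw [c.chartD_dproj hb]
      simpa [chartD_chartDinv c.top_mem hb]⟩

/-- The form at `b` with given coordinates. -/
def momentumOfCoord {b : B} (hb : b ∈ c.top.source) (a : MomentumModel V F m) : MomentumAt P m b :=
  ⟨a.1.compContinuousLinearMap (chartD c.top b), by
    intro Z i j hij hi hj
    refine a.2 _ i j hij ?_ ?_ <;>
    · simp [← c.chartD_dproj hb, hi, hj]⟩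

@[simp]
theorem momentumCoord_momentumOfCoord_self {b : B} (hb hb' : b ∈ c.top.source)
    (a : MomentumModel V F m) : c.momentumCoord hb' (c.momentumOfCoord hb a) = a := by
  apply Subtype.ext
  apply ContinuousAlternatingMap.ext
  intro Z
  refine congrArg a.1 (funext fun i => ?_)
  exact chartD_chartDinv c.top_mem hb (Z i)

theorem momentum_ext {w w' : Momentum P m} (h : w.pt = w'.pt) (hw : w.pt ∈ c.top.source)
    (h' : ∀ hw' : w'.pt ∈ c.top.source,
      c.momentumCoord hw w.form = c.momentumCoord hw' w'.form) : w = w' := by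
  obtain ⟨b, w⟩ := w
  obtain ⟨b', w'⟩ := w'
  obtain rfl : b = b' := h
  congr 1
  apply Subtype.ext
  apply ContinuousAlternatingMap.ext
  intro Z
  have := DFunLike.congr_fun (congrArg Subtype.val (h' hw)) (fun i => chartD c.top b (Z i))
  have e : (fun i => chartDinv c.top b (chartD c.top b (Z i))) = Z :=
    funext fun i => chartDinv_chartD c.top_mem hw (Z i)
  rw [← e]
  exact this

open Classical in
/-- Natural coordinates `(x, y, p)` of the extended multimomentum bundle. -/
def momentumChart : PartialEquiv (Momentum P m) (V × (F × MomentumModel V F m)) where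
  toFun w := ((c.top w.pt).1, (c.top w.pt).2,
    if h : w.pt ∈ c.top.source then c.momentumCoord h w.form else 0)
  invFun q := ⟨c.top.symm (q.1, q.2.1),
    if h : (q.1, q.2.1) ∈ c.top.target then c.momentumOfCoord (c.top.map_target h) q.2.2 else 0⟩
  source := {w | w.pt ∈ c.top.source}
  target := {q | (q.1, q.2.1) ∈ c.top.target}
  map_source' w hw := c.top.map_source hw
  map_target' q hq := c.top.map_target hq
  left_inv' w hw := by
    have hw : w.pt ∈ c.top.source := hw
    have e : c.top.symm (c.top w.pt) = w.pt := c.top.left_inv hw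
    refine c.momentum_ext e (by simpa [e] using hw) fun hw' => ?_
    simp only [Prod.mk.eta, c.top.map_source hw, hw, dif_pos, momentumCoord_momentumOfCoord_self]
  right_inv' q hq := by
    have hq : (q.1, q.2.1) ∈ c.top.target := hq
    have h2 := c.top.map_target hq
    refine Prod.ext (by simp [c.top.right_inv hq])
      (Prod.ext (by simp [c.top.right_inv hq]) ?_)
    simp only [hq, h2, dif_pos, momentumCoord_momentumOfCoord_self]

theorem momentumChart_transition_source :
    ((c.momentumChart (m := m)).symm.trans c'.momentumChart).source =
      {q | (q.1, q.2.1) ∈ (c.top.symm.trans c'.top).source} := by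
  ext q
  exact ⟨fun h => ⟨h.1, h.2⟩, fun h => ⟨h.1, h.2⟩⟩

/-- The coordinates of a form in a second chart. -/
theorem momentumCoord_momentumOfCoord {b : B} (hb : b ∈ c.top.source) (hb' : b ∈ c'.top.source)
    (a : MomentumModel V F m) :
    (c'.momentumCoord hb' (c.momentumOfCoord hb a)).1 =
      a.1.compContinuousLinearMap (fderiv ℝ (c.top ∘ c'.top.symm) (c'.top b)) := by
  rw [← chartD_comp_chartDinv c'.top_mem c.top_mem hb' hb]
  rfl

open Classical in
theorem momentumChart_transition (q : V × (F × MomentumModel V F m))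
    (h1 : (q.1, q.2.1) ∈ c.top.target) (h2 : c.top.symm (q.1, q.2.1) ∈ c'.top.source) :
    (c.momentumChart.symm.trans c'.momentumChart q).2.2.1 = q.2.2.1.compContinuousLinearMap
      (fderiv ℝ (c.top ∘ c'.top.symm) (c'.top (c.top.symm (q.1, q.2.1)))) := by
  rw [← momentumCoord_momentumOfCoord c c' (c.top.map_target h1) h2]
  change (dite (c.top.symm (q.1, q.2.1) ∈ c'.top.source) (fun h => c'.momentumCoord h
    (dite ((q.1, q.2.1) ∈ c.top.target)
      (fun h' => c.momentumOfCoord (c.top.map_target h') q.2.2) (fun _ => 0)))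
        (fun _ => 0)).1 = _
  rw [dif_pos h2, dif_pos h1]

end AdaptedChart

instance {X : Type*} [NormedAddCommGroup X] [NormedSpace ℝ X] [FiniteDimensional ℝ X] :
    FiniteDimensional ℝ (ContinuousMultilinearMap ℝ (fun _ : Fin m => X) ℝ) :=
  FiniteDimensional.of_injective
    (ContinuousMultilinearMap.toMultilinearMapLinear :
      ContinuousMultilinearMap ℝ (fun _ : Fin m => X) ℝ →ₗ[ℝ] _)
    ContinuousMultilinearMap.toMultilinearMap_injective

/-- Smoothness can be tested after an injective linear map into a finite dimensional space. -/
theorem contDiffOn_of_injective {W Z Q : Type*} [NormedAddCommGroup W] [NormedSpace ℝ W]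
    [NormedAddCommGroup Z] [NormedSpace ℝ Z] [FiniteDimensional ℝ Z]
    [NormedAddCommGroup Q] [NormedSpace ℝ Q] (T : W →L[ℝ] Z) (hT : Function.Injective T)
    {f : Q → W} {s : Set Q} (h : ContDiffOn ℝ ∞ (fun q => T (f q)) s) : ContDiffOn ℝ ∞ f s := by
  obtain ⟨r, hr⟩ := LinearMap.exists_leftInverse_of_injective T.toLinearMap
    (LinearMap.ker_eq_bot.2 hT)
  have : f = fun q => LinearMap.toContinuousLinearMap r (T (f q)) := by
    funext q
    exact (DFunLike.congr_fun hr (f q)).symm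
  rw [this]
  exact (LinearMap.toContinuousLinearMap r).contDiff.comp_contDiffOn h

theorem contDiff_compContinuousLinearMap {X : Type*} [NormedAddCommGroup X] [NormedSpace ℝ X] :
    ContDiff ℝ ∞ (fun q : (X →L[ℝ] X) × ContinuousMultilinearMap ℝ (fun _ : Fin m => X) ℝ =>
      q.2.compContinuousLinearMap (fun _ => q.1)) := by
  exact ((ContinuousMultilinearMap.compContinuousLinearMapContinuousMultilinear ℝ
    (fun _ : Fin m => X) (fun _ => X) ℝ).contDiff.comp
      (contDiff_pi.2 fun _ => contDiff_fst)).clm_apply contDiff_snd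

variable [FiniteDimensional ℝ V] [FiniteDimensional ℝ F]

variable (P m) in
/-- The natural charts of the extended multimomentum bundle. -/
def momentumAtlas : SmoothAtlas (V × (F × MomentumModel V F m)) (Momentum P m) where
  charts := range (AdaptedChart.momentumChart (P := P))
  chart j := (P.exists_chart j.pt).choose.momentumChart
  mem_source j := (P.exists_chart j.pt).choose_spec
  chart_mem j := mem_range_self _
  open_source := by
    rintro _ ⟨c, rfl⟩ _ ⟨c', rfl⟩
    rw [AdaptedChart.momentumChart_transition_source]
    exact (c.top.symm.trans c'.top).open_source.preimage
      (continuous_fst.prodMk (continuous_fst.comp continuous_snd))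
  contDiffOn := by
    rintro _ ⟨c, rfl⟩ _ ⟨c', rfl⟩
    have hz : ContDiff ℝ ∞ (fun q : V × (F × MomentumModel V F m) => (q.1, q.2.1)) := by fun_prop
    rw [AdaptedChart.momentumChart_transition_source]
    have t1 := (contDiffOn_transition c.top_mem c'.top_mem).comp hz.contDiffOn
      (s := {q : V × (F × MomentumModel V F m) | (q.1, q.2.1) ∈ (c.top.symm.trans c'.top).source})
      (fun q hq => hq)
    have t2 := (contDiffOn_fderiv_transition c'.top_mem c.top_mem).comp t1 (by
      intro q hq
      have h1 : (q.1, q.2.1) ∈ c.top.target := hq.1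
      have h2 : c.top.symm (q.1, q.2.1) ∈ c'.top.source := hq.2
      simp [h2, c.top.map_target h1])
    refine (contDiff_fst.comp_contDiffOn t1).prodMk ((contDiff_snd.comp_contDiffOn t1).prodMk ?_)
    refine contDiffOn_of_injective ((ContinuousAlternatingMap.toContinuousMultilinearMapCLM ℝ).comp
      (Submodule.subtypeL (twoVerticalForms m (ContinuousLinearMap.fst ℝ V F))))
      (fun a b h => Subtype.ext
        (ContinuousAlternatingMap.toContinuousMultilinearMap_injective h)) ?_
    refine (contDiff_compContinuousLinearMap.comp_contDiffOn (t2.prodMk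
      (((ContinuousAlternatingMap.toContinuousMultilinearMapCLM ℝ).comp
        (Submodule.subtypeL (twoVerticalForms m (ContinuousLinearMap.fst ℝ V F)))).contDiff.comp
          (contDiff_snd.comp contDiff_snd)).contDiffOn)).congr ?_
    intro q hq
    have h1 : (q.1, q.2.1) ∈ c.top.target := hq.1
    have h2 : c.top.symm (q.1, q.2.1) ∈ c'.top.source := hq.2
    change ContinuousAlternatingMap.toContinuousMultilinearMap
      (c.momentumChart.symm.trans c'.momentumChart q).2.2.1 = _
    rw [AdaptedChart.momentumChart_transition c c' q h1 h2]
    rfl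

instance : TopologicalSpace (Momentum P m) := (momentumAtlas P m).core.toTopologicalSpace

instance : ChartedSpace (V × (F × MomentumModel V F m)) (Momentum P m) :=
  (momentumAtlas P m).core.toChartedSpace

instance : IsManifold 𝓘(ℝ, V × (F × MomentumModel V F m)) ∞ (Momentum P m) :=
  (momentumAtlas P m).isManifold

variable (P m) in
/-- The extended multimomentum bundle as a fibred manifold over `M`. -/
def momentumFibred : FibredManifold V (F × MomentumModel V F m) M (Momentum P m) where
  proj w := P.proj w.pt
  exists_chart w := by
    obtain ⟨c, hc⟩ := P.exists_chart w.pt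
    have hmem : c.momentumChart ∈ (momentumAtlas P m).core.atlas := ⟨c, rfl⟩
    refine ⟨⟨(momentumAtlas P m).core.openPartialHomeomorph c.momentumChart hmem, c.base,
      ?_, c.base_mem, fun b hb => c.mapsTo _ hb, fun b hb => c.fst_eq _ hb⟩, hc⟩
    refine StructureGroupoid.subset_maximalAtlas _ ?_
    exact mem_iUnion₂.2 ⟨c.momentumChart, hmem, rfl⟩

end Momentum

end Fibred

section Bundle

variable {m N : ℕ} {M E Φ : Type*}
  [TopologicalSpace M] [ChartedSpace (EuclideanSpace ℝ (Fin m)) M]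
  [TopologicalSpace Φ] [ChartedSpace (EuclideanSpace ℝ (Fin N)) Φ]
  [TopologicalSpace E]
  [ChartedSpace (EuclideanSpace ℝ (Fin m) × EuclideanSpace ℝ (Fin N)) E]

variable (m N M E Φ) in
/-- A smooth fibre bundle `π : E → M` with typical fibre `Φ`, `dim M = m` and `dim E = m + N`. -/
structure SmoothFibreBundle where
  proj : E → M
  exists_trivialization : ∀ x : M, ∃ e : Bundle.Trivialization Φ proj, x ∈ e.baseSet ∧
    ContMDiffOn 𝓘(ℝ, EuclideanSpace ℝ (Fin m) × EuclideanSpace ℝ (Fin N))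
      ((𝓡 m).prod (𝓡 N)) ∞ e e.source ∧
    ContMDiffOn ((𝓡 m).prod (𝓡 N))
      𝓘(ℝ, EuclideanSpace ℝ (Fin m) × EuclideanSpace ℝ (Fin N)) ∞
      e.toOpenPartialHomeomorph.symm e.target

variable [IsManifold (𝓡 m) ∞ M] [IsManifold (𝓡 N) ∞ Φ]
  [IsManifold 𝓘(ℝ, EuclideanSpace ℝ (Fin m) × EuclideanSpace ℝ (Fin N)) ∞ E]

/-- Natural coordinates of a smooth fibre bundle, from a local trivialization. -/
def SmoothFibreBundle.fibred (π : SmoothFibreBundle m N M E Φ) :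
    FibredManifold (EuclideanSpace ℝ (Fin m)) (EuclideanSpace ℝ (Fin N)) M E where
  proj := π.proj
  exists_chart b := by
    obtain ⟨e, hx, he, he'⟩ := π.exists_trivialization (π.proj b)
    have hb : b ∈ e.source := e.mem_source.2 hx
    let ψ := chartAt (EuclideanSpace ℝ (Fin m)) (π.proj b)
    let χ := chartAt (EuclideanSpace ℝ (Fin N)) (e b).2
    let top : OpenPartialHomeomorph E (EuclideanSpace ℝ (Fin m) × EuclideanSpace ℝ (Fin N)) :=
      e.toOpenPartialHomeomorph.trans (ψ.prod χ)
    have hψ : ψ ∈ IsManifold.maximalAtlas (𝓡 m) ∞ M := IsManifold.chart_mem_maximalAtlas _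
    have hχ : χ ∈ IsManifold.maximalAtlas (𝓡 N) ∞ Φ := IsManifold.chart_mem_maximalAtlas _
    have hs : ∀ y ∈ top.source, y ∈ e.source ∧ π.proj y ∈ ψ.source ∧ (e y).2 ∈ χ.source := by
      intro y hy
      have h1 : y ∈ e.source := by
        have := hy
        simp only [top, OpenPartialHomeomorph.trans_source] at this
        exact this.1
      have h2 : e y ∈ ψ.source ×ˢ χ.source := by
        have := hy
        simp only [top, OpenPartialHomeomorph.trans_source] at this
        exact this.2
      exact ⟨h1, by rw [← e.coe_fst h1]; exact h2.1, h2.2⟩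
    refine ⟨⟨top, ψ, ?_, hψ, fun y hy => (hs y hy).2.1, fun y hy => ?_⟩, ?_⟩
    · apply OpenPartialHomeomorph.mem_maximalAtlas_of_contMDiffOn
      · have h0 : ContMDiffOn 𝓘(ℝ, EuclideanSpace ℝ (Fin m) × EuclideanSpace ℝ (Fin N))
            ((𝓡 m).prod (𝓡 N)) ∞ e top.source := he.mono fun y hy => (hs y hy).1
        refine ContMDiffOn.prodMk_space
          ((contMDiffOn_of_mem_maximalAtlas hψ).comp (contMDiff_fst.comp_contMDiffOn h0) ?_)
          ((contMDiffOn_of_mem_maximalAtlas hχ).comp (contMDiff_snd.comp_contMDiffOn h0) ?_)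
        · intro y hy
          have := (hs y hy).2.1
          rw [← e.coe_fst (hs y hy).1] at this
          exact this
        · exact fun y hy => (hs y hy).2.2
      · have ht : ∀ z ∈ top.target, z.1 ∈ ψ.target ∧ z.2 ∈ χ.target ∧
            (ψ.symm z.1, χ.symm z.2) ∈ e.target := by
          intro z hz
          have := hz
          simp only [top, OpenPartialHomeomorph.trans_target] at this
          exact ⟨this.1.1, this.1.2, this.2⟩
        refine he'.comp (ContMDiffOn.prodMk
          ((contMDiffOn_symm_of_mem_maximalAtlas hψ).comp
            contDiff_fst.contMDiff.contMDiffOn fun z hz => (ht z hz).1)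
          ((contMDiffOn_symm_of_mem_maximalAtlas hχ).comp
            contDiff_snd.contMDiff.contMDiffOn fun z hz => (ht z hz).2.1))
          fun z hz => (ht z hz).2.2
    · change ψ (e y).1 = ψ (π.proj y)
      rw [e.coe_fst (hs y hy).1]
    · simp only [top, OpenPartialHomeomorph.trans_source]
      refine ⟨hb, ?_, mem_chart_source _ _⟩
      change (e b).1 ∈ ψ.source
      rw [e.coe_fst hb]
      exact mem_chart_source _ _

end Bundle

section Forms

variable {X N : Type*} [NormedAddCommGroup X] [NormedSpace ℝ X] [TopologicalSpace N]
  [ChartedSpace X N] {n : ℕ}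

/-- The expression of a differential form in a chart. -/
def formInChart (θ : ∀ x : N, TangentSpace 𝓘(ℝ, X) x [⋀^Fin n]→L[ℝ] ℝ)
    (e : OpenPartialHomeomorph N X) (z : X) : X [⋀^Fin n]→L[ℝ] ℝ :=
  (θ (e.symm z)).compContinuousLinearMap (chartDinv e (e.symm z))

/-- Smooth differential forms. -/
def IsSmoothForm (θ : ∀ x : N, TangentSpace 𝓘(ℝ, X) x [⋀^Fin n]→L[ℝ] ℝ) : Prop :=
  ∀ e ∈ atlas X N, ContDiffOn ℝ ∞ (formInChart θ e) e.target

/-- The exterior derivative, computed in the preferred chart at the point. -/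
def extDerivAt (θ : ∀ x : N, TangentSpace 𝓘(ℝ, X) x [⋀^Fin n]→L[ℝ] ℝ) (x : N) :
    TangentSpace 𝓘(ℝ, X) x [⋀^Fin (n + 1)]→L[ℝ] ℝ :=
  (extDeriv (formInChart θ (chartAt X x)) (chartAt X x x)).compContinuousLinearMap
    (chartD (chartAt X x) x)

end Forms

section Algebra

variable {X Y : Type*} [AddCommGroup X] [Module ℝ X] [TopologicalSpace X]
  [AddCommGroup Y] [Module ℝ Y] [TopologicalSpace Y] {m : ℕ}

/-- The form `(Z₁, …, Zₘ) ↦ ∑ᵢ w (T Z₁, …, A Zᵢ, …, T Zₘ)`, with `A Zᵢ` in the `i`-th place. -/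
def insertForm (w : Y [⋀^Fin m]→L[ℝ] ℝ) (T A : X →L[ℝ] Y) : X [⋀^Fin m]→L[ℝ] ℝ where
  toContinuousMultilinearMap := ∑ i, w.toContinuousMultilinearMap.compContinuousLinearMap
    fun j => if j = i then A else T
  map_eq_zero_of_eq' := by
    intro v i j hv hij
    have happ : ∀ k, w.toContinuousMultilinearMap.compContinuousLinearMap
        (fun l => if l = k then A else T) v = w fun l => (if l = k then A else T) (v l) :=
      fun k => rfl
    change (∑ k, w.toContinuousMultilinearMap.compContinuousLinearMap
      fun l => if l = k then A else T) v = 0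
    rw [sum_apply, Finset.sum_eq_add i j hij]
    · have h : (fun l => (if l = i then A else T) (v l)) =
          (fun l => (if l = j then A else T) (v l)) ∘ Equiv.swap i j := by
        funext l
        rcases eq_or_ne l i with rfl | hi
        · simp [hv]
        · rcases eq_or_ne l j with rfl | hj
          · simp [hv, hij, hij.symm]
          · simp [hi, hj, Equiv.swap_apply_of_ne_of_ne hi hj]
      rw [happ, happ, h]
      exact w.toAlternatingMap.map_swap_add _ hij
    · rintro k - ⟨hki, hkj⟩
      rw [happ]
      exact w.map_eq_zero_of_eq _ (by simp [hv, hki.symm, hkj.symm]) hij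
    · simp
    · simp

theorem insertForm_apply (w : Y [⋀^Fin m]→L[ℝ] ℝ) (T A : X →L[ℝ] Y) (Z : Fin m → X) :
    insertForm w T A Z = ∑ i, w (Function.update (fun j => T (Z j)) i (A (Z i))) := by
  change (∑ k, w.toContinuousMultilinearMap.compContinuousLinearMap
      fun l => if l = k then A else T) Z = _
  rw [sum_apply]
  refine Finset.sum_congr rfl fun i _ => congrArg w (funext fun l => ?_)
  rcases eq_or_ne l i with rfl | h <;> simp [*]
/-- The multivector `u` represents the class of `m`-vectors of the range of `l`: it is the exterior
product of the image of a basis. -/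
def Represents (l : Y →L[ℝ] X) (u : ⋀[ℝ]^m X) : Prop :=
  ∃ b : Module.Basis (Fin m) ℝ Y, u = exteriorPower.ιMulti ℝ m fun i => l (b i)

/-- The value `w(u₁, …, uₘ)` for `u = u₁ ∧ … ∧ uₘ`, extended linearly. -/
def evalForm (w : X [⋀^Fin m]→L[ℝ] ℝ) (u : ⋀[ℝ]^m X) : ℝ :=
  exteriorPower.alternatingMapLinearEquiv w.toAlternatingMap u

/-- The contraction `i(u)w`: `Z ↦ w(u₁, …, uₘ, Z)` for `u = u₁ ∧ … ∧ uₘ`, extended linearly. -/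
def contractForm (w : X [⋀^Fin (m + 1)]→L[ℝ] ℝ) (u : ⋀[ℝ]^m X) (Z : X) : ℝ :=
  (-1) ^ m * exteriorPower.alternatingMapLinearEquiv (w.toAlternatingMap.curryLeft Z) u

end Algebra

/-- The Euclidean model space. -/
abbrev Eu (m : ℕ) : Type := EuclideanSpace ℝ (Fin m)

/-- Linear maps from `ℝᵐ` to a normed space. -/
abbrev EuHom (m : ℕ) (F : Type*) [NormedAddCommGroup F] [NormedSpace ℝ F] : Type _ :=
  Eu m →L[ℝ] F

/-- The model space of `J¹B`, with coordinates `(x, y, v)`. -/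
abbrev JetModel (m : ℕ) (F : Type*) [NormedAddCommGroup F] [NormedSpace ℝ F] : Type _ :=
  (Eu m × F) × EuHom m F

/-- The model space of the extended multimomentum bundle, with coordinates `(x, y, p)`. -/
abbrev MomModel (m : ℕ) (F : Type*) [NormedAddCommGroup F] [NormedSpace ℝ F] : Type _ :=
  Eu m × (F × MomentumModel (Eu m) F m)

section Field

variable {m : ℕ} {F M B : Type*} [NormedAddCommGroup F] [NormedSpace ℝ F] [FiniteDimensional ℝ F]
  [TopologicalSpace M] [ChartedSpace (Eu m) M]
  [TopologicalSpace B] [ChartedSpace (Eu m × F) B]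

variable (m) in
/-- The tangent space `T_x M`. -/
abbrev TBase (x : M) : Type _ := TangentSpace 𝓘(ℝ, Eu m) x

variable (m F) in
/-- The tangent space `T_b B`. -/
abbrev TTotal (b : B) : Type _ := TangentSpace 𝓘(ℝ, Eu m × F) b

variable {P : FibredManifold (Eu m) F M B}

/-- The tangent space of `J¹B` at `j`. -/
abbrev TJet (j : Jet1 P) : Type _ := TangentSpace 𝓘(ℝ, JetModel m F) j

/-- The tangent space of the extended multimomentum bundle at `w`. -/
abbrev TMom (w : Momentum P m) : Type _ := TangentSpace 𝓘(ℝ, MomModel m F) w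

/-- The tangent map of the projection of the extended multimomentum bundle to `B`. -/
def Momentum.dpt (w : Momentum P m) : TMom w →L[ℝ] TTotal m F w.pt :=
  mfderiv 𝓘(ℝ, MomModel m F) 𝓘(ℝ, Eu m × F) Momentum.pt w

/-- The canonical (Liouville) `m`-form `Θ` of the extended multimomentum bundle. -/
def Momentum.theta (w : Momentum P m) : TMom w [⋀^Fin m]→L[ℝ] ℝ :=
  w.form.1.compContinuousLinearMap w.dpt

/-- The multisymplectic form `Ω = -dΘ` of the extended multimomentum bundle. -/
def Momentum.omega (w : Momentum P m) : TMom w [⋀^Fin (m + 1)]→L[ℝ] ℝ :=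
  -extDerivAt Momentum.theta w

/-- The displacement of the jet `j` by the vertical part (along `j`) of `η`; for `η` with vertical
values this is `j + η` in the affine fibre of `J¹B`. -/
def JetAt.shift {b : B} (j : JetAt P b) (η : TBase m (P.proj b) →L[ℝ] TTotal m F b) : JetAt P b :=
  ⟨j.1 + (η - j.1.comp ((P.dproj b).comp η)), by
    have h := DFunLike.congr_fun j.2
    simp only [ContinuousLinearMap.comp_apply, ContinuousLinearMap.id_apply] at h
    ext u
    simp [h]⟩

variable (P) in
/-- A Lagrangian system: a volume form `ω` on `M` and a Lagrangian function `£` on `J¹B`, which give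
the Lagrangian density `£ω`. -/
structure LagrangianSystem where
  vol : ∀ x : M, TBase m x [⋀^Fin m]→L[ℝ] ℝ
  vol_smooth : IsSmoothForm vol
  vol_ne_zero : ∀ x, vol x ≠ 0
  lag : Jet1 P → ℝ
  lag_smooth : ContMDiff 𝓘(ℝ, JetModel m F) 𝓘(ℝ, ℝ) ∞ lag

namespace LagrangianSystem

variable (L : LagrangianSystem P)

/-- The map `Z ↦ ∑_ν d£(e^ν ⊗ θ(Z)) e_ν`, where `θ(Z)` is the vertical part of `Z` along `j` and
`d£` is the differential of `£` on the affine fibre of `J¹B`. In coordinates it is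
`∂£/∂v^A_ν (dy^A - v^A_α dx^α) ⊗ ∂/∂x^ν`: the contraction of the vertical endomorphism with `d£`. -/
def momentumMap (j : Jet1 P) : TTotal m F j.pt →L[ℝ] TBase m (P.proj j.pt) :=
  let D : (Eu m →L[ℝ] Eu m × F) →L[ℝ] ℝ := fderiv ℝ (fun η => L.lag ⟨j.pt, j.val.shift η⟩) 0
  ∑ ν, (D.comp (ContinuousLinearMap.smulRightL ℝ (Eu m) (Eu m × F)
    (EuclideanSpace.proj ν))).smulRight (EuclideanSpace.single ν (1 : ℝ))

/-- The extended Legendre map. Its value at `j` is the form at `j.pt` whose pullback to `J¹B` is the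
Poincaré-Cartan form `Θ_𝓛 = i(𝒱)𝓛 + 𝓛`, that is
`∂£/∂v^A_ν (dy^A - v^A_α dx^α) ∧ i(∂/∂x^ν)ω + £ω`. -/
def legendre (j : Jet1 P) : Momentum P m :=
  ⟨j.pt, insertForm (L.vol (P.proj j.pt)) (P.dproj j.pt) (L.momentumMap j) +
    L.lag j • (L.vol (P.proj j.pt)).compContinuousLinearMap (P.dproj j.pt), by
    intro Z i k hik hi hk
    have h1 : (L.vol (P.proj j.pt)).compContinuousLinearMap (P.dproj j.pt) Z = 0 :=
      (L.vol (P.proj j.pt)).map_coord_zero i hi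
    have h2 : insertForm (L.vol (P.proj j.pt)) (P.dproj j.pt) (L.momentumMap j) Z = 0 := by
      rw [insertForm_apply]
      refine Finset.sum_eq_zero fun l _ => ?_
      rcases eq_or_ne l i with rfl | hl
      · exact (L.vol (P.proj j.pt)).map_coord_zero k (by simp [hik.symm, hk])
      · exact (L.vol (P.proj j.pt)).map_coord_zero i (by simp [hl.symm, hi])
    simp [h1, h2]⟩

/-- The tangent map of the extended Legendre map. -/
def dlegendre (j : Jet1 P) : TJet j →L[ℝ] TMom (L.legendre j) :=
  mfderiv 𝓘(ℝ, JetModel m F) 𝓘(ℝ, MomModel m F) L.legendre j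

/-- The tangent map, at the point `legendre j`, of the projection of the extended multimomentum
bundle to `M`. -/
def dbase (j : Jet1 P) : TMom (L.legendre j) →L[ℝ] TBase m (P.proj j.pt) :=
  (momentumFibred P m).dproj (L.legendre j)

/-- Fields of `m`-vectors along the extended Legendre map. -/
abbrev MVectorAlong : Type _ := ∀ j : Jet1 P, ⋀[ℝ]^m (TMom (L.legendre j))

/-- Fields of `1`-jets of sections of the extended multimomentum bundle over `M`, along the extended
Legendre map. -/
abbrev JetAlong : Type _ := ∀ j : Jet1 P, JetAt (momentumFibred P m) (L.legendre j)

/-- Sections of `T*M ⊗ T𝓜π = Hom(TM, T𝓜π)` along the extended Legendre map. -/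
abbrev TensorAlong : Type _ := ∀ j : Jet1 P, TBase m (P.proj j.pt) →L[ℝ] TMom (L.legendre j)

variable (S : Set (Jet1 P))

/-- `X` is a smooth vector field along the extended Legendre map on `S`. -/
def IsSmoothVector (X : ∀ j : Jet1 P, TMom (L.legendre j)) : Prop :=
  ContMDiffOn 𝓘(ℝ, JetModel m F) (𝓘(ℝ, MomModel m F)).tangent ∞
    (fun j => (⟨L.legendre j, X j⟩ : TangentBundle 𝓘(ℝ, MomModel m F) (Momentum P m))) S

/-- `Y` is smooth on `S` as a map into the jet bundle of the extended multimomentum bundle. -/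
def IsSmoothJet (Y : L.JetAlong) : Prop :=
  ContMDiffOn 𝓘(ℝ, JetModel m F)
    𝓘(ℝ, JetModel m (F × MomentumModel (Eu m) F m)) ∞
    (fun j => (⟨L.legendre j, Y j⟩ : Jet1 (momentumFibred P m))) S

/-- `H` is smooth on `S`, as a section of a bundle of linear maps between tangent spaces. -/
def IsSmoothTensor [IsManifold 𝓘(ℝ, Eu m) ∞ M] (H : L.TensorAlong) : Prop :=
  ∀ j₀ ∈ S, ContMDiffWithinAt 𝓘(ℝ, JetModel m F) 𝓘(ℝ, EuHom m (MomModel m F)) ∞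
    (inTangentCoordinates 𝓘(ℝ, Eu m) 𝓘(ℝ, MomModel m F) (fun j : Jet1 P => P.proj j.pt)
      L.legendre H j₀) S j₀

/-- `K` is locally the exterior product of `m` smooth vector fields along the Legendre map. -/
def IsLocallyDecomposable (K : L.MVectorAlong) : Prop :=
  ∀ j ∈ S, ∃ U : Set (Jet1 P), IsOpen U ∧ j ∈ U ∧ U ⊆ S ∧
    ∃ X : Fin m → ∀ j : Jet1 P, TMom (L.legendre j),
      (∀ α, L.IsSmoothVector U (X α)) ∧ ∀ j' ∈ U, K j' = exteriorPower.ιMulti ℝ m fun α => X α j'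

/-- `K` and `K'` define the same class on `S`: `K' = f K` for a smooth nowhere zero function `f`. -/
def SameClass (K K' : L.MVectorAlong) : Prop :=
  ∃ f : Jet1 P → ℝ, ContMDiffOn 𝓘(ℝ, JetModel m F) 𝓘(ℝ, ℝ) ∞ f S ∧
    ∀ j ∈ S, f j ≠ 0 ∧ K' j = f j • K j

/-- The distribution along the Legendre map with fibres the ranges of `H` is orientable on `S`: it
is generated by a nowhere zero locally decomposable `m`-vector field. -/
def IsOrientable (H : L.TensorAlong) : Prop :=
  ∃ K : L.MVectorAlong, L.IsLocallyDecomposable S K ∧ ∀ j ∈ S, Represents (H j) (K j)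

/-- `K` is an extended `m`-vector field operator on `S`. -/
structure IsMVectorOperator (K : L.MVectorAlong) : Prop where
  ne_zero : ∀ j ∈ S, K j ≠ 0
  locallyDecomposable : L.IsLocallyDecomposable S K
  transverse : ∀ j ∈ S,
    evalForm ((L.vol (P.proj j.pt)).compContinuousLinearMap (L.dbase j)) (K j) ≠ 0
  field_eq : ∀ j ∈ S, ∀ Z : TJet j, contractForm (L.legendre j).omega (K j) (L.dlegendre j Z) = 0
  semiholonomic : ∀ j ∈ S,
    Represents j.val.1 (exteriorPower.map m (L.legendre j).dpt.toLinearMap (K j))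

/-- `Y` is an extended jet field operator on `S`. -/
structure IsJetOperator (Y : L.JetAlong) : Prop where
  smooth : L.IsSmoothJet S Y
  orientable : L.IsOrientable S fun j => (Y j).1
  field_eq : ∀ j ∈ S, ∀ (Z : Fin m → TBase m (P.proj j.pt)) (W : TJet j),
    (L.legendre j).omega (Fin.snoc (α := fun _ => TMom (L.legendre j))
      (fun i => (Y j).1 (Z i)) (L.dlegendre j W)) = 0
  semiholonomic : ∀ j ∈ S, (L.legendre j).dpt.comp (Y j).1 = j.val.1

/-- `H` is an extended connection operator on `S`. The field `isConnection` says that `i(H)ξ = ξ`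
for all semibasic covectors `ξ`, and `field_eq` that the pullback by the Legendre map of
`i(H)Ω - (m - 1)Ω` vanishes, where `H` acts as the endomorphism `H ∘ T(projection to M)`. -/
structure IsConnectionOperator [IsManifold 𝓘(ℝ, Eu m) ∞ M] (H : L.TensorAlong) : Prop where
  smooth : L.IsSmoothTensor S H
  isConnection : ∀ j ∈ S, ∀ ξ : TMom (L.legendre j) →L[ℝ] ℝ,
    (∀ Z, L.dbase j Z = 0 → ξ Z = 0) → ∀ Z, ξ (H j (L.dbase j Z)) = ξ Z
  orientable : L.IsOrientable S H
  field_eq : ∀ j ∈ S, ∀ Z : Fin (m + 1) → TJet j,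
    (∑ i, (L.legendre j).omega (Function.update (fun k => L.dlegendre j (Z k)) i
      (H j (L.dbase j (L.dlegendre j (Z i)))))) -
      ((m : ℝ) - 1) * (L.legendre j).omega (fun k => L.dlegendre j (Z k)) = 0
  semiholonomic : ∀ j ∈ S, (L.legendre j).dpt.comp (H j) = j.val.1

/-- The affine family `H₀ + ∑ᵢ gᵢ Gᵢ`. -/
def family {k : ℕ} (H₀ : L.TensorAlong) (G : Fin k → L.TensorAlong) (g : Jet1 P → Fin k → ℝ) :
    L.TensorAlong :=
  fun j => H₀ j + ∑ i, g j i • G i j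

/-- The exterior product `H(∂/∂x¹) ∧ … ∧ H(∂/∂xᵐ)` in the natural coordinates `c`. -/
def wedge (c : AdaptedChart (V := Eu m) (F := F) P.proj) (H : L.TensorAlong) : L.MVectorAlong :=
  fun j => exteriorPower.ιMulti ℝ m fun α =>
    H j (chartDinv c.base (P.proj j.pt) (EuclideanSpace.single α (1 : ℝ)))

end LagrangianSystem

end Field

end

/-! Call a linear map `l : T_x M → T𝓜π` over `𝔉(j)` a solution at `j` (`IsSolutionAt`) when it lifts
the jet `j` and `Ω(T𝔉(W), l Z₁, …, l Zₘ) = 0` for all `W` and `Zᵢ`. The three kinds of operator are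
smooth fields of solutions in different guises, so the theorem is about the solution set at each jet
and its smooth sections.

In natural coordinates a point of `𝓜π` is `(x, y, p)`, with `p` an `m`-form on `ℝᵐ × F`, and `Θ` is
`p` itself. Hence `Θ` has linear and `Ω` constant coefficients (`formInChart_theta`, `omega_apply`).
A lift of `v` sends `e_k` to `(e_k, v e_k, p_k)`. By `stdOmega_cons`, contracting `Ω` with `W'` and
these `m` vectors gives the sum over `k` of `p_k` on the tuple `(e_i, v e_i)` with `z` in slot `k`,
where `z` is the `(x, y)`-part of `W'`, minus the `p`-part of `W'` on the whole tuple. For `W' =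
T𝔉(W)` the subtracted term is the derivative at `v = v₀` of `ρ£ - ρ ∂£/∂v · (v - v₀)`, where `ρ` is
the coefficient of `ω`. Its velocity derivatives cancel and `D z = ∂(ρ£)/∂(x, y) · z` remains
(`fderiv_legC_tup`). Second derivatives of `£` do not survive, which is why regularity of `£` plays
no role.

Given `v`, a momentum is the same as a pair of a map `T : F → ℝᵐ` and a number `s`, its value on the
tuple (`mom_momCoef`). The field equation then splits into `s_k = D(e_k, v e_k)` and the trace
condition `∑ (T_k η)_k = D(0, η)` (`lift_fieldEq_iff`). The `s_k` are forced; the `T_k` have `N m²`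
entries subject to `N` independent equations. So the solutions form an affine space over the
trace-free coefficients, of dimension `N(m² - 1)` (`finrank_ker_traceForm`). A fixed basis of that
kernel and a fixed projection onto it give `H₀`, the `Gᵢ` and the smooth `gᵢ`
(`smooth_solution_iff`). Because the solution sets are affine, a partition of unity on `E` glues
local solutions to a global one (`exists_global_solution`).

Jet field operators are solutions up to the order of the arguments of `Ω`. For connections, split
every argument into a horizontal and a vertical part. The terms with no vertical part, and with
three or more, vanish by degree, those with one by the field equation. On the remaining terms, with
two vertical entries, `i(H)` counts the `m - 1` horizontal ones (`sum_form_update_eq`,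
`IsSolutionAt.connection_eq`). In the other direction a connection associated with `K` gets its
equation from `K`, since a transverse decomposable `m`-vector determines its section
(`section_unique`). The passage from `K` to `H` is smooth by Cramer's rule
(`isSmoothTensor_of_basis`), and the factor `f` is a quotient of values of the volume form
(`IsLocallyDecomposable.contMDiffOn_factor`). Globally, bases of `ω`-volume one pick a
representative `K` (`unitWedge`). -/

noncomputable section

/-! ### Differentials, forms and smoothness in arbitrary charts -/

section ChartCalculus

variable {X N : Type*} [NormedAddCommGroup X] [NormedSpace ℝ X] [TopologicalSpace N]
  [ChartedSpace X N]
  {X' N' : Type*} [NormedAddCommGroup X'] [NormedSpace ℝ X'] [TopologicalSpace N']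
  [ChartedSpace X' N']
  {Q J : Type*} [NormedAddCommGroup Q] [NormedSpace ℝ Q] [TopologicalSpace J] [ChartedSpace Q J]

theorem chartD_eq_fderiv_comp {e e' : OpenPartialHomeomorph N X}
    (he : e ∈ IsManifold.maximalAtlas 𝓘(ℝ, X) ∞ N)
    (he' : e' ∈ IsManifold.maximalAtlas 𝓘(ℝ, X) ∞ N) {x : N} (hx : x ∈ e.source)
    (hx' : x ∈ e'.source) (v : TangentSpace 𝓘(ℝ, X) x) :
    chartD e' x v = fderiv ℝ (e' ∘ e.symm) (e x) (chartD e x v) := by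
  rw [← chartD_comp_chartDinv he he' hx hx']
  simp [chartDinv_chartD he hx]

theorem chartDinv_eq_comp_fderiv {e e' : OpenPartialHomeomorph N X}
    (he : e ∈ IsManifold.maximalAtlas 𝓘(ℝ, X) ∞ N)
    (he' : e' ∈ IsManifold.maximalAtlas 𝓘(ℝ, X) ∞ N) {x : N} (hx : x ∈ e.source)
    (hx' : x ∈ e'.source) (v : X) :
    chartDinv e x v = chartDinv e' x (fderiv ℝ (e' ∘ e.symm) (e x) v) := by
  rw [← chartD_comp_chartDinv he he' hx hx']
  simp [chartDinv_chartD he' hx']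

/-- The inverse differentials of two charts differ by the derivative of the transition map
(`chartDinv_eq_comp_fderiv`). -/
theorem formInChart_transition {n : ℕ} (θ : ∀ x : N, TangentSpace 𝓘(ℝ, X) x [⋀^Fin n]→L[ℝ] ℝ)
    {e e' : OpenPartialHomeomorph N X}
    (he : e ∈ IsManifold.maximalAtlas 𝓘(ℝ, X) ∞ N)
    (he' : e' ∈ IsManifold.maximalAtlas 𝓘(ℝ, X) ∞ N) {z : X}
    (hz : z ∈ (e.symm.trans e').source) :
    formInChart θ e z = (formInChart θ e' ((e' ∘ e.symm) z)).compContinuousLinearMap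
      (fderiv ℝ (e' ∘ e.symm) z) := by
  have h1 : z ∈ e.target := by simp at hz; exact hz.1
  have h2 : e.symm z ∈ e'.source := by simp at hz; exact hz.2
  have h3 := e.map_target h1
  ext v
  -- The two values of `θ` lie over points that are only propositionally equal; with the point `y`
  -- variable, `rfl` can transport the dependent form.
  have h4 : ∀ y, y = e.symm z → θ (e.symm z) (fun i => chartDinv e (e.symm z) (v i)) =
      θ y fun i => chartDinv e' y (fderiv ℝ (e' ∘ e.symm) z (v i)) := by
    rintro y rfl
    congr 1
    funext i
    have := chartDinv_eq_comp_fderiv he he' h3 h2 (v i)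
    rw [e.right_inv h1] at this
    exact this
  exact h4 _ (e'.left_inv h2)

/-- Smoothness into a finite dimensional space can be tested on a finite separating family of
linear maps. -/
theorem contMDiffOn_of_separating {W ι : Type*} [NormedAddCommGroup W] [NormedSpace ℝ W]
    [Fintype ι] {Z : ι → Type*} [∀ i, NormedAddCommGroup (Z i)] [∀ i, NormedSpace ℝ (Z i)]
    [∀ i, FiniteDimensional ℝ (Z i)] (T : ∀ i, W →L[ℝ] Z i)
    (hT : ∀ w, (∀ i, T i w = 0) → w = 0) {f : J → W} {s : Set J}
    (h : ∀ i, ContMDiffOn 𝓘(ℝ, Q) 𝓘(ℝ, Z i) ∞ (fun q => T i (f q)) s) :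
    ContMDiffOn 𝓘(ℝ, Q) 𝓘(ℝ, W) ∞ f s := by
  have hinj : LinearMap.ker (ContinuousLinearMap.pi T).toLinearMap = ⊥ := by
    refine LinearMap.ker_eq_bot'.2 fun w hw => hT w fun i => ?_
    exact congrFun hw i
  obtain ⟨r, hr⟩ := LinearMap.exists_leftInverse_of_injective _ hinj
  have : f = fun q => LinearMap.toContinuousLinearMap r (ContinuousLinearMap.pi T (f q)) := by
    funext q
    exact (DFunLike.congr_fun hr (f q)).symm
  rw [this]
  exact (LinearMap.toContinuousLinearMap r).contMDiff.comp_contMDiffOn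
    (contMDiffOn_pi_space.2 h)

theorem contMDiffOn_clm_of_apply {W E ι : Type*} [NormedAddCommGroup W] [NormedSpace ℝ W]
    [FiniteDimensional ℝ W] [NormedAddCommGroup E] [NormedSpace ℝ E] [Fintype ι]
    (b : Module.Basis ι ℝ E) {f : J → E →L[ℝ] W} {s : Set J}
    (h : ∀ i, ContMDiffOn 𝓘(ℝ, Q) 𝓘(ℝ, W) ∞ (fun q => f q (b i)) s) :
    ContMDiffOn 𝓘(ℝ, Q) 𝓘(ℝ, E →L[ℝ] W) ∞ f s := by
  refine contMDiffOn_of_separating (fun i => ContinuousLinearMap.apply ℝ W (b i)) ?_ h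
  intro w hw
  exact ContinuousLinearMap.coe_injective (b.ext hw)

/-- The evaluation of alternating forms at a tuple of vectors. -/
def evalAt {X : Type*} [NormedAddCommGroup X] [NormedSpace ℝ X] {n : ℕ} (Z : Fin n → X) :
    X [⋀^Fin n]→L[ℝ] ℝ →L[ℝ] ℝ :=
  (ContinuousMultilinearMap.apply ℝ (fun _ : Fin n => X) ℝ Z).comp
    (ContinuousAlternatingMap.toContinuousMultilinearMapCLM ℝ)

/-- Evaluations at the finitely many tuples of basis vectors separate alternating forms. -/
theorem contMDiffOn_form_of_apply [FiniteDimensional ℝ X] {n : ℕ}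
    (p : Submodule ℝ (X [⋀^Fin n]→L[ℝ] ℝ)) {f : J → p} {s : Set J}
    (h : ∀ Z, ContMDiffOn 𝓘(ℝ, Q) 𝓘(ℝ, ℝ) ∞ (fun q => (f q).1 Z) s) :
    ContMDiffOn 𝓘(ℝ, Q) 𝓘(ℝ, p) ∞ f s := by
  let b := Module.finBasis ℝ X
  refine contMDiffOn_of_separating (ι := Fin n → Fin (Module.finrank ℝ X)) (Z := fun _ => ℝ)
    (fun σ => (evalAt fun i => b (σ i)).comp p.subtypeL) ?_ fun σ => h _
  intro w hw
  apply Subtype.ext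
  apply ContinuousAlternatingMap.toAlternatingMap_injective
  apply b.ext_alternating
  intro σ _
  exact hw σ

theorem contMDiffOn_form_of_apply' [FiniteDimensional ℝ X] {n : ℕ}
    {f : J → X [⋀^Fin n]→L[ℝ] ℝ} {s : Set J}
    (h : ∀ Z, ContMDiffOn 𝓘(ℝ, Q) 𝓘(ℝ, ℝ) ∞ (fun q => f q Z) s) :
    ContMDiffOn 𝓘(ℝ, Q) 𝓘(ℝ, X [⋀^Fin n]→L[ℝ] ℝ) ∞ f s := by
  let b := Module.finBasis ℝ X
  refine contMDiffOn_of_separating (ι := Fin n → Fin (Module.finrank ℝ X)) (Z := fun _ => ℝ)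
    (fun σ => evalAt fun i => b (σ i)) ?_ fun σ => h _
  intro w hw
  apply ContinuousAlternatingMap.toAlternatingMap_injective
  apply b.ext_alternating
  intro σ _
  exact hw σ

/-- A multilinear form applied to smooth data is smooth. -/
theorem contMDiffOn_form_apply {n : ℕ} {w : J → X [⋀^Fin n]→L[ℝ] ℝ} {Z : Fin n → J → X}
    {s : Set J} (hw : ContMDiffOn 𝓘(ℝ, Q) 𝓘(ℝ, X [⋀^Fin n]→L[ℝ] ℝ) ∞ w s)
    (hZ : ∀ i, ContMDiffOn 𝓘(ℝ, Q) 𝓘(ℝ, X) ∞ (Z i) s) :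
    ContMDiffOn 𝓘(ℝ, Q) 𝓘(ℝ, ℝ) ∞ (fun q => w q fun i => Z i q) s := by
  have h1 : ContDiff ℝ ∞ (fun p : (X [⋀^Fin n]→L[ℝ] ℝ) × (Fin n → X) => p.1 p.2) := by
    -- Writing `w(Z)` as the pullback of `w` by the maps `t ↦ t Zᵢ`, evaluated at `(1, …, 1)`,
    -- exhibits it through continuous multilinear maps, which are smooth.
    have h2 : (fun p : (X [⋀^Fin n]→L[ℝ] ℝ) × (Fin n → X) => p.1 p.2) = fun p =>
        ContinuousMultilinearMap.apply ℝ (fun _ : Fin n => ℝ) ℝ (fun _ => 1)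
          (ContinuousMultilinearMap.compContinuousLinearMapContinuousMultilinear ℝ
            (fun _ : Fin n => ℝ) (fun _ => X) ℝ
            (fun i => ContinuousLinearMap.toSpanSingleton ℝ (p.2 i))
            (ContinuousAlternatingMap.toContinuousMultilinearMapCLM ℝ p.1)) := by
      funext p
      change _ = p.1 (fun i => ContinuousLinearMap.toSpanSingleton ℝ (p.2 i) 1)
      simp
    rw [h2]
    refine (ContinuousLinearMap.contDiff _).comp (ContDiff.clm_apply
      ((ContinuousMultilinearMap.contDiff _).comp (contDiff_pi.2 fun i => ?_))
      ((ContinuousLinearMap.contDiff _).comp contDiff_fst))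
    exact (ContinuousLinearMap.toSpanSingletonCLE (𝕜 := ℝ) (E := X)).contDiff.comp
      ((contDiff_apply ℝ X i).comp contDiff_snd)
  exact h1.contMDiff.comp_contMDiffOn (hw.prodMk_space (contMDiffOn_pi_space.2 hZ))

/-- `IsSmoothForm` tests only the charts of the atlas; smooth transitions carry the property over to
natural charts, which lie in the maximal atlas. -/
theorem contDiffOn_formInChart [FiniteDimensional ℝ X] [IsManifold 𝓘(ℝ, X) ∞ N] {n : ℕ}
    {θ : ∀ x : N, TangentSpace 𝓘(ℝ, X) x [⋀^Fin n]→L[ℝ] ℝ} (hθ : IsSmoothForm θ)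
    {e : OpenPartialHomeomorph N X} (he : e ∈ IsManifold.maximalAtlas 𝓘(ℝ, X) ∞ N) :
    ContDiffOn ℝ ∞ (formInChart θ e) e.target := by
  intro z hz
  let e' := chartAt X (e.symm z)
  have he' : e' ∈ IsManifold.maximalAtlas 𝓘(ℝ, X) ∞ N := IsManifold.chart_mem_maximalAtlas _
  have hz' : z ∈ (e.symm.trans e').source := by
    simp [hz, e']
  have hn := (e.symm.trans e').open_source.mem_nhds hz'
  refine ContDiffAt.contDiffWithinAt ?_
  have h1 := contDiffOn_transition he he'
  have h2 := contDiffOn_fderiv_transition he he'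
  have h3 : ContDiffOn ℝ ∞ (formInChart θ e' ∘ (e' ∘ e.symm)) (e.symm.trans e').source :=
    (hθ e' (chart_mem_atlas _ _)).comp h1 (by
      intro w hw
      simp at hw
      exact e'.map_source hw.2)
  refine ContDiffOn.contDiffAt ?_ hn
  refine contDiffOn_of_injective (ContinuousAlternatingMap.toContinuousMultilinearMapCLM ℝ)
    ContinuousAlternatingMap.toContinuousMultilinearMap_injective ?_
  refine ((contDiff_compContinuousLinearMap (m := n)).comp_contDiffOn (h2.prodMk
    ((ContinuousAlternatingMap.toContinuousMultilinearMapCLM ℝ).contDiff.comp_contDiffOn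
      h3))).congr fun w hw => ?_
  rw [formInChart_transition θ he he' hw]
  rfl

/-- Naturality of `d` under the transition map (`extDeriv_pullback`, which needs a `C²` map) makes
the exterior derivative independent of the preferred chart, so `Ω` can be computed in natural
coordinates. -/
theorem extDerivAt_eq [IsManifold 𝓘(ℝ, X) ∞ N] {n : ℕ}
    {θ : ∀ x : N, TangentSpace 𝓘(ℝ, X) x [⋀^Fin n]→L[ℝ] ℝ}
    {e : OpenPartialHomeomorph N X} (he : e ∈ IsManifold.maximalAtlas 𝓘(ℝ, X) ∞ N)
    {x : N} (hx : x ∈ e.source) (hd : DifferentiableAt ℝ (formInChart θ e) (e x)) :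
    extDerivAt θ x = (extDeriv (formInChart θ e) (e x)).compContinuousLinearMap (chartD e x) := by
  let e' := chartAt X x
  have hx' : x ∈ e'.source := mem_chart_source X x
  have he' : e' ∈ IsManifold.maximalAtlas 𝓘(ℝ, X) ∞ N := IsManifold.chart_mem_maximalAtlas _
  have hz' : e' x ∈ (e'.symm.trans e).source := by
    simp [hx, hx']
  have hn := (e'.symm.trans e).open_source.mem_nhds hz'
  have h0 : (e ∘ e'.symm) (e' x) = e x := by simp [hx']
  have h1 : formInChart θ e' =ᶠ[𝓝 (e' x)] fun z => (formInChart θ e ((e ∘ e'.symm)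
      z)).compContinuousLinearMap (fderiv ℝ (e ∘ e'.symm) z) := by
    filter_upwards [hn] with z hz
    exact formInChart_transition θ he' he hz
  have h2 := extDeriv_pullback (by rw [h0]; exact hd) ((contDiffOn_transition he' he).contDiffAt hn)
    (by simpa using WithTop.coe_le_coe.2 (le_top : (2 : ℕ∞) ≤ ⊤))
  change (extDeriv (formInChart θ e') (e' x)).compContinuousLinearMap (chartD e' x) = _
  rw [h1.extDeriv_eq, h2, h0]
  ext v
  simp only [ContinuousAlternatingMap.compContinuousLinearMap_apply]
  congr 1
  funext i
  exact (chartD_eq_fderiv_comp he' he hx' hx (v i)).symm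

theorem chartD_mfderiv {f : N → N'} {e : OpenPartialHomeomorph N X}
    {e' : OpenPartialHomeomorph N' X'} (he : e ∈ IsManifold.maximalAtlas 𝓘(ℝ, X) ∞ N)
    (he' : e' ∈ IsManifold.maximalAtlas 𝓘(ℝ, X') ∞ N') {x : N} (hx : x ∈ e.source)
    (hx' : f x ∈ e'.source) (hf : MDifferentiableAt 𝓘(ℝ, X) 𝓘(ℝ, X') f x)
    (v : TangentSpace 𝓘(ℝ, X) x) :
    chartD e' (f x) (mfderiv 𝓘(ℝ, X) 𝓘(ℝ, X') f x v) =
      fderiv ℝ (e' ∘ f ∘ e.symm) (e x) (chartD e x v) := by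
  have hs := (mdiff_of_mem he).mdifferentiableAt_symm (e.map_source hx)
  have h0 : e.symm (e x) = x := e.left_inv hx
  have h1 : MDifferentiableAt 𝓘(ℝ, X) 𝓘(ℝ, X') (e' ∘ f) x :=
    ((mdiff_of_mem he').mdifferentiableAt hx').comp x hf
  have h2 := mfderiv_comp x ((mdiff_of_mem he').mdifferentiableAt hx') hf
  have h3 : MDifferentiableAt 𝓘(ℝ, X) 𝓘(ℝ, X') ((e' ∘ f) ∘ e.symm) (e x) := by
    refine MDifferentiableAt.comp (e x) ?_ hs
    rw [h0]; exact h1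
  have h4 := mfderiv_comp x h3 ((mdiff_of_mem he).mdifferentiableAt hx)
  have h5 : mfderiv 𝓘(ℝ, X) 𝓘(ℝ, X') (((e' ∘ f) ∘ e.symm) ∘ e) x =
      mfderiv 𝓘(ℝ, X) 𝓘(ℝ, X') (e' ∘ f) x := by
    apply Filter.EventuallyEq.mfderiv_eq
    filter_upwards [e.open_source.mem_nhds hx] with y hy
    simp [hy]
  rw [mfderiv_eq_fderiv] at h4
  exact DFunLike.congr_fun (h2.symm.trans (h5.symm.trans h4)) v

theorem chartDinv_apply_eq_mfderiv_symm {e : OpenPartialHomeomorph N X}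
    (he : e ∈ IsManifold.maximalAtlas 𝓘(ℝ, X) ∞ N) {x : N} (hx : x ∈ e.source) (u : X) :
    (chartDinv e x u : X) = mfderiv 𝓘(ℝ, X) 𝓘(ℝ, X) e.symm (e x) u := by
  apply (chartD_invertible he hx).injective
  refine (chartD_chartDinv he hx u).trans ?_
  have := DFunLike.congr_fun ((mdiff_of_mem he).comp_symm_deriv (e.map_source hx)) u
  rw [e.left_inv hx] at this
  exact this.symm

theorem contMDiffWithinAt_chartD_chartDinv {f : J → N} {s : Set J} {j₀ : J}
    {e e' : OpenPartialHomeomorph N X}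
    (he : e ∈ IsManifold.maximalAtlas 𝓘(ℝ, X) ∞ N)
    (he' : e' ∈ IsManifold.maximalAtlas 𝓘(ℝ, X) ∞ N) (hf : ContMDiffWithinAt 𝓘(ℝ, Q) 𝓘(ℝ, X) ∞ f s j₀)
    (h : f j₀ ∈ e.source) (h' : f j₀ ∈ e'.source) :
    ContMDiffWithinAt 𝓘(ℝ, Q) 𝓘(ℝ, X →L[ℝ] X) ∞
      (fun j => (chartD e' (f j)).comp (chartDinv e (f j))) s j₀ := by
  have hz : e (f j₀) ∈ (e.symm.trans e').source := by simp [h, h']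
  have h1 : ContMDiffAt 𝓘(ℝ, X) 𝓘(ℝ, X →L[ℝ] X) ∞ (fderiv ℝ (e' ∘ e.symm)) (e (f j₀)) :=
    ((contDiffOn_fderiv_transition he he').contDiffAt
      ((e.symm.trans e').open_source.mem_nhds hz)).contMDiffAt
  have h2 : ContMDiffAt 𝓘(ℝ, X) 𝓘(ℝ, X) ∞ e (f j₀) :=
    (contMDiffOn_of_mem_maximalAtlas he).contMDiffAt (e.open_source.mem_nhds h)
  have h3 := (h1.comp _ h2).comp_contMDiffWithinAt j₀ hf
  have hn : ∀ᶠ j in 𝓝[s] j₀, f j ∈ e.source ∩ e'.source :=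
    hf.continuousWithinAt.eventually ((e.open_source.inter e'.open_source).mem_nhds ⟨h, h'⟩)
  refine h3.congr_of_eventuallyEq ?_ (chartD_comp_chartDinv he he' h h')
  filter_upwards [hn] with j hj
  exact chartD_comp_chartDinv he he' hj.1 hj.2

theorem contMDiffOn_tangent_iff [IsManifold 𝓘(ℝ, X) ∞ N] {f : J → N} {s : Set J}
    {e : OpenPartialHomeomorph N X} (he : e ∈ IsManifold.maximalAtlas 𝓘(ℝ, X) ∞ N)
    (hf : ContMDiffOn 𝓘(ℝ, Q) 𝓘(ℝ, X) ∞ f s) (hs : MapsTo f s e.source)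
    (Y : ∀ j, TangentSpace 𝓘(ℝ, X) (f j)) :
    ContMDiffOn 𝓘(ℝ, Q) (𝓘(ℝ, X)).tangent ∞ (fun j => (⟨f j, Y j⟩ : TangentBundle 𝓘(ℝ, X) N)) s ↔
      ContMDiffOn 𝓘(ℝ, Q) 𝓘(ℝ, X) ∞ (fun j => (chartD e (f j) (Y j) : X)) s := by
  refine forall₂_congr fun j₀ hj₀ => ?_
  let e₀ := chartAt X (f j₀)
  have he₀ : e₀ ∈ IsManifold.maximalAtlas 𝓘(ℝ, X) ∞ N := IsManifold.chart_mem_maximalAtlas _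
  have h0 : f j₀ ∈ e₀.source := mem_chart_source X _
  have hn : ∀ᶠ j in 𝓝[s] j₀, f j ∈ e.source ∩ e₀.source :=
    (hf j₀ hj₀).continuousWithinAt.eventually
      ((e.open_source.inter e₀.open_source).mem_nhds ⟨hs hj₀, h0⟩)
  have key : (fun j => (trivializationAt X (TangentSpace 𝓘(ℝ, X)) (f j₀)
      (⟨f j, Y j⟩ : TangentBundle 𝓘(ℝ, X) N)).2) =ᶠ[𝓝[s] j₀] fun j => chartD e₀ (f j) (Y j) := by
    filter_upwards [hn] with j hj
    have := DFunLike.congr_fun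
      (TangentBundle.continuousLinearMapAt_trivializationAt (I := 𝓘(ℝ, X)) hj.2) (Y j)
    rw [Bundle.Trivialization.continuousLinearMapAt_apply,
      Bundle.Trivialization.linearMapAt_apply, if_pos (by simpa using hj.2)] at this
    exact this
  rw [Bundle.contMDiffWithinAt_totalSpace]
  rw [Filter.EventuallyEq.contMDiffWithinAt_iff key (key.self_of_nhdsWithin hj₀)]
  constructor
  · rintro ⟨-, h⟩
    refine ((contMDiffWithinAt_chartD_chartDinv he₀ he (hf j₀ hj₀) h0 (hs hj₀)).clm_apply
      h).congr_of_eventuallyEq_of_mem ?_ hj₀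
    filter_upwards [hn] with j hj
    simp [chartDinv_chartD he₀ hj.2]
  · intro h
    refine ⟨hf j₀ hj₀, ((contMDiffWithinAt_chartD_chartDinv he he₀ (hf j₀ hj₀) (hs hj₀)
      h0).clm_apply h).congr_of_eventuallyEq_of_mem ?_ hj₀⟩
    filter_upwards [hn] with j hj
    simp [chartDinv_chartD he hj.1]

/-- Near `j₀` both expressions are the matrix of `H`, in the preferred and in the given charts; they
differ by smooth transition factors on either side. -/
theorem contMDiffOn_inTangentCoordinates_iff [IsManifold 𝓘(ℝ, X) ∞ N] [IsManifold 𝓘(ℝ, X') ∞ N']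
    {f : J → N} {f' : J → N'} {s : Set J}
    {e : OpenPartialHomeomorph N X} (he : e ∈ IsManifold.maximalAtlas 𝓘(ℝ, X) ∞ N)
    (hf : ContMDiffOn 𝓘(ℝ, Q) 𝓘(ℝ, X) ∞ f s) (hs : MapsTo f s e.source)
    {e' : OpenPartialHomeomorph N' X'} (he' : e' ∈ IsManifold.maximalAtlas 𝓘(ℝ, X') ∞ N')
    (hf' : ContMDiffOn 𝓘(ℝ, Q) 𝓘(ℝ, X') ∞ f' s) (hs' : MapsTo f' s e'.source)
    (H : ∀ j, TangentSpace 𝓘(ℝ, X) (f j) →L[ℝ] TangentSpace 𝓘(ℝ, X') (f' j)) :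
    (∀ j₀ ∈ s, ContMDiffWithinAt 𝓘(ℝ, Q) 𝓘(ℝ, X →L[ℝ] X') ∞
      (inTangentCoordinates 𝓘(ℝ, X) 𝓘(ℝ, X') f f' H j₀) s j₀) ↔
    ContMDiffOn 𝓘(ℝ, Q) 𝓘(ℝ, X →L[ℝ] X') ∞
      (fun j => (chartD e' (f' j)).comp ((H j).comp (chartDinv e (f j)))) s := by
  refine forall₂_congr fun j₀ hj₀ => ?_
  let e₀ := chartAt X (f j₀)
  have he₀ : e₀ ∈ IsManifold.maximalAtlas 𝓘(ℝ, X) ∞ N := IsManifold.chart_mem_maximalAtlas _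
  have h0 : f j₀ ∈ e₀.source := mem_chart_source X _
  let e₀' := chartAt X' (f' j₀)
  have he₀' : e₀' ∈ IsManifold.maximalAtlas 𝓘(ℝ, X') ∞ N' := IsManifold.chart_mem_maximalAtlas _
  have h0' : f' j₀ ∈ e₀'.source := mem_chart_source X' _
  have hn : ∀ᶠ j in 𝓝[s] j₀, f j ∈ e.source ∩ e₀.source :=
    (hf j₀ hj₀).continuousWithinAt.eventually
      ((e.open_source.inter e₀.open_source).mem_nhds ⟨hs hj₀, h0⟩)
  have hn' : ∀ᶠ j in 𝓝[s] j₀, f' j ∈ e'.source ∩ e₀'.source :=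
    (hf' j₀ hj₀).continuousWithinAt.eventually
      ((e'.open_source.inter e₀'.open_source).mem_nhds ⟨hs' hj₀, h0'⟩)
  have key : inTangentCoordinates 𝓘(ℝ, X) 𝓘(ℝ, X') f f' H j₀ =ᶠ[𝓝[s] j₀] fun j =>
      (chartD e₀' (f' j)).comp ((H j).comp (chartDinv e₀ (f j))) := by
    filter_upwards [hn, hn'] with j hj hj'
    rw [inTangentCoordinates_eq_mfderiv_comp hj.2 hj'.2]
    have h1 : mfderivWithin 𝓘(ℝ, X) 𝓘(ℝ, X) (extChartAt 𝓘(ℝ, X) (f j₀)).symm (range 𝓘(ℝ, X))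
        (extChartAt 𝓘(ℝ, X) (f j₀) (f j)) = mfderiv 𝓘(ℝ, X) 𝓘(ℝ, X) e₀.symm (e₀ (f j)) := by
      simp only [modelWithCornersSelf_coe, range_id, mfderivWithin_univ, e₀]
      rfl
    rw [h1]
    apply ContinuousLinearMap.ext
    intro u
    exact congrArg (fun t : TangentSpace 𝓘(ℝ, X) (f j) => chartD e₀' (f' j) (H j t))
      (chartDinv_apply_eq_mfderiv_symm he₀ hj.2 u).symm
  rw [Filter.EventuallyEq.contMDiffWithinAt_iff key (key.self_of_nhdsWithin hj₀)]
  constructor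
  · intro h
    refine ((contMDiffWithinAt_chartD_chartDinv he₀' he' (hf' j₀ hj₀) h0' (hs' hj₀)).clm_comp
      (h.clm_comp (contMDiffWithinAt_chartD_chartDinv he he₀ (hf j₀ hj₀) (hs hj₀)
        h0))).congr_of_eventuallyEq_of_mem ?_ hj₀
    filter_upwards [hn, hn'] with j hj hj'
    ext u
    simp [chartDinv_chartD he₀ hj.2, chartDinv_chartD he₀' hj'.2]
  · intro h
    refine ((contMDiffWithinAt_chartD_chartDinv he' he₀' (hf' j₀ hj₀) (hs' hj₀) h0').clm_comp
      (h.clm_comp (contMDiffWithinAt_chartD_chartDinv he₀ he (hf j₀ hj₀) h0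
        (hs hj₀)))).congr_of_eventuallyEq_of_mem ?_ hj₀
    filter_upwards [hn, hn'] with j hj hj'
    ext u
    simp [chartDinv_chartD he hj.1, chartDinv_chartD he' hj'.1]

end ChartCalculus

/-! ### Forms of top degree -/

section StandardVolume

/-- The standard basis of `ℝᵐ`. -/
def stdVec (m : ℕ) (k : Fin m) : Eu m := EuclideanSpace.single k 1

/-- The standard basis of `ℝᵐ`, bundled. -/
def stdBasis (m : ℕ) : Module.Basis (Fin m) ℝ (Eu m) := (EuclideanSpace.basisFun (Fin m) ℝ).toBasis

variable {m : ℕ}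

@[simp] theorem stdBasis_apply (k : Fin m) : stdBasis m k = stdVec m k := by
  simp [stdBasis, stdVec]

theorem coe_stdBasis : ⇑(stdBasis m) = stdVec m := funext stdBasis_apply

theorem sum_stdVec (u : Eu m) : ∑ k, u k • stdVec m k = u := by
  have := (EuclideanSpace.basisFun (Fin m) ℝ).sum_repr u
  simpa [stdVec] using this

@[simp] theorem stdVec_self (k : Fin m) : stdVec m k k = 1 := by simp [stdVec]

theorem stdVec_apply (k l : Fin m) : stdVec m k l = if l = k then 1 else 0 := by
  simp [stdVec]

/-- The standard volume form of `ℝᵐ`. -/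
def stdVol (m : ℕ) : Eu m [⋀^Fin m]→L[ℝ] ℝ :=
  { (stdBasis m).det with
    cont := by
      change Continuous fun Z => (stdBasis m).det Z
      simp only [Module.Basis.det_apply]
      refine Continuous.matrix_det ?_
      refine continuous_matrix fun i j => ?_
      change Continuous fun Z : Fin m → Eu m => (stdBasis m).repr (Z j) i
      simp only [stdBasis, OrthonormalBasis.coe_toBasis_repr_apply,
        EuclideanSpace.basisFun_repr]
      fun_prop }

@[simp] theorem stdVol_stdVec : stdVol m (stdVec m) = 1 := by
  change (stdBasis m).det (stdVec m) = 1
  rw [← coe_stdBasis]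
  exact (stdBasis m).det_self

/-- An alternating map of top degree is determined by its value at a basis. -/
theorem alternating_eq_det_smul {Y X : Type*} [AddCommGroup Y] [Module ℝ Y] [AddCommGroup X]
    [Module ℝ X] (g : Y [⋀^Fin m]→ₗ[ℝ] X) (b : Module.Basis (Fin m) ℝ Y) (y : Fin m → Y) :
    g y = b.det y • g b := by
  have h : g = (LinearMap.toSpanSingleton ℝ X (g b)).compAlternatingMap b.det := by
    refine b.ext_alternating fun σ hσ => ?_
    -- In top degree an injective choice of basis indices is a permutation, and it multiplies both
    -- sides by its sign.
    let τ : Equiv.Perm (Fin m) := Equiv.ofBijective σ (Finite.injective_iff_bijective.1 hσ)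
    have h1 := g.map_perm b τ
    have h2 := b.det.map_perm b τ
    simp only [LinearMap.compAlternatingMap_apply, LinearMap.toSpanSingleton_apply]
    change g (b ∘ τ) = b.det (b ∘ τ) • g b
    rw [h1, h2, b.det_self]
    simp
  conv_lhs => rw [h]
  simp

theorem form_eq_zero_of_basis {Y : Type*} [AddCommGroup Y] [Module ℝ Y] [TopologicalSpace Y]
    (w : Y [⋀^Fin m]→L[ℝ] ℝ) (b : Module.Basis (Fin m) ℝ Y) (h : w b = 0) (y : Fin m → Y) :
    w y = 0 := by
  have := alternating_eq_det_smul w.toAlternatingMap b y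
  simp only [ContinuousAlternatingMap.coe_toAlternatingMap] at this
  rw [this, h, smul_zero]

/-- When `u` is expanded in the basis, every term except the `k`-th repeats a basis vector. -/
theorem form_update_basis {Y : Type*} [AddCommGroup Y] [Module ℝ Y] [TopologicalSpace Y]
    (w : Y [⋀^Fin m]→L[ℝ] ℝ) (b : Module.Basis (Fin m) ℝ Y) (k : Fin m) (u : Y) :
    w (Function.update b k u) = b.repr u k * w b := by
  have h := w.toAlternatingMap.map_update_sum Finset.univ k (fun l => b.repr u l • b l) b
  rw [b.sum_repr] at h
  simp only [ContinuousAlternatingMap.coe_toAlternatingMap] at h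
  rw [h, Finset.sum_eq_single k]
  · rw [w.map_update_smul, Function.update_eq_self, smul_eq_mul]
  · intro l _ hl
    rw [w.map_update_smul, w.map_eq_zero_of_eq (Function.update b k (b l))
      (by simp [hl] : _ = Function.update b k (b l) l) hl.symm, smul_zero]
  · simp

theorem form_update_stdVec (w : Eu m [⋀^Fin m]→L[ℝ] ℝ) (k : Fin m) (u : Eu m) :
    w (Function.update (stdVec m) k u) = u k * w (stdVec m) := by
  have := form_update_basis w (stdBasis m) k u
  rw [coe_stdBasis] at this
  simpa [stdBasis] using this

end StandardVolume

/-! ### Linear coordinates on the space of momenta -/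

section MomentumAlgebra

variable {m : ℕ} {F : Type*} [NormedAddCommGroup F] [NormedSpace ℝ F]

/-- The horizontal lifts `(e_k, v e_k)` of the standard basis. -/
def tup (v : Eu m →L[ℝ] F) (k : Fin m) : Eu m × F := (stdVec m k, v (stdVec m k))

/-- The vertical part `(ξ, η) ↦ η - v ξ` along `v`. -/
def vertPart (v : Eu m →L[ℝ] F) : Eu m × F →L[ℝ] F :=
  ContinuousLinearMap.snd ℝ _ _ - v.comp (ContinuousLinearMap.fst ℝ _ _)

@[simp] theorem vertPart_apply (v : Eu m →L[ℝ] F) (z : Eu m × F) :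
    vertPart v z = z.2 - v z.1 := rfl

/-- The momentum `A^ν_A (dy^A - v^A_α dx^α) ∧ i(∂/∂x^ν)w + s w`. -/
def mom (w : Eu m [⋀^Fin m]→L[ℝ] ℝ) (v : Eu m →L[ℝ] F) (A : F →L[ℝ] Eu m) (s : ℝ) :
    MomentumModel (Eu m) F m :=
  ⟨insertForm w (ContinuousLinearMap.fst ℝ (Eu m) F) (A.comp (vertPart v)) +
    s • w.compContinuousLinearMap (ContinuousLinearMap.fst ℝ (Eu m) F), by
    intro Z i k hik hi hk
    have h1 : w.compContinuousLinearMap (ContinuousLinearMap.fst ℝ (Eu m) F) Z = 0 :=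
      w.map_coord_zero i hi
    have h2 : insertForm w (ContinuousLinearMap.fst ℝ (Eu m) F) (A.comp (vertPart v)) Z = 0 := by
      rw [insertForm_apply]
      refine Finset.sum_eq_zero fun l _ => ?_
      rcases eq_or_ne l i with rfl | hl
      · exact w.map_coord_zero k (by rw [Function.update_of_ne hik.symm]; exact hk)
      · exact w.map_coord_zero i (by rw [Function.update_of_ne hl.symm]; exact hi)
    simp [h1, h2]⟩

theorem mom_apply (w : Eu m [⋀^Fin m]→L[ℝ] ℝ) (v : Eu m →L[ℝ] F) (A : F →L[ℝ] Eu m) (s : ℝ)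
    (Z : Fin m → Eu m × F) : (mom w v A s).1 Z =
      ∑ i, w (Function.update (fun j => (Z j).1) i (A ((Z i).2 - v (Z i).1))) +
        s * w fun j => (Z j).1 := by
  simp only [mom, ContinuousAlternatingMap.add_apply, insertForm_apply]
  rfl

/-- The tuple is lifted by `v'`, independently of the `v` in the momentum: differentiating the
Legendre map moves `v` while the arguments stay fixed. -/
theorem mom_tup (w : Eu m [⋀^Fin m]→L[ℝ] ℝ) (v v' : Eu m →L[ℝ] F) (A : F →L[ℝ] Eu m) (s : ℝ) :
    (mom w v A s).1 (tup v') =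
      w (stdVec m) * (∑ k, A (v' (stdVec m k) - v (stdVec m k)) k + s) := by
  rw [mom_apply]
  have h : (fun j => (tup v' j).1) = stdVec m := rfl
  simp only [h, form_update_stdVec]
  rw [← Finset.sum_mul]
  simp only [tup]
  ring

/-- The lifts by `v` have no vertical part along `v`, so only the insertion in slot `k` survives. -/
theorem mom_update_tup (w : Eu m [⋀^Fin m]→L[ℝ] ℝ) (v : Eu m →L[ℝ] F) (A : F →L[ℝ] Eu m) (s : ℝ)
    (k : Fin m) (z : Eu m × F) :
    (mom w v A s).1 (Function.update (tup v) k z) =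
      w (stdVec m) * (A (z.2 - v z.1) k + s * z.1 k) := by
  rw [mom_apply]
  have h : (fun j => (Function.update (tup v) k z j).1) = Function.update (stdVec m) k z.1 := by
    funext j
    rcases eq_or_ne j k with rfl | hj <;> simp [tup, *]
  rw [h, Finset.sum_eq_single k]
  · simp only [Function.update_self, Function.update_idem, form_update_stdVec]
    ring
  · intro i _ hi
    exact w.map_coord_zero i (by simp [hi, tup])
  · simp

/-- A momentum is determined by its values on horizontal vectors and on all but one horizontal
vectors. -/
theorem momentum_eq_zero (v : Eu m →L[ℝ] F) (a : MomentumModel (Eu m) F m) (h0 : a.1 (tup v) = 0)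
    (h1 : ∀ k η, a.1 (Function.update (tup v) k (0, η)) = 0) : a = 0 := by
  let T : Eu m →L[ℝ] Eu m × F := (ContinuousLinearMap.id ℝ _).prod v
  have hT : (fun k => T (stdVec m k)) = tup v := rfl
  have e0 : ∀ ξ : Fin m → Eu m, a.1 (fun k => T (ξ k)) = 0 := by
    intro ξ
    refine form_eq_zero_of_basis (a.1.compContinuousLinearMap T) (stdBasis m) ?_ ξ
    rw [coe_stdBasis]
    exact h0
  have e1 : ∀ (ξ : Fin m → Eu m) (i : Fin m) (η : F),
      a.1 (Function.update (fun k => T (ξ k)) i (0, η)) = 0 := by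
    intro ξ i η
    -- The other `m - 1` vectors span a proper subspace, so some functional `lam` kills them and is
    -- `1` at some `u`. Inserting the rank-one map `lam ⊗ (0, η)` into `a` gives a top-degree form
    -- on `ℝᵐ` that vanishes on the standard basis by `h1`. At `ξ` with `u` in slot `i` its only
    -- term is the value wanted.
    have hlt : Submodule.span ℝ (Set.range fun j : {j // j ≠ i} => ξ j) < ⊤ := by
      refine Submodule.lt_top_of_finrank_lt_finrank ?_
      refine (finrank_range_le_card _).trans_lt ?_
      simp only [finrank_euclideanSpace, Fintype.card_fin, ne_eq, Fintype.card_subtype_compl,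
        Fintype.card_subtype_eq]
      have := i.pos
      omega
    obtain ⟨lam, hlam, hker⟩ := Submodule.exists_le_ker_of_lt_top _ hlt
    obtain ⟨u, hu⟩ : ∃ u, lam u = 1 := by
      obtain ⟨u, hu⟩ : ∃ u, lam u ≠ 0 := by
        by_contra! h
        exact hlam (LinearMap.ext h)
      exact ⟨(lam u)⁻¹ • u, by simp [hu]⟩
    let lam' : Eu m →L[ℝ] ℝ := LinearMap.toContinuousLinearMap lam
    have hphi : ∀ ζ, insertForm a.1 T (lam'.smulRight ((0 : Eu m), η)) ζ = 0 := by
      refine form_eq_zero_of_basis _ (stdBasis m) ?_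
      rw [coe_stdBasis, insertForm_apply, hT]
      refine Finset.sum_eq_zero fun k _ => ?_
      rw [ContinuousLinearMap.smulRight_apply, a.1.map_update_smul, h1, smul_zero]
    have h2 := hphi (Function.update ξ i u)
    rw [insertForm_apply, Finset.sum_eq_single i] at h2
    · simp only [Function.update_self, ContinuousLinearMap.smulRight_apply] at h2
      have h3 : lam' u = 1 := hu
      rw [h3, one_smul] at h2
      have h4 : Function.update (fun k => T (Function.update ξ i u k)) i ((0 : Eu m), η) =
          Function.update (fun k => T (ξ k)) i (0, η) := by
        funext k
        rcases eq_or_ne k i with rfl | hk <;> simp [*]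
      rw [h4] at h2
      exact h2
    · intro k _ hk
      rw [Function.update_of_ne hk]
      have h3 : lam' (ξ k) = 0 := hker (Submodule.subset_span ⟨⟨k, hk⟩, rfl⟩)
      rw [ContinuousLinearMap.smulRight_apply, h3, zero_smul]
      exact a.1.map_coord_zero k (by simp)
    · simp
  apply Subtype.ext
  apply ContinuousAlternatingMap.ext
  intro Z
  -- Expanding into horizontal and vertical parts leaves the terms with at most one vertical entry,
  -- since `a` kills two.
  have hZ : Z = (fun k => T (Z k).1) + fun k => ((0 : Eu m), vertPart v (Z k)) := by
    funext k
    simp [T]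
  rw [hZ, a.1.map_add_univ]
  refine Finset.sum_eq_zero fun s _ => ?_
  rcases sᶜ.eq_empty_or_nonempty with hs | ⟨i, hi⟩
  · rw [Finset.compl_eq_empty_iff] at hs
    rw [hs, Finset.piecewise_univ]
    exact e0 _
  · by_cases h2 : ∃ k ∈ sᶜ, k ≠ i
    · obtain ⟨k, hk, hki⟩ := h2
      rw [Finset.mem_compl] at hi hk
      exact a.2 _ i k hki.symm (by simp [hi]) (by simp [hk])
    · push Not at h2
      have h3 : s.piecewise (fun k => T (Z k).1) (fun k => ((0 : Eu m), vertPart v (Z k))) =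
          Function.update (fun k => T (Z k).1) i (0, vertPart v (Z i)) := by
        funext k
        rcases eq_or_ne k i with rfl | hk
        · rw [Finset.mem_compl] at hi
          simp [hi]
        · have : k ∈ s := by
            by_contra h
            exact hk (h2 k (Finset.mem_compl.2 h))
          simp [hk, this]
      rw [h3]
      exact e1 _ _ _

/-- The coefficients `A` of a momentum with respect to `v`. -/
def momCoef (v : Eu m →L[ℝ] F) (a : MomentumModel (Eu m) F m) : F →L[ℝ] Eu m :=
  ∑ i, ((a.1.toContinuousMultilinearMap.toContinuousLinearMap (tup v) i).comp
    (ContinuousLinearMap.inr ℝ (Eu m) F)).smulRight (stdVec m i)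

theorem momCoef_apply (v : Eu m →L[ℝ] F) (a : MomentumModel (Eu m) F m) (η : F) (k : Fin m) :
    momCoef v a η k = a.1 (Function.update (tup v) k (0, η)) := by
  simp only [momCoef, sum_apply]
  simp [stdVec_apply]

/-- Both sides agree on the tuples tested by `momentum_eq_zero`. Together with `momCoef_mom` this
makes the coefficients and the horizontal value a coordinate system on momenta for each `v`. -/
theorem mom_momCoef (v : Eu m →L[ℝ] F) (a : MomentumModel (Eu m) F m) :
    mom (stdVol m) v (momCoef v a) (a.1 (tup v)) = a := by
  rw [← sub_eq_zero]
  refine momentum_eq_zero v _ ?_ fun k η => ?_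
  · rw [AddSubgroupClass.coe_sub, ContinuousAlternatingMap.sub_apply, mom_tup]
    simp
  · rw [AddSubgroupClass.coe_sub, ContinuousAlternatingMap.sub_apply, mom_update_tup]
    simp [momCoef_apply]

theorem momCoef_mom (v : Eu m →L[ℝ] F) (A : F →L[ℝ] Eu m) (s : ℝ) :
    momCoef v (mom (stdVol m) v A s) = A := by
  ext η k
  simp [momCoef_apply, mom_update_tup]

theorem mom_add (w : Eu m [⋀^Fin m]→L[ℝ] ℝ) (v : Eu m →L[ℝ] F) (A A' : F →L[ℝ] Eu m) (s s' : ℝ) :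
    mom w v (A + A') (s + s') = mom w v A s + mom w v A' s' := by
  apply Subtype.ext
  apply ContinuousAlternatingMap.ext
  intro Z
  rw [Submodule.coe_add, ContinuousAlternatingMap.add_apply]
  simp only [mom_apply, add_apply, w.map_update_add, Finset.sum_add_distrib]
  ring

theorem mom_smul (w : Eu m [⋀^Fin m]→L[ℝ] ℝ) (v : Eu m →L[ℝ] F) (A : F →L[ℝ] Eu m) (s c : ℝ) :
    mom w v (c • A) (c * s) = c • mom w v A s := by
  apply Subtype.ext
  apply ContinuousAlternatingMap.ext
  intro Z
  rw [Submodule.coe_smul, ContinuousAlternatingMap.smul_apply]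
  simp only [mom_apply, smul_apply, w.map_update_smul, smul_eq_mul, mul_add, Finset.mul_sum,
    mul_assoc]

end MomentumAlgebra

/-! ### The constant multisymplectic form and its insertion operator -/

section MultisymplecticAlgebra

variable {m : ℕ} {F : Type*} [NormedAddCommGroup F] [NormedSpace ℝ F]

/-- The projection `(x, y, p) ↦ (x, y)`. -/
def momProj (m : ℕ) (F : Type*) [NormedAddCommGroup F] [NormedSpace ℝ F] :
    MomModel m F →L[ℝ] Eu m × F :=
  (ContinuousLinearMap.fst ℝ _ _).prod
    ((ContinuousLinearMap.fst ℝ _ _).comp (ContinuousLinearMap.snd ℝ _ _))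

@[simp] theorem momProj_apply (z : MomModel m F) : momProj m F z = (z.1, z.2.1) := rfl

/-- The canonical multisymplectic form of the model space. -/
def stdOmega (Z : Fin (m + 1) → MomModel m F) : ℝ :=
  -∑ i : Fin (m + 1), (-1) ^ (i : ℕ) * (Z i).2.2.1 (fun k => momProj m F (Z (i.succAbove k)))

theorem form_cons_removeNth {X : Type*} [AddCommGroup X] [Module ℝ X] [TopologicalSpace X] {n : ℕ}
    (a : X [⋀^Fin (n + 1)]→L[ℝ] ℝ) (ζ : Fin (n + 1) → X) (k : Fin (n + 1)) (z : X) :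
    a (Fin.cons z (k.removeNth ζ)) = (-1) ^ (k : ℕ) * a (Function.update ζ k z) := by
  have h := a.toAlternatingMap.neg_one_pow_smul_map_insertNth k z (k.removeNth ζ)
  have h2 : k.insertNth z (k.removeNth ζ) = Function.update ζ k z := Fin.insertNth_removeNth k z ζ
  rw [h2] at h
  refine h.symm.trans ?_
  rw [zsmul_eq_mul]
  push_cast
  rfl

/-- The subtracted term uses the momentum part of `Z`. In each other term `Z` moves from the front
into the slot freed by `ζ k`, and the sign of that move cancels the alternating sign. -/
theorem stdOmega_cons (Z : MomModel m F) (ζ : Fin m → MomModel m F) :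
    stdOmega (Fin.cons Z ζ : Fin (m + 1) → MomModel m F) =
      ∑ k, (ζ k).2.2.1 (Function.update (fun i => momProj m F (ζ i)) k (momProj m F Z)) -
        Z.2.2.1 fun i => momProj m F (ζ i) := by
  rw [stdOmega, Fin.sum_univ_succ]
  simp only [Fin.cons_zero, Fin.cons_succ, Fin.zero_succAbove, Fin.val_zero, pow_zero, one_mul]
  rw [neg_add, ← Finset.sum_neg_distrib, sub_eq_add_neg, add_comm]
  congr 1
  refine Finset.sum_congr rfl fun k _ => ?_
  -- The index `k : Fin m` forces `m` to be a successor, which `removeNth` needs.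
  obtain ⟨n, rfl⟩ : ∃ n, m = n + 1 := ⟨m - 1, by have := k.pos; omega⟩
  have h : (fun i => momProj (n + 1) F
      ((Fin.cons Z ζ : Fin (n + 1 + 1) → MomModel (n + 1) F) (k.succ.succAbove i))) =
      Fin.cons (momProj (n + 1) F Z) (k.removeNth fun i => momProj (n + 1) F (ζ i)) := by
    funext i
    refine Fin.cases ?_ (fun i => ?_) i
    · simp
    · simp [Fin.removeNth]
  rw [h, form_cons_removeNth, Fin.val_succ, pow_succ]
  have h2 : ((-1 : ℝ) ^ (k : ℕ)) * (-1) ^ (k : ℕ) = 1 := by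
    rw [← mul_pow]; simp
  linear_combination (-(ζ k).2.2.1 (Function.update (fun i => momProj (n + 1) F (ζ i)) k
    (momProj (n + 1) F Z))) * (-h2)

/-- The multisymplectic form vanishes on three vectors that are vertical over the base. -/
theorem stdOmega_eq_zero_of_three (Z : Fin (m + 1) → MomModel m F) {i j k : Fin (m + 1)}
    (hij : i ≠ j) (hik : i ≠ k) (hjk : j ≠ k) (hi : (Z i).1 = 0) (hj : (Z j).1 = 0)
    (hk : (Z k).1 = 0) : stdOmega Z = 0 := by
  rw [stdOmega, neg_eq_zero]
  refine Finset.sum_eq_zero fun l _ => ?_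
  -- Each term of `Ω` takes the momentum part of one vector and feeds the others to it. Whichever
  -- vector that is, two of the three vertical ones remain as arguments.
  have key : ∀ p q : Fin (m + 1), p ≠ q → p ≠ l → q ≠ l → (Z p).1 = 0 → (Z q).1 = 0 →
      (Z l).2.2.1 (fun k => momProj m F (Z (l.succAbove k))) = 0 := by
    intro p q hpq hp hq hp0 hq0
    obtain ⟨p', rfl⟩ := Fin.exists_succAbove_eq hp
    obtain ⟨q', rfl⟩ := Fin.exists_succAbove_eq hq
    exact (Z l).2.2.2 _ p' q' (fun h => hpq (by rw [h])) hp0 hq0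
  rcases eq_or_ne i l with rfl | hil
  · rw [key j k hjk hij.symm hik.symm hj hk, mul_zero]
  rcases eq_or_ne j l with rfl | hjl
  · rw [key i k hik hij hjk.symm hi hk, mul_zero]
  · rw [key i j hij hil hjl hi hj, mul_zero]

/-- If `Ω` vanishes on three vertical vectors and on at most one vertical vector, then
`i(P)Ω = (m - 1)Ω`. -/
theorem sum_form_update_eq {X : Type*} [AddCommGroup X] [Module ℝ X] [TopologicalSpace X]
    (w : X [⋀^Fin (m + 1)]→L[ℝ] ℝ) (Z A : Fin (m + 1) → X) (h0 : w A = 0)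
    (h1 : ∀ i, w (Function.update A i (Z i)) = 0)
    (h3 : ∀ Y : Fin (m + 1) → X, ∀ i j k, i ≠ j → i ≠ k → j ≠ k → Y i = Z i - A i →
      Y j = Z j - A j → Y k = Z k - A k → w Y = 0) :
    ∑ i, w (Function.update Z i (A i)) = ((m : ℝ) - 1) * w Z := by
  let V : Fin (m + 1) → X := fun i => Z i - A i
  -- `pw s` is the term of the expansion of `w(A + V)` with `A` on `s` and `V` off `s`.
  let pw : Finset (Fin (m + 1)) → ℝ := fun s => w (s.piecewise A V)
  have hZ : w Z = ∑ s, pw s := by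
    have : Z = A + V := by funext i; simp [V]
    conv_lhs => rw [this]
    exact w.map_add_univ A V
  have hV : ∀ i, w (Function.update Z i (V i)) = ∑ s : Finset (Fin (m + 1)),
      if i ∈ s then 0 else pw s := by
    intro i
    have : Function.update Z i (V i) = Function.update A i 0 + V := by
      funext j
      rcases eq_or_ne j i with rfl | hj <;> simp [V, *]
    rw [this, w.map_add_univ]
    refine Finset.sum_congr rfl fun s _ => ?_
    split_ifs with hi
    · exact w.map_coord_zero i (by simp [hi])
    · refine congrArg w (funext fun j => ?_)
      by_cases hj : j ∈ s
      · have : j ≠ i := fun h => hi (h ▸ hj)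
        simp [hj, this]
      · simp [hj]
  have hA : ∀ i, w (Function.update Z i (A i)) = w Z - w (Function.update Z i (V i)) := by
    intro i
    have h := w.map_update_add Z i (A i) (V i)
    have h' : A i + V i = Z i := by simp [V]
    rw [h', Function.update_eq_self] at h
    rw [h]; ring
  -- Terms with zero, one, or at least three entries from `V` vanish, so the number of such entries
  -- may be replaced by `2`.
  have hcard : ∀ s : Finset (Fin (m + 1)), (sᶜ.card : ℝ) * pw s = 2 * pw s := by
    intro s
    rcases Nat.lt_or_ge 2 sᶜ.card with hs | hs
    · obtain ⟨i, j, k, hi, hj, hk, hij, hik, hjk⟩ := Finset.two_lt_card_iff.1 hs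
      rw [Finset.mem_compl] at hi hj hk
      have : pw s = 0 := h3 _ i j k hij hik hjk (by simp [hi, V]) (by simp [hj, V])
        (by simp [hk, V])
      rw [this]; simp
    · interval_cases h : sᶜ.card
      · rw [Finset.card_eq_zero, Finset.compl_eq_empty_iff] at h
        simp [pw, h, h0]
      · obtain ⟨i, hi⟩ := Finset.card_eq_one.1 h
        have : pw s = w (Function.update A i (V i)) := by
          refine congrArg w (funext fun j => ?_)
          rcases eq_or_ne j i with rfl | hj
          · have : j ∈ sᶜ := by simp [hi]
            rw [Finset.mem_compl] at this
            simp [this]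
          · have : j ∈ s := by
              by_contra hjs
              rw [← Finset.mem_compl, hi, Finset.mem_singleton] at hjs
              exact hj hjs
            simp [this, hj]
        have h2 : w (Function.update A i (V i)) = 0 := by
          have h := w.map_update_sub A i (Z i) (A i)
          rw [Function.update_eq_self, h1, h0, sub_zero] at h
          exact h
        rw [this, h2]; simp
      · simp
  -- Summed over `i`, the term `pw s` occurs once for each `i ∉ s`. Subtracting the total `2 w(Z)`
  -- from `(m + 1) w(Z)` leaves the factor `m - 1`.
  have hsum : ∑ i, w (Function.update Z i (V i)) = 2 * w Z := by
    simp only [hV]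
    rw [Finset.sum_comm, hZ, Finset.mul_sum]
    refine Finset.sum_congr rfl fun s _ => ?_
    rw [← hcard, Finset.sum_ite, Finset.sum_const_zero, zero_add, Finset.sum_const, nsmul_eq_mul]
    congr 3
    ext i
    simp
  simp only [hA, Finset.sum_sub_distrib, hsum]
  simp
  ring

end MultisymplecticAlgebra

/-! ### The field equation as a trace condition -/

section FieldEquation

variable {m : ℕ} {F : Type*} [NormedAddCommGroup F] [NormedSpace ℝ F]

/-- The vertical endomorphism part `e_k ↦ (0, 0, T_k + s_k vol)`. -/
def momHom (v : Eu m →L[ℝ] F) (T : Fin m → F →L[ℝ] Eu m) (s : Fin m → ℝ) :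
    EuHom m (MomModel m F) :=
  ∑ k, (EuclideanSpace.proj k : Eu m →L[ℝ] ℝ).smulRight
    ((0, 0, mom (stdVol m) v (T k) (s k)) : MomModel m F)

theorem momHom_stdVec (v : Eu m →L[ℝ] F) (T : Fin m → F →L[ℝ] Eu m) (s : Fin m → ℝ) (k : Fin m) :
    momHom v T s (stdVec m k) = (0, 0, mom (stdVol m) v (T k) (s k)) := by
  rw [momHom, sum_apply, Finset.sum_eq_single k]
  · rw [ContinuousLinearMap.smulRight_apply]
    change stdVec m k k • _ = _
    rw [stdVec_self, one_smul]
  · intro l _ hl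
    rw [ContinuousLinearMap.smulRight_apply]
    change stdVec m k l • _ = _
    rw [stdVec_apply, if_neg hl, zero_smul]
  · simp

/-- The horizontal lift `e_k ↦ (e_k, v e_k, 0)`. -/
def horLift (v : Eu m →L[ℝ] F) : EuHom m (MomModel m F) :=
  (ContinuousLinearMap.id ℝ _).prod (v.prod (0 : EuHom m (MomentumModel (Eu m) F m)))

@[simp] theorem horLift_apply (v : Eu m →L[ℝ] F) (u : Eu m) : horLift v u = (u, v u, 0) := rfl

theorem eu_hom_ext {W : Type*} [AddCommGroup W] [Module ℝ W] [TopologicalSpace W]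
    {f g : Eu m →L[ℝ] W} (h : ∀ k, f (stdVec m k) = g (stdVec m k)) : f = g := by
  apply ContinuousLinearMap.coe_injective
  refine (stdBasis m).ext fun k => ?_
  simpa using h k

/-- The semiholonomic condition in coordinates. -/
def IsLift (v : Eu m →L[ℝ] F) (h : EuHom m (MomModel m F)) : Prop :=
  ∀ u, momProj m F (h u) = (u, v u)

/-- The coefficients of a lift. -/
def liftCoef (v : Eu m →L[ℝ] F) (h : EuHom m (MomModel m F)) (k : Fin m) : F →L[ℝ] Eu m :=
  momCoef v (h (stdVec m k)).2.2

/-- The lift condition fixes the `x` and `y` components, and `mom_momCoef` rewrites the third. A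
lift therefore amounts to free data `(T, s)`. -/
theorem IsLift.eq {v : Eu m →L[ℝ] F} {h : EuHom m (MomModel m F)} (hl : IsLift v h) :
    h = horLift v + momHom v (liftCoef v h) fun k => (h (stdVec m k)).2.2.1 (tup v) := by
  refine eu_hom_ext fun k => ?_
  rw [add_apply, momHom_stdVec, liftCoef, mom_momCoef, horLift_apply]
  have := hl (stdVec m k)
  rw [momProj_apply, Prod.ext_iff] at this
  refine Prod.ext ?_ (Prod.ext ?_ ?_)
  · simpa using this.1
  · simpa using this.2
  · simp

theorem IsLift.tup_eq {v : Eu m →L[ℝ] F} {h : EuHom m (MomModel m F)} (hl : IsLift v h) :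
    (fun k => momProj m F (h (stdVec m k))) = tup v :=
  funext fun _ => hl _

theorem isLift_horLift_add (v : Eu m →L[ℝ] F) (T : Fin m → F →L[ℝ] Eu m) (s : Fin m → ℝ) :
    IsLift v (horLift v + momHom v T s) := by
  suffices h : (momProj m F).comp (horLift v + momHom v T s) =
      (ContinuousLinearMap.id ℝ _).prod v from fun u => DFunLike.congr_fun h u
  refine eu_hom_ext fun k => ?_
  rw [ContinuousLinearMap.comp_apply, add_apply, momHom_stdVec, horLift_apply]
  simp

theorem liftCoef_horLift_add (v : Eu m →L[ℝ] F) (T : Fin m → F →L[ℝ] Eu m) (s : Fin m → ℝ) :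
    liftCoef v (horLift v + momHom v T s) = T := by
  funext k
  rw [liftCoef, add_apply, momHom_stdVec, horLift_apply]
  simp [momCoef_mom]

/-- The trace of the coefficients. -/
def traceForm (m : ℕ) (F : Type*) [NormedAddCommGroup F] [NormedSpace ℝ F] :
    (Fin m → F →L[ℝ] Eu m) →ₗ[ℝ] (F →L[ℝ] ℝ) where
  toFun T := ∑ k, (EuclideanSpace.proj k : Eu m →L[ℝ] ℝ).comp (T k)
  map_add' T T' := by
    simp [Finset.sum_add_distrib]
  map_smul' c T := by
    simp [Finset.smul_sum]

theorem traceForm_apply (T : Fin m → F →L[ℝ] Eu m) (η : F) :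
    traceForm m F T η = ∑ k, T k η k := by
  simp [traceForm]

/-- The field equation for a lift, in coordinates. -/
theorem lift_fieldEq_iff (v : Eu m →L[ℝ] F) (h : EuHom m (MomModel m F))
    (D : Eu m × F →L[ℝ] ℝ) :
    (∀ z, ∑ k, (h (stdVec m k)).2.2.1 (Function.update (tup v) k z) = D z) ↔
      (∀ k, (h (stdVec m k)).2.2.1 (tup v) = D (tup v k)) ∧
        traceForm m F (liftCoef v h) = D.comp (ContinuousLinearMap.inr ℝ _ _) := by
  have e1 : ∀ z, ∑ k, (h (stdVec m k)).2.2.1 (Function.update (tup v) k z) =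
      traceForm m F (liftCoef v h) (vertPart v z) +
        ∑ k, z.1 k * (h (stdVec m k)).2.2.1 (tup v) := by
    intro z
    rw [traceForm_apply, ← Finset.sum_add_distrib]
    refine Finset.sum_congr rfl fun k _ => ?_
    conv_lhs => rw [← mom_momCoef v (h (stdVec m k)).2.2, mom_update_tup, stdVol_stdVec]
    rw [liftCoef, vertPart_apply]
    ring
  simp only [e1]
  constructor
  · intro H
    refine ⟨fun k => ?_, ?_⟩
    -- The horizontal vectors `tup v k` read off the numbers `s_k`; the vertical vectors `(0, η)`
    -- below read off the trace.
    · have := H (tup v k)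
      simpa [tup, stdVec_apply] using this
    · ext η
      have := H (0, η)
      simpa using this
  · rintro ⟨ha, hb⟩ z
    rw [hb]
    simp only [ha]
    have hz : z = (0, vertPart v z) + ∑ k, z.1 k • tup v k := by
      refine Prod.ext ?_ ?_
      · simp [Prod.fst_sum, tup, sum_stdVec]
      · simp only [vertPart_apply, tup, Prod.snd_add, Prod.snd_sum, Prod.smul_snd, ← map_smul,
          ← map_sum, sum_stdVec]
        simp
    conv_rhs => rw [hz]
    simp

theorem traceForm_surjective (hm : 1 ≤ m) : Function.Surjective (traceForm m F) := by
  intro φ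
  -- Spread `φ` evenly over the `m` diagonal entries; this requires `m ≠ 0`.
  refine ⟨fun k => ((m : ℝ)⁻¹ • φ).smulRight (stdVec m k), ?_⟩
  ext η
  have : (m : ℝ) ≠ 0 := by positivity
  rw [traceForm_apply]
  simp
  field_simp

/-- Rank-nullity: `m` maps `F → ℝᵐ` have `N m²` entries in all, and the trace maps them onto the
`N`-dimensional dual of `F`. -/
theorem finrank_ker_traceForm [FiniteDimensional ℝ F] (hm : 1 ≤ m) :
    Module.finrank ℝ (LinearMap.ker (traceForm m F)) = Module.finrank ℝ F * (m ^ 2 - 1) := by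
  have h := (traceForm m F).finrank_range_add_finrank_ker
  rw [LinearMap.range_eq_top.2 (traceForm_surjective hm), finrank_top,
    Module.finrank_pi_fintype] at h
  have h1 : Module.finrank ℝ (F →L[ℝ] ℝ) = Module.finrank ℝ F := by
    rw [← LinearMap.toContinuousLinearMap.finrank_eq, Module.finrank_linearMap]; simp
  have h2 : Module.finrank ℝ (F →L[ℝ] Eu m) = Module.finrank ℝ F * m := by
    rw [← LinearMap.toContinuousLinearMap.finrank_eq, Module.finrank_linearMap]; simp
  rw [h1, h2, Finset.sum_const, Finset.card_univ, Fintype.card_fin, smul_eq_mul] at h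
  rw [Nat.mul_sub, mul_one]
  have : m * (Module.finrank ℝ F * m) = Module.finrank ℝ F * m ^ 2 := by ring
  omega

end FieldEquation

/-! ### Decomposable multivectors and the sections they represent -/

section Multivectors

variable {X Y : Type*} [AddCommGroup X] [Module ℝ X] [TopologicalSpace X]
  [AddCommGroup Y] [Module ℝ Y] [TopologicalSpace Y] {m : ℕ}

@[simp] theorem evalForm_ιMulti (w : X [⋀^Fin m]→L[ℝ] ℝ) (x : Fin m → X) :
    evalForm w (exteriorPower.ιMulti ℝ m x) = w x :=
  exteriorPower.alternatingMapLinearEquiv_apply_ιMulti _ _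

theorem evalForm_smul (w : X [⋀^Fin m]→L[ℝ] ℝ) (c : ℝ) (u : ⋀[ℝ]^m X) :
    evalForm w (c • u) = c * evalForm w u := by
  simp [evalForm]

@[simp] theorem contractForm_ιMulti (w : X [⋀^Fin (m + 1)]→L[ℝ] ℝ) (x : Fin m → X) (Z : X) :
    contractForm w (exteriorPower.ιMulti ℝ m x) Z = (-1) ^ m * w (Fin.cons Z x) := by
  rw [contractForm, exteriorPower.alternatingMapLinearEquiv_apply_ιMulti]
  rfl

theorem contractForm_smul (w : X [⋀^Fin (m + 1)]→L[ℝ] ℝ) (c : ℝ) (u : ⋀[ℝ]^m X) (Z : X) :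
    contractForm w (c • u) Z = c * contractForm w u Z := by
  simp only [contractForm, map_smul, smul_eq_mul]
  ring

/-- The two tuples differ by a cyclic permutation, hence the values by a sign. Jet field operators
put the tangent vector of `J¹` last, solutions put it first. -/
theorem form_snoc_eq_zero_iff (w : X [⋀^Fin (m + 1)]→L[ℝ] ℝ) (x : Fin m → X) (Z : X) :
    w (Fin.snoc (α := fun _ => X) x Z) = 0 ↔ w (Fin.cons Z x) = 0 := by
  have h := w.toAlternatingMap.map_perm (Fin.cons Z x) (finRotate (m + 1))
  have h2 : (Fin.cons Z x : Fin (m + 1) → X) ∘ finRotate (m + 1) =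
      Fin.snoc (α := fun _ => X) x Z := (Fin.snoc_eq_cons_rotate x Z).symm
  rw [h2] at h
  change w _ = _ • w _ at h
  rw [h, smul_eq_zero_iff_eq]

/-- A decomposable multivector in the range of `l` is a multiple of the one given by a basis. -/
theorem ιMulti_comp_eq_smul (l : Y →L[ℝ] X) (b : Module.Basis (Fin m) ℝ Y) (y : Fin m → Y) :
    exteriorPower.ιMulti ℝ m (fun i => l (y i)) =
      b.det y • exteriorPower.ιMulti ℝ m (fun i => l (b i)) :=
  alternating_eq_det_smul ((exteriorPower.ιMulti ℝ m).compLinearMap l.toLinearMap) b y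

/-- A nonzero factor can be absorbed into the first basis vector. For `m = 0` there is only the
empty basis and `c` could only be `1`. -/
theorem represents_iff (hm : 1 ≤ m) (l : Y →L[ℝ] X) (b : Module.Basis (Fin m) ℝ Y)
    (u : ⋀[ℝ]^m X) :
    Represents l u ↔ ∃ c : ℝ, c ≠ 0 ∧ u = c • exteriorPower.ιMulti ℝ m fun i => l (b i) := by
  constructor
  · rintro ⟨b', rfl⟩
    exact ⟨b.det b', (b.isUnit_det b').ne_zero, ιMulti_comp_eq_smul l b b'⟩
  · rintro ⟨c, hc, rfl⟩
    let d : Fin m → ℝˣ := Function.update 1 ⟨0, hm⟩ (Units.mk0 c hc)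
    refine ⟨b.unitsSMul d, ?_⟩
    rw [ιMulti_comp_eq_smul l b (b.unitsSMul d)]
    congr 1
    rw [b.det_unitsSMul_self]
    simp only [d]
    rw [Finset.prod_eq_single ⟨0, hm⟩]
    · simp
    · intro i _ hi
      simp [hi]
    · simp

theorem form_comp_eq_zero_of_basis {k : ℕ} (w : X [⋀^Fin (k + 1)]→L[ℝ] ℝ) (l : Y →L[ℝ] X)
    (b : Module.Basis (Fin k) ℝ Y) (Z : X) (h : w (Fin.cons Z fun i => l (b i)) = 0)
    (y : Fin k → Y) : w (Fin.cons Z fun i => l (y i)) = 0 := by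
  have := alternating_eq_det_smul ((w.toAlternatingMap.curryLeft Z).compLinearMap l.toLinearMap) b y
  change w (Fin.cons Z fun i => l (y i)) = _ • w (Fin.cons Z fun i => l (b i)) at this
  rw [this, h, smul_zero]

/-- Two sections of `D` whose ranges are represented by the same multivector coincide. -/
theorem section_unique [IsTopologicalAddGroup X] [ContinuousSMul ℝ X] [SeparatingDual ℝ X]
    [IsTopologicalAddGroup Y] [ContinuousSMul ℝ Y]
    (w : Y [⋀^Fin m]→L[ℝ] ℝ) (D : X →L[ℝ] Y) {l l' : Y →L[ℝ] X} (b : Module.Basis (Fin m) ℝ Y)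
    (hw : w b ≠ 0) (hl : ∀ y, D (l y) = y) (hl' : ∀ y, D (l' y) = y)
    {u : ⋀[ℝ]^m X} (hu : Represents l u) (hu' : Represents l' u) : l = l' := by
  obtain ⟨b₁, hb₁⟩ := hu
  obtain ⟨b₂, hb₂⟩ := hu'
  have hw₁ : w b₁ ≠ 0 := fun h => hw (form_eq_zero_of_basis w b₁ h b)
  apply ContinuousLinearMap.coe_injective
  refine b₁.ext fun k => ?_
  by_contra hne
  obtain ⟨lam, hlam⟩ := SeparatingDual.exists_ne_zero (R := ℝ) (sub_ne_zero.2 hne)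
  -- `φ` inserts `lam ∘ (id - l' ∘ D)`, which kills the range of `l'`. Computed from `l'`, the value
  -- of `φ` on `u` is `0`. Computed from `l`, it is `lam(l b₁ₖ - l' b₁ₖ)` times `w b₁`, because the
  -- other slots repeat `b₁ k`.
  let φ := insertForm w D ((lam.comp (ContinuousLinearMap.id ℝ X - l'.comp D)).smulRight (b₁ k))
  have e : evalForm φ u = φ fun i => l (b₁ i) := by rw [hb₁, evalForm_ιMulti]
  have e' : evalForm φ u = φ fun i => l' (b₂ i) := by rw [hb₂, evalForm_ιMulti]
  have e2 : φ (fun i => l' (b₂ i)) = 0 := by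
    simp only [φ, insertForm_apply]
    refine Finset.sum_eq_zero fun i _ => w.map_coord_zero i ?_
    simp [hl']
  have e1 : φ (fun i => l (b₁ i)) = lam (l (b₁ k) - l' (b₁ k)) * w b₁ := by
    simp only [φ, insertForm_apply, hl]
    rw [Finset.sum_eq_single k]
    · rw [ContinuousLinearMap.smulRight_apply, w.map_update_smul, Function.update_eq_self]
      simp [hl]
    · intro i _ hi
      rw [ContinuousLinearMap.smulRight_apply, w.map_update_smul,
        w.map_eq_zero_of_eq (Function.update b₁ i (b₁ k))
          (by simp [hi.symm] : _ = Function.update b₁ i (b₁ k) k) hi, smul_zero]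
    · simp
  rw [e', e2, e1] at e
  exact mul_ne_zero hlam hw₁ e.symm

end Multivectors

/-- Alternating forms of degree `m` on a normed space. -/
abbrev FormOn (m : ℕ) (X : Type*) [NormedAddCommGroup X] [NormedSpace ℝ X] : Type _ :=
  X [⋀^Fin m]→L[ℝ] ℝ

/-! ### Forms with linear coefficients; finite dimensionality of the models -/

section CanonicalForm

/-- The exterior derivative of a form with linear coefficients. -/
theorem extDeriv_of_linear {X : Type*} [NormedAddCommGroup X] [NormedSpace ℝ X]
    [FiniteDimensional ℝ X] {n : ℕ} {θ : X → FormOn n X} (T : (Fin n → X) → X →L[ℝ] ℝ)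
    (hT : ∀ z Z, θ z Z = T Z z) (x : X) : DifferentiableAt ℝ θ x ∧ ∀ Z : Fin (n + 1) → X,
      extDeriv θ x Z = ∑ i : Fin (n + 1), (-1) ^ (i : ℕ) * θ (Z i) fun k => Z (i.succAbove k) := by
  have h : ContDiff ℝ ∞ θ := by
    rw [← contMDiff_iff_contDiff, ← contMDiffOn_univ]
    refine contMDiffOn_form_of_apply' fun Z => ?_
    simp only [hT]
    exact (ContinuousLinearMap.contMDiff _).contMDiffOn
  have hd : DifferentiableAt ℝ θ x := h.contDiffAt.differentiableAt (by simp)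
  refine ⟨hd, fun Z => ?_⟩
  rw [extDeriv_apply hd]
  refine Finset.sum_congr rfl fun i _ => ?_
  simp only [hT, ContinuousLinearMap.fderiv, zsmul_eq_mul]
  push_cast
  rfl

instance finiteDimensional_formOn {X : Type*} [NormedAddCommGroup X] [NormedSpace ℝ X]
    [FiniteDimensional ℝ X] {n : ℕ} : FiniteDimensional ℝ (FormOn n X) :=
  FiniteDimensional.of_injective (ContinuousAlternatingMap.toContinuousMultilinearMapCLM ℝ :
    FormOn n X →L[ℝ] ContinuousMultilinearMap ℝ (fun _ : Fin n => X) ℝ).toLinearMap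
    ContinuousAlternatingMap.toContinuousMultilinearMap_injective

instance finiteDimensional_momentumModel {X G : Type*} [NormedAddCommGroup X] [NormedSpace ℝ X]
    [NormedAddCommGroup G] [NormedSpace ℝ G] [FiniteDimensional ℝ X] [FiniteDimensional ℝ G]
    {n : ℕ} : FiniteDimensional ℝ (MomentumModel X G n) :=
  have : FiniteDimensional ℝ (FormOn n (X × G)) := inferInstance
  FiniteDimensional.finiteDimensional_submodule _

instance finiteDimensional_momModel {n : ℕ} {G : Type*} [NormedAddCommGroup G] [NormedSpace ℝ G]
    [FiniteDimensional ℝ G] : FiniteDimensional ℝ (MomModel n G) :=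
  have : FiniteDimensional ℝ (G × MomentumModel (Eu n) G n) := inferInstance
  inferInstanceAs (FiniteDimensional ℝ (Eu n × (G × MomentumModel (Eu n) G n)))

variable {m : ℕ} {F : Type*} [NormedAddCommGroup F] [NormedSpace ℝ F]

/-- The canonical form of the model space. -/
def stdTheta (z : MomModel m F) : FormOn m (MomModel m F) :=
  z.2.2.1.compContinuousLinearMap (momProj m F)

/-- Exhibits the linear dependence on the point that `extDeriv_of_linear` asks for. -/
theorem stdTheta_apply_eq (z : MomModel m F) (Z : Fin m → MomModel m F) :
    stdTheta z Z = ((evalAt fun i => momProj m F (Z i)).comp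
      ((Submodule.subtypeL (twoVerticalForms m (ContinuousLinearMap.fst ℝ (Eu m) F))).comp
        ((ContinuousLinearMap.snd ℝ F _).comp (ContinuousLinearMap.snd ℝ (Eu m) _)))) z := rfl

end CanonicalForm

/-! ### Natural charts of `J¹E` and `𝓜π`; `Θ` and `Ω` in them -/

section NaturalCharts

variable {m : ℕ} {F M B : Type*} [NormedAddCommGroup F] [NormedSpace ℝ F]
  [TopologicalSpace M] [ChartedSpace (Eu m) M]
  [TopologicalSpace B] [ChartedSpace (Eu m × F) B]
  {P : FibredManifold (Eu m) F M B}

/-- The natural chart of the jet bundle. -/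
def jetTop (c : AdaptedChart (V := Eu m) (F := F) P.proj) :
    OpenPartialHomeomorph (Jet1 P) (JetModel m F) :=
  (jetAtlas P).core.openPartialHomeomorph c.jetChart ⟨c, rfl⟩

theorem jetTop_mem (c : AdaptedChart (V := Eu m) (F := F) P.proj) :
    jetTop c ∈ IsManifold.maximalAtlas 𝓘(ℝ, JetModel m F) ∞ (Jet1 P) :=
  StructureGroupoid.subset_maximalAtlas _ (mem_iUnion₂.2 ⟨c.jetChart, ⟨c, rfl⟩, rfl⟩)

variable (c : AdaptedChart (V := Eu m) (F := F) P.proj)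

theorem jetTop_apply (j : Jet1 P) : jetTop c j = (c.top j.pt, c.jetCoord j) := rfl

theorem contMDiffOn_jet_pt : ContMDiffOn 𝓘(ℝ, JetModel m F) 𝓘(ℝ, Eu m × F) ∞
    (Jet1.pt (P := P)) (jetTop c).source := by
  have h1 : ContMDiffOn 𝓘(ℝ, JetModel m F) 𝓘(ℝ, Eu m × F) ∞
      (fun j => (jetTop c j).1) (jetTop c).source :=
    contDiff_fst.contMDiff.comp_contMDiffOn (contMDiffOn_of_mem_maximalAtlas (jetTop_mem c))
  refine ((contMDiffOn_symm_of_mem_maximalAtlas c.top_mem).comp h1 fun j hj =>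
    c.top.map_source hj).congr fun j hj => (c.top.left_inv hj).symm

theorem contMDiffOn_base_proj : ContMDiffOn 𝓘(ℝ, JetModel m F) 𝓘(ℝ, Eu m) ∞
    (fun j : Jet1 P => P.proj j.pt) (jetTop c).source := by
  have h1 : ContMDiffOn 𝓘(ℝ, JetModel m F) 𝓘(ℝ, Eu m) ∞
      (fun j => (jetTop c j).1.1) (jetTop c).source :=
    (contDiff_fst.comp contDiff_fst).contMDiff.comp_contMDiffOn
      (contMDiffOn_of_mem_maximalAtlas (jetTop_mem c))
  refine ((contMDiffOn_symm_of_mem_maximalAtlas c.base_mem).comp h1 fun j hj => ?_).congr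
    fun j hj => ?_
  · change (c.top j.pt).1 ∈ c.base.target
    rw [c.fst_eq _ hj]
    exact c.base.map_source (c.mapsTo _ hj)
  · change _ = c.base.symm (c.top j.pt).1
    rw [c.fst_eq _ hj, c.base.left_inv (c.mapsTo _ hj)]

variable [FiniteDimensional ℝ F]

/-- The natural chart of the multimomentum bundle. -/
def momTop : OpenPartialHomeomorph (Momentum P m) (MomModel m F) :=
  (momentumAtlas P m).core.openPartialHomeomorph c.momentumChart ⟨c, rfl⟩

theorem momTop_mem :
    momTop c ∈ IsManifold.maximalAtlas 𝓘(ℝ, MomModel m F) ∞ (Momentum P m) :=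
  StructureGroupoid.subset_maximalAtlas _ (mem_iUnion₂.2 ⟨c.momentumChart, ⟨c, rfl⟩, rfl⟩)

theorem momProj_momTop (w : Momentum P m) : momProj m F (momTop c w) = c.top w.pt := rfl

theorem momTop_snd_snd {w : Momentum P m} (hw : w.pt ∈ c.top.source) :
    (momTop c w).2.2 = c.momentumCoord hw w.form := by
  classical
  change (dite (w.pt ∈ c.top.source) (fun h => c.momentumCoord h w.form) fun _ => 0) = _
  rw [dif_pos hw]

/-- Natural coordinates of the multimomentum bundle, as a fibred manifold over the base. -/
def momAdapted : AdaptedChart (V := Eu m) (F := F × MomentumModel (Eu m) F m)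
    (momentumFibred P m).proj where
  top := momTop c
  base := c.base
  top_mem := momTop_mem c
  base_mem := c.base_mem
  mapsTo _ hw := c.mapsTo _ hw
  fst_eq _ hw := c.fst_eq _ hw

theorem contMDiffOn_momentum_pt : ContMDiffOn 𝓘(ℝ, MomModel m F) 𝓘(ℝ, Eu m × F) ∞
    (Momentum.pt (P := P) (m := m)) (momTop c).source := by
  have h1 : ContMDiffOn 𝓘(ℝ, MomModel m F) 𝓘(ℝ, Eu m × F) ∞
      (fun w : Momentum P m => momProj m F (momTop c w)) (momTop c).source :=
    (momProj m F).contMDiff.comp_contMDiffOn (contMDiffOn_of_mem_maximalAtlas (momTop_mem c))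
  refine ((contMDiffOn_symm_of_mem_maximalAtlas c.top_mem).comp h1 fun j hj =>
    c.top.map_source hj).congr fun j hj => (c.top.left_inv hj).symm

theorem chartD_dpt {w : Momentum P m} (hw : w.pt ∈ c.top.source) (Z : TMom w) :
    chartD c.top w.pt (w.dpt Z) = momProj m F (chartD (momTop c) w Z) := by
  have hw' : w ∈ (momTop c).source := hw
  have hd : MDifferentiableAt 𝓘(ℝ, MomModel m F) 𝓘(ℝ, Eu m × F)
      (Momentum.pt (P := P) (m := m)) w :=
    ((contMDiffOn_momentum_pt c).contMDiffAt
      ((momTop c).open_source.mem_nhds hw')).mdifferentiableAt (by simp)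
  have h := chartD_mfderiv (momTop_mem c) c.top_mem hw' hw hd Z
  have h2 : c.top ∘ Momentum.pt ∘ (momTop c).symm =ᶠ[𝓝 (momTop c w)] momProj m F := by
    filter_upwards [(momTop c).open_target.mem_nhds ((momTop c).map_source hw')] with z hz
    have := congrArg (momProj m F) ((momTop c).right_inv hz)
    rw [momProj_momTop] at this
    exact this
  rw [h2.fderiv_eq, ContinuousLinearMap.fderiv] at h
  exact h

theorem chartD_dproj_dpt {w : Momentum P m} (hw : w.pt ∈ c.top.source) (Z : TMom w) :
    chartD c.base (P.proj w.pt) (P.dproj w.pt (w.dpt Z)) = (chartD (momTop c) w Z).1 := by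
  rw [c.chartD_dproj hw, chartD_dpt c hw]
  rfl

theorem dproj_momentumFibred {w : Momentum P m} (Z : TMom w) :
    (momentumFibred P m).dproj w Z = P.dproj w.pt (w.dpt Z) := by
  obtain ⟨c, hc⟩ := P.exists_chart w.pt
  apply (chartD_invertible c.base_mem (c.mapsTo _ hc)).injective
  refine Eq.trans ?_ (chartD_dproj_dpt c hc Z).symm
  exact (momAdapted c).chartD_dproj hc Z

/-- The coordinate `p` of a form is the form read in the chart, and the projection to `E` becomes
`momProj`; so `Θ` is tautological in natural coordinates. -/
theorem formInChart_theta {z : MomModel m F} (hz : z ∈ (momTop c).target) :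
    formInChart (Momentum.theta (P := P)) (momTop c) z = stdTheta z := by
  have hw : (momTop c).symm z ∈ (momTop c).source := (momTop c).map_target hz
  set w := (momTop c).symm z with hwdef
  have hz' : momTop c w = z := (momTop c).right_inv hz
  ext Z
  have h1 : formInChart (Momentum.theta (P := P)) (momTop c) z Z =
      w.form.1 fun i => w.dpt (chartDinv (momTop c) w (Z i)) := rfl
  have h2 : z.2.2 = c.momentumCoord hw w.form := by
    rw [← hz']
    exact momTop_snd_snd c hw
  have h3 : stdTheta z Z = z.2.2.1 fun i => momProj m F (Z i) := rfl
  rw [h1, h3, h2]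
  have h4 : ∀ y : Fin m → Eu m × F, (c.momentumCoord hw w.form).1 y =
      w.form.1 fun i => chartDinv c.top w.pt (y i) := fun y => rfl
  rw [h4]
  congr 1
  funext i
  apply (chartD_invertible c.top_mem hw).injective
  rw [chartD_dpt c hw, chartD_chartDinv (momTop_mem c) hw]
  exact (chartD_chartDinv c.top_mem hw _).symm

/-- `Θ` has linear coefficients in a natural chart and `d` may be computed there, so `Ω` has
constant coefficients. -/
theorem omega_apply {w : Momentum P m} (hw : w.pt ∈ c.top.source) (Z : Fin (m + 1) → TMom w) :
    w.omega Z = stdOmega fun i => (chartD (momTop c) w (Z i) : MomModel m F) := by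
  have hw' : w ∈ (momTop c).source := hw
  have ht := (momTop c).map_source hw'
  have he : formInChart (Momentum.theta (P := P)) (momTop c) =ᶠ[𝓝 (momTop c w)] stdTheta := by
    filter_upwards [(momTop c).open_target.mem_nhds ht] with z hz
    exact formInChart_theta c hz
  obtain ⟨hd, hext⟩ := extDeriv_of_linear _ (stdTheta_apply_eq (m := m) (F := F)) (momTop c w)
  have h1 := extDerivAt_eq (momTop_mem c) hw' (he.differentiableAt_iff.2 hd)
  refine (congrArg Neg.neg (DFunLike.congr_fun h1 Z)).trans ?_
  rw [he.extDeriv_eq]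
  exact congrArg Neg.neg (hext _)

end NaturalCharts

/-! ### The extended Legendre map in natural coordinates -/

section LegendreCoordinates

variable {m : ℕ} {F M B : Type*} [NormedAddCommGroup F] [NormedSpace ℝ F]
  [TopologicalSpace M] [ChartedSpace (Eu m) M]
  [TopologicalSpace B] [ChartedSpace (Eu m × F) B]
  {P : FibredManifold (Eu m) F M B} (L : LagrangianSystem P)
  (c : AdaptedChart (V := Eu m) (F := F) P.proj)

/-- The Lagrangian function in natural coordinates. -/
def lagC (q : JetModel m F) : ℝ := L.lag ((jetTop c).symm q)

/-- The volume form in natural coordinates. -/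
def volC (x : Eu m) : FormOn m (Eu m) := formInChart L.vol c.base x

/-- The momenta `∂£/∂v^A_ν` in natural coordinates. -/
def momentaC (q : JetModel m F) : F →L[ℝ] Eu m :=
  ∑ ν, ((fderiv ℝ (lagC L c) q).comp ((ContinuousLinearMap.inr ℝ (Eu m × F) (Eu m →L[ℝ] F)).comp
    (ContinuousLinearMap.smulRightL ℝ (Eu m) F (EuclideanSpace.proj ν)))).smulRight (stdVec m ν)

/-- The extended Legendre map in natural coordinates. -/
def legC (q : JetModel m F) : MomModel m F :=
  (q.1.1, q.1.2, mom (volC L c q.1.1) q.2 (momentaC L c q) (lagC L c q))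

/-- The coefficient `ρ£` of the Lagrangian density in natural coordinates. -/
def densityC (q : JetModel m F) : ℝ := volC L c q.1.1 (stdVec m) * lagC L c q

/-- The derivative of `ρ£` with respect to the coordinates `(x, y)`. -/
def densityD (q : JetModel m F) : Eu m × F →L[ℝ] ℝ :=
  (fderiv ℝ (densityC L c) q).comp (ContinuousLinearMap.inl ℝ (Eu m × F) (Eu m →L[ℝ] F))

theorem contDiffOn_lagC : ContDiffOn ℝ ∞ (lagC L c) (jetTop c).target := by
  rw [← contMDiffOn_iff_contDiffOn]
  exact L.lag_smooth.comp_contMDiffOn (contMDiffOn_symm_of_mem_maximalAtlas (jetTop_mem c))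

theorem lagC_jetTop {j : Jet1 P} (hj : j ∈ (jetTop c).source) : lagC L c (jetTop c j) = L.lag j := by
  rw [lagC, (jetTop c).left_inv hj]

theorem differentiableAt_lagC {q : JetModel m F} (hq : q ∈ (jetTop c).target) :
    DifferentiableAt ℝ (lagC L c) q :=
  ((contDiffOn_lagC L c).contDiffAt ((jetTop c).open_target.mem_nhds hq)).differentiableAt
    (by simp)

theorem contDiffOn_fderiv_lagC : ContDiffOn ℝ ∞ (fderiv ℝ (lagC L c)) (jetTop c).target :=
  (contDiffOn_lagC L c).fderiv_of_isOpen (jetTop c).open_target (by simp)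

theorem momentaC_apply (q : JetModel m F) (η : F) (k : Fin m) :
    momentaC L c q η k =
      fderiv ℝ (lagC L c) q (0, (EuclideanSpace.proj k : Eu m →L[ℝ] ℝ).smulRight η) := by
  simp [momentaC, sum_apply, stdVec_apply]

theorem sum_proj_smulRight (A : Eu m →L[ℝ] F) :
    ∑ k, (EuclideanSpace.proj k : Eu m →L[ℝ] ℝ).smulRight (A (stdVec m k)) = A := by
  refine eu_hom_ext fun l => ?_
  simp [sum_apply, stdVec_apply]

theorem sum_momentaC (q : JetModel m F) (A : Eu m →L[ℝ] F) :
    ∑ k, momentaC L c q (A (stdVec m k)) k = fderiv ℝ (lagC L c) q (0, A) := by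
  simp only [momentaC_apply]
  rw [← map_sum]
  congr 1
  refine Prod.ext (by simp [Prod.fst_sum]) ?_
  rw [Prod.snd_sum]
  exact sum_proj_smulRight A

theorem fst_mem_base_target {q : JetModel m F} (hq : q ∈ (jetTop c).target) :
    q.1.1 ∈ c.base.target := by
  have h1 : q.1 ∈ c.top.target := hq.1
  have h2 := c.top.map_target h1
  have h3 := c.fst_eq _ h2
  rw [c.top.right_inv h1] at h3
  rw [h3]
  exact c.base.map_source (c.mapsTo _ h2)

/-- In jet coordinates `shift η` adds to `v` the linear expression `Lin η`, the vertical part of `η`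
along `j`. The chain rule then turns the fibre derivative into `∂£/∂v`. -/
theorem fderiv_lag_shift {j : Jet1 P} (hj : j.pt ∈ c.top.source) (φ : Eu m →L[ℝ] ℝ)
    (Z : TTotal m F j.pt) :
    (fderiv ℝ (fun η : Eu m →L[ℝ] Eu m × F => L.lag ⟨j.pt, j.val.shift η⟩) 0)
      (φ.smulRight (Z : Eu m × F)) =
    fderiv ℝ (lagC L c) (jetTop c j) (0, (φ.comp (chartDinv c.base (P.proj j.pt))).smulRight
      (vertPart (c.jetCoord j) (chartD c.top j.pt Z))) := by
  let θ : Eu m × F →L[ℝ] F := (vertPart (c.jetCoord j)).comp (chartD c.top j.pt)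
  let R : Eu m →L[ℝ] Eu m := chartDinv c.base (P.proj j.pt)
  let Lin : (Eu m →L[ℝ] Eu m × F) →L[ℝ] (Eu m →L[ℝ] F) :=
    ((ContinuousLinearMap.compL ℝ (Eu m) (Eu m × F) F) θ).comp
      ((ContinuousLinearMap.compL ℝ (Eu m) (Eu m) (Eu m × F)).flip R)
  have hLin : ∀ η u, Lin η u = vertPart (c.jetCoord j) (chartD c.top j.pt (η (R u))) :=
    fun η u => rfl
  have key : ∀ η : Eu m →L[ℝ] Eu m × F,
      jetTop c ⟨j.pt, j.val.shift η⟩ = (c.top j.pt, c.jetCoord j + Lin η) := by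
    intro η
    rw [jetTop_apply]
    refine Prod.ext rfl ?_
    ext u
    rw [add_apply, hLin]
    let y : TTotal m F j.pt := η (R u)
    have h1 := c.chartD_jet hj (chartD c.base (P.proj j.pt) (P.dproj j.pt y))
    rw [chartDinv_chartD c.base_mem (c.mapsTo _ hj), c.chartD_dproj hj] at h1
    have h2 : c.jetCoord ⟨j.pt, j.val.shift η⟩ u = (chartD c.top j.pt (j.val.1 (R u) +
      (y - j.val.1 (P.dproj j.pt y)))).2 := rfl
    refine h2.trans ?_
    rw [map_add, map_sub, h1]
    rfl
  have h0 : (fun η : Eu m →L[ℝ] Eu m × F => L.lag ⟨j.pt, j.val.shift η⟩) =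
      fun η => lagC L c (c.top j.pt, c.jetCoord j + Lin η) := by
    funext η
    rw [← key, lagC_jetTop]
    exact hj
  have hd := (differentiableAt_lagC L c ((jetTop c).map_source hj)).hasFDerivAt
  have hg : HasFDerivAt (fun η : Eu m →L[ℝ] Eu m × F => (c.top j.pt, c.jetCoord j + Lin η))
      ((0 : (Eu m →L[ℝ] Eu m × F) →L[ℝ] Eu m × F).prod Lin) 0 :=
    (hasFDerivAt_const _ _).prodMk (Lin.hasFDerivAt.const_add _)
  have hq : (c.top j.pt, c.jetCoord j + Lin 0) = jetTop c j := by
    rw [map_zero, add_zero]; rfl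
  have hcomp := HasFDerivAt.comp (0 : Eu m →L[ℝ] Eu m × F) (by rw [hq]; exact hd) hg
  rw [h0]
  refine (DFunLike.congr_fun hcomp.fderiv _).trans ?_
  rw [ContinuousLinearMap.comp_apply, ContinuousLinearMap.prod_apply]
  congr 2
  ext u
  rw [hLin]
  change vertPart (c.jetCoord j) (chartD c.top j.pt (φ (R u) • Z)) =
    φ (R u) • vertPart (c.jetCoord j) (chartD c.top j.pt Z)
  rw [map_smul, map_smul]

/-- `momentumMap` sums over the standard basis of the model of `T_x M`, which need not be the
coordinate basis of `c`. A contraction of dual bases does not depend on the basis: the matrices `R`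
and `Q` of the change cancel. -/
theorem chartD_momentumMap {j : Jet1 P} (hj : j.pt ∈ c.top.source) (Z : TTotal m F j.pt) :
    chartD c.base (P.proj j.pt) (L.momentumMap j Z) =
      momentaC L c (jetTop c j) (vertPart (c.jetCoord j) (chartD c.top j.pt Z)) := by
  set θ := vertPart (c.jetCoord j) (chartD c.top j.pt Z) with hθ
  let R : Eu m →L[ℝ] Eu m := chartDinv c.base (P.proj j.pt)
  let Q : Eu m →L[ℝ] Eu m := chartD c.base (P.proj j.pt)
  have hQR : ∀ u, Q (R u) = u := chartD_chartDinv c.base_mem (c.mapsTo _ hj)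
  let ℓ : (Eu m →L[ℝ] ℝ) →L[ℝ] ℝ := (fderiv ℝ (lagC L c) (jetTop c j)).comp
    ((ContinuousLinearMap.inr ℝ (Eu m × F) (Eu m →L[ℝ] F)).comp
      ((ContinuousLinearMap.smulRightL ℝ (Eu m) F).flip θ))
  have hℓ : ∀ φ, ℓ φ = fderiv ℝ (lagC L c) (jetTop c j) (0, φ.smulRight θ) := fun φ => rfl
  have h1 : (L.momentumMap j Z : Eu m) =
      ∑ ν, ℓ ((EuclideanSpace.proj ν : Eu m →L[ℝ] ℝ).comp R) • stdVec m ν := by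
    have : (L.momentumMap j Z : Eu m) = ∑ ν,
        (fderiv ℝ (fun η : Eu m →L[ℝ] Eu m × F => L.lag ⟨j.pt, j.val.shift η⟩) 0)
          ((EuclideanSpace.proj ν : Eu m →L[ℝ] ℝ).smulRight (Z : Eu m × F)) • stdVec m ν := by
      have hD : ∀ (D : (Eu m →L[ℝ] Eu m × F) →L[ℝ] ℝ) (z : Eu m × F),
          (∑ ν, (D.comp (ContinuousLinearMap.smulRightL ℝ (Eu m) (Eu m × F)
            (EuclideanSpace.proj ν))).smulRight (EuclideanSpace.single ν (1 : ℝ))) z =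
          ∑ ν, D ((EuclideanSpace.proj ν : Eu m →L[ℝ] ℝ).smulRight z) • stdVec m ν := by
        intro D z
        rw [sum_apply]
        rfl
      exact hD _ Z
    rw [this]
    refine Finset.sum_congr rfl fun ν _ => ?_
    rw [fderiv_lag_shift L c hj]
    rfl
  have h2 : ∀ ν, (EuclideanSpace.proj ν : Eu m →L[ℝ] ℝ).comp R =
      ∑ μ, (R (stdVec m μ) ν) • (EuclideanSpace.proj μ : Eu m →L[ℝ] ℝ) := by
    intro ν
    refine eu_hom_ext fun k => ?_
    simp [sum_apply, stdVec_apply]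
  have h3 : Q (L.momentumMap j Z : Eu m) = momentaC L c (jetTop c j) θ := by
    have h4 : Q (L.momentumMap j Z : Eu m) =
        ∑ μ, ℓ (EuclideanSpace.proj μ : Eu m →L[ℝ] ℝ) • stdVec m μ := by
      rw [h1]
      simp only [h2, map_sum, map_smul, Finset.sum_smul]
      rw [Finset.sum_comm]
      refine Finset.sum_congr rfl fun μ _ => ?_
      have h5 := congrArg Q (sum_stdVec (R (stdVec m μ)))
      rw [hQR] at h5
      conv_rhs => rw [← h5]
      rw [map_sum, Finset.smul_sum]
      refine Finset.sum_congr rfl fun ν _ => ?_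
      rw [map_smul, smul_smul, smul_eq_mul, mul_comm]
    rw [h4]
    ext k
    rw [momentaC_apply, ← hℓ]
    simp [stdVec_apply]
  exact h3

variable [FiniteDimensional ℝ F]

theorem momTop_legendre {j : Jet1 P} (hj : j.pt ∈ c.top.source) :
    momTop c (L.legendre j) = legC L c (jetTop c j) := by
  refine Prod.ext rfl (Prod.ext rfl ?_)
  have hj' : (L.legendre j).pt ∈ c.top.source := hj
  rw [momTop_snd_snd c hj']
  apply Subtype.ext
  apply ContinuousAlternatingMap.ext
  intro Z
  have hbase := c.fst_eq _ hj
  have hvol : ∀ y : Fin m → TBase m (P.proj j.pt), L.vol (P.proj j.pt) y =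
      volC L c (jetTop c j).1.1 fun i => chartD c.base (P.proj j.pt) (y i) := by
    intro y
    have h1 : ∀ x, x = P.proj j.pt → L.vol (P.proj j.pt) y =
        L.vol x (fun i => chartDinv c.base x (chartD c.base (P.proj j.pt) (y i))) := by
      rintro x rfl
      simp only [chartDinv_chartD c.base_mem (c.mapsTo _ hj)]
    refine h1 (c.base.symm (c.top j.pt).1) ?_
    rw [hbase, c.base.left_inv (c.mapsTo _ hj)]
  have h2 : (c.momentumCoord hj' (L.legendre j).form).1 Z =
      ∑ i, L.vol (P.proj j.pt) (Function.update (fun k => P.dproj j.pt (chartDinv c.top j.pt (Z k)))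
        i (L.momentumMap j (chartDinv c.top j.pt (Z i)))) +
      L.lag j * L.vol (P.proj j.pt) fun k => P.dproj j.pt (chartDinv c.top j.pt (Z k)) := by
    rw [← insertForm_apply (L.vol (P.proj j.pt)) (P.dproj j.pt) (L.momentumMap j)]
    rfl
  rw [h2]
  refine Eq.trans ?_ (mom_apply _ _ _ _ _).symm
  have h3 : ∀ z, chartD c.base (P.proj j.pt) (P.dproj j.pt (chartDinv c.top j.pt z)) = z.1 := by
    intro z
    rw [c.chartD_dproj hj, chartD_chartDinv c.top_mem hj]
  simp only [hvol, h3, lagC_jetTop L c (show j ∈ (jetTop c).source from hj)]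
  congr 1
  refine Finset.sum_congr rfl fun i _ => ?_
  refine congrArg _ (funext fun k => ?_)
  rcases eq_or_ne k i with rfl | hk
  · rw [Function.update_self, Function.update_self, chartD_momentumMap L c hj,
      chartD_chartDinv c.top_mem hj]
    rfl
  · rw [Function.update_of_ne hk, Function.update_of_ne hk, h3]

end LegendreCoordinates

/-! ### Smooth dependence of momenta on parameters -/

section SmoothMomenta

variable {m : ℕ} {F : Type*} [NormedAddCommGroup F] [NormedSpace ℝ F]
  {Q J : Type*} [NormedAddCommGroup Q] [NormedSpace ℝ Q] [TopologicalSpace J] [ChartedSpace Q J]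

theorem contMDiffOn_update {X : Type*} [NormedAddCommGroup X] [NormedSpace ℝ X] {ι : Type*}
    [DecidableEq ι] {s : Set J} {f : J → ι → X} {g : J → X} {i : ι}
    (hf : ∀ k, ContMDiffOn 𝓘(ℝ, Q) 𝓘(ℝ, X) ∞ (fun q => f q k) s)
    (hg : ContMDiffOn 𝓘(ℝ, Q) 𝓘(ℝ, X) ∞ g s) (k : ι) :
    ContMDiffOn 𝓘(ℝ, Q) 𝓘(ℝ, X) ∞ (fun q => Function.update (f q) i (g q) k) s := by
  rcases eq_or_ne k i with rfl | hk
  · simpa using hg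
  · simpa [hk] using hf k

theorem apply_fderiv_eq {E G Z : Type*} [NormedAddCommGroup E] [NormedSpace ℝ E]
    [NormedAddCommGroup G] [NormedSpace ℝ G] [NormedAddCommGroup Z] [NormedSpace ℝ Z]
    (T : G →L[ℝ] Z) {f : E → G} {q : E} (hf : DifferentiableAt ℝ f q) (W : E) :
    T (fderiv ℝ f q W) = fderiv ℝ (fun p => T (f p)) q W :=
  (DFunLike.congr_fun (T.hasFDerivAt.comp q hf.hasFDerivAt).fderiv W).symm

variable [FiniteDimensional ℝ F]

theorem contMDiffOn_mom {s : Set J} {w : J → FormOn m (Eu m)} {v : J → Eu m →L[ℝ] F}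
    {A : J → F →L[ℝ] Eu m} {r : J → ℝ}
    (hw : ContMDiffOn 𝓘(ℝ, Q) 𝓘(ℝ, FormOn m (Eu m)) ∞ w s)
    (hv : ContMDiffOn 𝓘(ℝ, Q) 𝓘(ℝ, Eu m →L[ℝ] F) ∞ v s)
    (hA : ContMDiffOn 𝓘(ℝ, Q) 𝓘(ℝ, F →L[ℝ] Eu m) ∞ A s)
    (hr : ContMDiffOn 𝓘(ℝ, Q) 𝓘(ℝ, ℝ) ∞ r s) :
    ContMDiffOn 𝓘(ℝ, Q) 𝓘(ℝ, MomentumModel (Eu m) F m) ∞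
      (fun q => mom (w q) (v q) (A q) (r q)) s := by
  refine contMDiffOn_form_of_apply _ fun Z => ?_
  simp only [mom_apply]
  refine (contMDiffOn_finsetSum fun i _ => ?_).add (hr.mul ?_)
  · refine contMDiffOn_form_apply (Z := fun k q => Function.update (fun j => (Z j).1) i
      (A q ((Z i).2 - v q (Z i).1)) k) hw fun k => ?_
    exact contMDiffOn_update (fun k => contMDiffOn_const)
      (hA.clm_apply (contMDiffOn_const.sub (hv.clm_apply contMDiffOn_const))) k
  · exact contMDiffOn_form_apply (Z := fun k _ => (Z k).1) hw fun k => contMDiffOn_const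

theorem contMDiffOn_momCoef {s : Set J} {v : J → Eu m →L[ℝ] F}
    {a : J → MomentumModel (Eu m) F m}
    (hv : ContMDiffOn 𝓘(ℝ, Q) 𝓘(ℝ, Eu m →L[ℝ] F) ∞ v s)
    (ha : ContMDiffOn 𝓘(ℝ, Q) 𝓘(ℝ, MomentumModel (Eu m) F m) ∞ a s) :
    ContMDiffOn 𝓘(ℝ, Q) 𝓘(ℝ, F →L[ℝ] Eu m) ∞ (fun q => momCoef (v q) (a q)) s := by
  refine contMDiffOn_clm_of_apply (Module.finBasis ℝ F) fun i => ?_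
  set η := Module.finBasis ℝ F i
  have h : ∀ q, momCoef (v q) (a q) η =
      ∑ k, (a q).1 (Function.update (tup (v q)) k (0, η)) • stdVec m k := by
    intro q
    conv_lhs => rw [← sum_stdVec (momCoef (v q) (a q) η)]
    simp only [momCoef_apply]
  simp only [h]
  refine contMDiffOn_finsetSum fun k _ => ?_
  suffices h2 : ContMDiffOn 𝓘(ℝ, Q) 𝓘(ℝ, ℝ) ∞
      (fun q => (a q).1 (Function.update (tup (v q)) k (0, η))) s from h2.smul contMDiffOn_const
  refine contMDiffOn_form_apply (w := fun q => (a q).1)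
    (Z := fun l q => Function.update (tup (v q)) k (0, η) l)
    ((Submodule.subtypeL (twoVerticalForms m
      (ContinuousLinearMap.fst ℝ (Eu m) F))).contMDiff.comp_contMDiffOn ha) fun l => ?_
  exact contMDiffOn_update (fun l => contMDiffOn_const.prodMk_space
    (hv.clm_apply contMDiffOn_const)) contMDiffOn_const l

end SmoothMomenta

/-! ### The tangent map of the Legendre map -/

section LegendreDerivative

variable {m : ℕ} {F M B : Type*} [NormedAddCommGroup F] [NormedSpace ℝ F]
  [TopologicalSpace M] [ChartedSpace (Eu m) M]
  [TopologicalSpace B] [ChartedSpace (Eu m × F) B]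
  {P : FibredManifold (Eu m) F M B} (L : LagrangianSystem P)
  (c : AdaptedChart (V := Eu m) (F := F) P.proj)

theorem contDiffOn_volC [IsManifold 𝓘(ℝ, Eu m) ∞ M] :
    ContDiffOn ℝ ∞ (fun q : JetModel m F => volC L c q.1.1) (jetTop c).target :=
  (contDiffOn_formInChart L.vol_smooth c.base_mem).comp
    (contDiff_fst.comp contDiff_fst).contDiffOn fun _ hq => fst_mem_base_target c hq

theorem contDiffOn_density [IsManifold 𝓘(ℝ, Eu m) ∞ M] :
    ContDiffOn ℝ ∞ (fun q : JetModel m F => volC L c q.1.1 (stdVec m)) (jetTop c).target :=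
  (evalAt (stdVec m)).contDiff.comp_contDiffOn (contDiffOn_volC L c)

variable [FiniteDimensional ℝ F]

theorem contDiffOn_momentaC : ContDiffOn ℝ ∞ (momentaC L c) (jetTop c).target := by
  rw [← contMDiffOn_iff_contDiffOn]
  refine contMDiffOn_clm_of_apply (Module.finBasis ℝ F) fun i => ?_
  set η := Module.finBasis ℝ F i
  have h : ∀ q, momentaC L c q η = ∑ k, fderiv ℝ (lagC L c) q
      (0, (EuclideanSpace.proj k : Eu m →L[ℝ] ℝ).smulRight η) • stdVec m k := by
    intro q
    conv_lhs => rw [← sum_stdVec (momentaC L c q η)]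
    simp only [momentaC_apply]
  simp only [h]
  exact contMDiffOn_finsetSum fun k _ => ContMDiffOn.smul
    ((contMDiffOn_iff_contDiffOn.2 (contDiffOn_fderiv_lagC L c)).clm_apply contMDiffOn_const)
      contMDiffOn_const

variable [IsManifold 𝓘(ℝ, Eu m) ∞ M]

theorem contDiffOn_densityC : ContDiffOn ℝ ∞ (densityC L c) (jetTop c).target :=
  (contDiffOn_density L c).mul (contDiffOn_lagC L c)

theorem contDiffOn_densityD : ContDiffOn ℝ ∞ (densityD L c) (jetTop c).target :=
  ((contDiffOn_densityC L c).fderiv_of_isOpen (jetTop c).open_target (by simp)).clm_comp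
    contDiffOn_const

theorem contDiffOn_legC : ContDiffOn ℝ ∞ (legC L c) (jetTop c).target := by
  refine ContDiffOn.prodMk (contDiff_fst.comp contDiff_fst).contDiffOn
    (ContDiffOn.prodMk (contDiff_snd.comp contDiff_fst).contDiffOn ?_)
  rw [← contMDiffOn_iff_contDiffOn]
  exact contMDiffOn_mom (contMDiffOn_iff_contDiffOn.2 (contDiffOn_volC L c))
    contDiff_snd.contMDiff.contMDiffOn
    (contMDiffOn_iff_contDiffOn.2 (contDiffOn_momentaC L c))
    (contMDiffOn_iff_contDiffOn.2 (contDiffOn_lagC L c))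

theorem contMDiffOn_legendre : ContMDiffOn 𝓘(ℝ, JetModel m F) 𝓘(ℝ, MomModel m F) ∞ L.legendre
    (jetTop c).source := by
  have h1 : ContMDiffOn 𝓘(ℝ, JetModel m F) 𝓘(ℝ, MomModel m F) ∞
      (fun j => legC L c (jetTop c j)) (jetTop c).source :=
    (contMDiffOn_iff_contDiffOn.2 (contDiffOn_legC L c)).comp
      (contMDiffOn_of_mem_maximalAtlas (jetTop_mem c)) fun _ hj => (jetTop c).map_source hj
  have h2 : ∀ j ∈ (jetTop c).source, L.legendre j ∈ (momTop c).source := fun j hj => hj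
  refine ((contMDiffOn_symm_of_mem_maximalAtlas (momTop_mem c)).comp h1 fun j hj => ?_).congr
    fun j hj => ?_
  · rw [mem_preimage, ← momTop_legendre L c hj]
    exact (momTop c).map_source (h2 j hj)
  · rw [Function.comp_apply, ← momTop_legendre L c hj, (momTop c).left_inv (h2 j hj)]

/-- The `v`-derivatives drop out of the derivative of the Legendre map on the vectors that are
horizontal with respect to `v`. -/
theorem fderiv_legC_tup {q : JetModel m F} (hq : q ∈ (jetTop c).target) (W : JetModel m F) :
    (fderiv ℝ (legC L c) q W).2.2.1 (tup q.2) = densityD L c q W.1 := by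
  have hn := (jetTop c).open_target.mem_nhds hq
  have hleg : DifferentiableAt ℝ (legC L c) q :=
    ((contDiffOn_legC L c).contDiffAt hn).differentiableAt (by simp)
  have hlag := (differentiableAt_lagC L c hq).hasFDerivAt
  have hdlag : DifferentiableAt ℝ (fderiv ℝ (lagC L c)) q :=
    ((contDiffOn_fderiv_lagC L c).contDiffAt hn).differentiableAt (by simp)
  have hρ : DifferentiableAt ℝ (fun q : JetModel m F => volC L c q.1.1 (stdVec m)) q :=
    ((contDiffOn_density L c).contDiffAt hn).differentiableAt (by simp)
  have hdens : DifferentiableAt ℝ (densityC L c) q :=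
    ((contDiffOn_densityC L c).contDiffAt hn).differentiableAt (by simp)
  let ev : MomModel m F →L[ℝ] ℝ := (evalAt (tup q.2)).comp
    ((Submodule.subtypeL (twoVerticalForms m (ContinuousLinearMap.fst ℝ (Eu m) F))).comp
      ((ContinuousLinearMap.snd ℝ F _).comp (ContinuousLinearMap.snd ℝ (Eu m) _)))
  have h1 := apply_fderiv_eq (E := JetModel m F) (G := MomModel m F) (f := legC L c) ev hleg W
  -- With the arguments frozen at the lifts by `q.2`, the momentum at `p` evaluates to `ρ£`
  -- corrected by the first-order term in `p.2 - q.2` (`mom_tup`).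
  have h2 : (fun p => ev (legC L c p)) = fun p => densityC L c p -
      volC L c p.1.1 (stdVec m) * fderiv ℝ (lagC L c) p ((0 : Eu m × F), p.2 - q.2) := by
    funext p
    change (legC L c p).2.2.1 (tup q.2) = _
    rw [legC, mom_tup, densityC]
    have := sum_momentaC L c p (q.2 - p.2)
    simp only [sub_apply] at this
    rw [this]
    have h3 : ((0 : Eu m × F), q.2 - p.2) = -((0 : Eu m × F), p.2 - q.2) := by
      rw [Prod.neg_mk, neg_zero, neg_sub]
    rw [h3, map_neg]
    ring
  have h3 : HasFDerivAt (fun p : JetModel m F => ((0 : Eu m × F), p.2 - q.2))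
      ((0 : JetModel m F →L[ℝ] Eu m × F).prod (ContinuousLinearMap.snd ℝ _ _)) q :=
    (hasFDerivAt_const _ _).prodMk (hasFDerivAt_snd.sub_const _)
  have h4 := hdens.hasFDerivAt.sub (hρ.hasFDerivAt.mul (hdlag.hasFDerivAt.clm_apply h3))
  rw [h2] at h1
  have h5 := h1.trans (DFunLike.congr_fun h4.fderiv W)
  have h6 : HasFDerivAt (densityC L c) _ q := hρ.hasFDerivAt.mul hlag
  -- `ρ` is a function of `x` alone, hence constant along a line in the velocity direction.
  have h7 : fderiv ℝ (fun q : JetModel m F => volC L c q.1.1 (stdVec m)) q (0, W.2) = 0 := by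
    have hz : HasFDerivAt (fun t : ℝ => q + t • ((0 : Eu m × F), W.2))
        (ContinuousLinearMap.toSpanSingleton ℝ ((0 : Eu m × F), W.2)) 0 :=
      (ContinuousLinearMap.toSpanSingleton ℝ ((0 : Eu m × F), W.2)).hasFDerivAt.const_add _
    have hq0 : q + (0 : ℝ) • ((0 : Eu m × F), W.2) = q := by simp
    have hc := HasFDerivAt.comp (0 : ℝ) (by rw [hq0]; exact hρ.hasFDerivAt) hz
    have hconst : ((fun q : JetModel m F => volC L c q.1.1 (stdVec m)) ∘
        fun t : ℝ => q + t • ((0 : Eu m × F), W.2)) = fun _ => volC L c q.1.1 (stdVec m) := by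
      funext t
      simp
    rw [hconst] at hc
    have := DFunLike.congr_fun (hc.unique (hasFDerivAt_const _ _)) 1
    simpa using this
  have h8 : fderiv ℝ (densityC L c) q (0, W.2) =
      volC L c q.1.1 (stdVec m) * fderiv ℝ (lagC L c) q (0, W.2) := by
    rw [h6.fderiv]
    simp [h7]
  have hW : W = (W.1, 0) + (0, W.2) := by simp
  have h9 : fderiv ℝ (densityC L c) q W = densityD L c q W.1 +
      volC L c q.1.1 (stdVec m) * fderiv ℝ (lagC L c) q (0, W.2) := by
    conv_lhs => rw [hW, map_add, h8]
    rfl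
  refine h5.trans ?_
  -- The derivative of `d£` is applied to this zero vector, so second derivatives of `£` disappear.
  -- The two remaining terms in the velocity part of `W` cancel.
  have h10 : ((0 : Eu m × F), q.2 - q.2) = (0 : JetModel m F) := by
    rw [sub_self]; rfl
  rw [sub_apply, h9, add_apply, smul_apply, smul_apply, add_apply,
    ContinuousLinearMap.comp_apply, ContinuousLinearMap.flip_apply, h10, map_zero, map_zero,
    zero_smul, add_zero, add_zero, smul_eq_mul]
  exact add_sub_cancel_right _ _

theorem momProj_fderiv_legC {q : JetModel m F} (hq : q ∈ (jetTop c).target) (W : JetModel m F) :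
    momProj m F (fderiv ℝ (legC L c) q W) = W.1 := by
  have hleg : DifferentiableAt ℝ (legC L c) q :=
    ((contDiffOn_legC L c).contDiffAt
      ((jetTop c).open_target.mem_nhds hq)).differentiableAt (by simp)
  refine (apply_fderiv_eq (E := JetModel m F) (G := MomModel m F) (f := legC L c)
    (momProj m F) hleg W).trans ?_
  exact DFunLike.congr_fun hasFDerivAt_fst.fderiv W

theorem chartD_dlegendre {j : Jet1 P} (hj : j ∈ (jetTop c).source) (W : TJet j) :
    (chartD (momTop c) (L.legendre j) (L.dlegendre j W) : MomModel m F) =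
      fderiv ℝ (legC L c) (jetTop c j) (chartD (jetTop c) j W) := by
  have hd : MDifferentiableAt 𝓘(ℝ, JetModel m F) 𝓘(ℝ, MomModel m F) L.legendre j :=
    ((contMDiffOn_legendre L c).contMDiffAt
      ((jetTop c).open_source.mem_nhds hj)).mdifferentiableAt (by simp)
  have h := chartD_mfderiv (jetTop_mem c) (momTop_mem c) hj
    (show L.legendre j ∈ (momTop c).source from hj) hd W
  have h2 : momTop c ∘ L.legendre ∘ (jetTop c).symm =ᶠ[𝓝 (jetTop c j)] legC L c := by
    filter_upwards [(jetTop c).open_target.mem_nhds ((jetTop c).map_source hj)] with z hz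
    rw [Function.comp_apply, Function.comp_apply, momTop_legendre L c ((jetTop c).map_target hz),
      (jetTop c).right_inv hz]
  rw [h2.fderiv_eq] at h
  exact h

end LegendreDerivative

/-! ### Normed and module structure on the space of coordinate tensors -/

section Instances

variable {m : ℕ} {F : Type*} [NormedAddCommGroup F] [NormedSpace ℝ F] [FiniteDimensional ℝ F]

set_option synthInstance.maxHeartbeats 400000 in
instance normedAddCommGroupEuHomMom : NormedAddCommGroup (EuHom m (MomModel m F)) := inferInstance

set_option synthInstance.maxHeartbeats 400000 in
instance normedSpaceEuHomMom : NormedSpace ℝ (EuHom m (MomModel m F)) := inferInstance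

instance addCommGroupEuHomMom : AddCommGroup (EuHom m (MomModel m F)) := inferInstance

instance addCommMonoidEuHomMom : AddCommMonoid (EuHom m (MomModel m F)) := inferInstance

instance moduleEuHomMom : Module ℝ (EuHom m (MomModel m F)) := NormedSpace.toModule

instance smulEuHomMom : SMul ℝ (EuHom m (MomModel m F)) :=
  moduleEuHomMom.toDistribMulAction.toSMul

end Instances

/-! ### Coordinates on the trace-free coefficients -/

section TracefreeBasis

variable {m : ℕ} {F : Type*} [NormedAddCommGroup F] [NormedSpace ℝ F] [FiniteDimensional ℝ F]

/-- `γ` is a basis coordinate map composed with a linear retraction onto the kernel. Being defined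
and continuous on all of `X`, it turns smooth kernel-valued functions into smooth coefficients. -/
theorem exists_coordinates_of_finrank_ker {X Y : Type*} [NormedAddCommGroup X] [NormedSpace ℝ X]
    [FiniteDimensional ℝ X] [AddCommGroup Y] [Module ℝ Y] (t : X →ₗ[ℝ] Y) {n : ℕ}
    (hn : Module.finrank ℝ (LinearMap.ker t) = n) :
    ∃ (τ : Fin n → X) (γ : X →L[ℝ] (Fin n → ℝ)),
      LinearIndependent ℝ τ ∧ (∀ i, t (τ i) = 0) ∧ ∀ T, t T = 0 → ∑ i, γ T i • τ i = T := by
  let K := LinearMap.ker t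
  let b : Module.Basis (Fin n) ℝ K := Module.finBasisOfFinrankEq ℝ K hn
  obtain ⟨r, hr⟩ := LinearMap.exists_leftInverse_of_injective K.subtype (by simp)
  refine ⟨fun i => (b i : X),
    LinearMap.toContinuousLinearMap (b.equivFun.toLinearMap.comp r),
    b.linearIndependent.map' K.subtype (by simp), fun i => (b i).2, fun T hT => ?_⟩
  have h1 : r T = ⟨T, hT⟩ := DFunLike.congr_fun hr (⟨T, hT⟩ : K)
  have h2 := congrArg K.subtype (b.sum_equivFun (r T))
  rw [map_sum] at h2
  simp only [map_smul] at h2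
  refine h2.trans ?_
  rw [h1]
  rfl

theorem exists_tracefree_basis (hm : 1 ≤ m) {N : ℕ} (hN : Module.finrank ℝ F = N) :
    ∃ (τ : Fin (N * (m ^ 2 - 1)) → Fin m → F →L[ℝ] Eu m)
      (γ : (Fin m → F →L[ℝ] Eu m) →L[ℝ] (Fin (N * (m ^ 2 - 1)) → ℝ)),
      LinearIndependent ℝ τ ∧ (∀ i, traceForm m F (τ i) = 0) ∧
        ∀ T, traceForm m F T = 0 → ∑ i, γ T i • τ i = T :=
  exists_coordinates_of_finrank_ker (traceForm m F) (by rw [finrank_ker_traceForm hm, hN])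

end TracefreeBasis

/-! ### Linearity and smoothness of the vertical part of a lift -/

section LiftFamilies

variable {m : ℕ} {F : Type*} [NormedAddCommGroup F] [NormedSpace ℝ F] [FiniteDimensional ℝ F]

theorem momHom_add (v : Eu m →L[ℝ] F) (T T' : Fin m → F →L[ℝ] Eu m) (s s' : Fin m → ℝ) :
    momHom v (T + T') (s + s') = momHom v T s + momHom v T' s' := by
  refine eu_hom_ext fun k => ?_
  rw [add_apply, momHom_stdVec, momHom_stdVec, momHom_stdVec, Pi.add_apply, Pi.add_apply, mom_add]
  simp

theorem momHom_smul (v : Eu m →L[ℝ] F) (T : Fin m → F →L[ℝ] Eu m) (a : ℝ) :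
    momHom v (a • T) 0 = a • momHom v T 0 := by
  refine eu_hom_ext fun k => ?_
  have h : (a • momHom v T 0) (stdVec m k) = a • momHom v T 0 (stdVec m k) := rfl
  rw [h, momHom_stdVec, momHom_stdVec, Pi.smul_apply, Pi.zero_apply]
  have := mom_smul (stdVol m) v (T k) 0 a
  rw [mul_zero] at this
  rw [this]
  simp

theorem momHom_zero (v : Eu m →L[ℝ] F) : momHom v (0 : Fin m → F →L[ℝ] Eu m) 0 = 0 := by
  have h := momHom_add v (0 : Fin m → F →L[ℝ] Eu m) 0 0 0
  rw [add_zero, add_zero] at h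
  exact left_eq_add.1 h

theorem momHom_sum {ι : Type*} (t : Finset ι) (v : Eu m →L[ℝ] F)
    (T : ι → Fin m → F →L[ℝ] Eu m) (a : ι → ℝ) :
    momHom v (∑ i ∈ t, a i • T i) 0 = ∑ i ∈ t, a i • momHom v (T i) 0 := by
  classical
  induction t using Finset.induction_on with
  | empty => rw [Finset.sum_empty, Finset.sum_empty, momHom_zero]
  | insert i t hi ih =>
    rw [Finset.sum_insert hi, Finset.sum_insert hi, ← ih, ← momHom_smul, ← momHom_add, add_zero]

/-- `liftCoef` recovers `T` from the lift. -/
theorem eq_zero_of_momHom_eq_zero {v : Eu m →L[ℝ] F} {T : Fin m → F →L[ℝ] Eu m}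
    (h : momHom v T 0 = 0) : T = 0 := by
  have h1 := liftCoef_horLift_add v T 0
  have h2 := liftCoef_horLift_add v (0 : Fin m → F →L[ℝ] Eu m) 0
  rw [h] at h1
  rw [momHom_zero] at h2
  rw [← h1, h2]

variable {Q J : Type*} [NormedAddCommGroup Q] [NormedSpace ℝ Q] [TopologicalSpace J]
  [ChartedSpace Q J] {S : Set J}

theorem contMDiffOn_euHom_of_apply {W : Type*} [NormedAddCommGroup W] [NormedSpace ℝ W]
    [FiniteDimensional ℝ W] {f : J → EuHom m W}
    (h : ∀ k, ContMDiffOn 𝓘(ℝ, Q) 𝓘(ℝ, W) ∞ (fun q => f q (stdVec m k)) S) :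
    ContMDiffOn 𝓘(ℝ, Q) 𝓘(ℝ, EuHom m W) ∞ f S :=
  contMDiffOn_clm_of_apply (stdBasis m) fun i => by simpa using h i

theorem contMDiffOn_momHom {v : J → Eu m →L[ℝ] F} {T : J → Fin m → F →L[ℝ] Eu m}
    {s : J → Fin m → ℝ} (hv : ContMDiffOn 𝓘(ℝ, Q) 𝓘(ℝ, Eu m →L[ℝ] F) ∞ v S)
    (hT : ∀ k, ContMDiffOn 𝓘(ℝ, Q) 𝓘(ℝ, F →L[ℝ] Eu m) ∞ (fun q => T q k) S)
    (hs : ∀ k, ContMDiffOn 𝓘(ℝ, Q) 𝓘(ℝ, ℝ) ∞ (fun q => s q k) S) :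
    ContMDiffOn 𝓘(ℝ, Q) 𝓘(ℝ, EuHom m (MomModel m F)) ∞ (fun q => momHom (v q) (T q) (s q)) S := by
  refine contMDiffOn_euHom_of_apply fun k => ?_
  simp only [momHom_stdVec]
  exact contMDiffOn_const.prodMk_space (contMDiffOn_const.prodMk_space
    (contMDiffOn_mom contMDiffOn_const hv (hT k) (hs k)))

theorem contMDiffOn_horLift {v : J → Eu m →L[ℝ] F}
    (hv : ContMDiffOn 𝓘(ℝ, Q) 𝓘(ℝ, Eu m →L[ℝ] F) ∞ v S) :
    ContMDiffOn 𝓘(ℝ, Q) 𝓘(ℝ, EuHom m (MomModel m F)) ∞ (fun q => horLift (v q)) S := by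
  refine contMDiffOn_euHom_of_apply fun k => ?_
  simp only [horLift_apply]
  exact contMDiffOn_const.prodMk_space ((hv.clm_apply contMDiffOn_const).prodMk_space
    contMDiffOn_const)

theorem contMDiffOn_liftCoef {v : J → Eu m →L[ℝ] F} {h : J → EuHom m (MomModel m F)}
    (hv : ContMDiffOn 𝓘(ℝ, Q) 𝓘(ℝ, Eu m →L[ℝ] F) ∞ v S)
    (hh : ContMDiffOn 𝓘(ℝ, Q) 𝓘(ℝ, EuHom m (MomModel m F)) ∞ h S) :
    ContMDiffOn 𝓘(ℝ, Q) 𝓘(ℝ, Fin m → F →L[ℝ] Eu m) ∞ (fun q => liftCoef (v q) (h q)) S := by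
  refine contMDiffOn_pi_space.2 fun k => contMDiffOn_momCoef hv ?_
  have h1 : ContMDiffOn 𝓘(ℝ, Q) 𝓘(ℝ, MomModel m F) ∞ (fun q => h q (stdVec m k)) S :=
    ContMDiffOn.clm_apply hh contMDiffOn_const
  exact (contDiff_snd.comp contDiff_snd).contMDiff.comp_contMDiffOn h1

end LiftFamilies

/-! ### Solutions at a single jet -/

section PointwiseSolutions

variable {m : ℕ} {F M B : Type*} [NormedAddCommGroup F] [NormedSpace ℝ F] [FiniteDimensional ℝ F]
  [TopologicalSpace M] [ChartedSpace (Eu m) M]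
  [TopologicalSpace B] [ChartedSpace (Eu m × F) B]
  {P : FibredManifold (Eu m) F M B} (L : LagrangianSystem P)
  (c : AdaptedChart (V := Eu m) (F := F) P.proj)

/-- A linear map `T_x M → T𝓜π` along the Legendre map that is semiholonomic and satisfies the
field equation. -/
def IsSolutionAt (j : Jet1 P) (l : TBase m (P.proj j.pt) →L[ℝ] TMom (L.legendre j)) : Prop :=
  (L.legendre j).dpt.comp l = j.val.1 ∧
    ∀ (Z : Fin m → TBase m (P.proj j.pt)) (W : TJet j),
      (L.legendre j).omega (Fin.cons (L.dlegendre j W) fun i => l (Z i)) = 0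

/-- A linear map `T_x M → T𝓜π` in natural coordinates. -/
def toCoord (j : Jet1 P) (l : TBase m (P.proj j.pt) →L[ℝ] TMom (L.legendre j)) :
    EuHom m (MomModel m F) :=
  (chartD (momTop c) (L.legendre j)).comp (l.comp (chartDinv c.base (P.proj j.pt)))

/-- The linear map `T_x M → T𝓜π` with given natural coordinates. -/
def ofCoord (j : Jet1 P) (h : EuHom m (MomModel m F)) :
    TBase m (P.proj j.pt) →L[ℝ] TMom (L.legendre j) :=
  (chartDinv (momTop c) (L.legendre j)).comp
    (ContinuousLinearMap.comp h (chartD c.base (P.proj j.pt)))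

variable {c}

theorem toCoord_ofCoord {j : Jet1 P} (hj : j.pt ∈ c.top.source) (h : EuHom m (MomModel m F)) :
    toCoord L c j (ofCoord L c j h) = h := by
  apply ContinuousLinearMap.ext
  intro u
  refine (chartD_chartDinv (momTop_mem c) (show L.legendre j ∈ (momTop c).source from hj) _).trans ?_
  exact congrArg h (chartD_chartDinv c.base_mem (c.mapsTo _ hj) u)

theorem ofCoord_toCoord {j : Jet1 P} (hj : j.pt ∈ c.top.source)
    (l : TBase m (P.proj j.pt) →L[ℝ] TMom (L.legendre j)) :
    ofCoord L c j (toCoord L c j l) = l := by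
  apply ContinuousLinearMap.ext
  intro u
  refine (chartDinv_chartD (momTop_mem c) (show L.legendre j ∈ (momTop c).source from hj) _).trans ?_
  exact congrArg l (chartDinv_chartD c.base_mem (c.mapsTo _ hj) u)

theorem toCoord_add (j : Jet1 P) (l l' : TBase m (P.proj j.pt) →L[ℝ] TMom (L.legendre j)) :
    toCoord L c j (l + l') = toCoord L c j l + toCoord L c j l' := by
  apply ContinuousLinearMap.ext
  intro u
  exact map_add (chartD (X := MomModel m F) (momTop c) (L.legendre j)) _ _

theorem toCoord_smul (j : Jet1 P) (a : ℝ)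
    (l : TBase m (P.proj j.pt) →L[ℝ] TMom (L.legendre j)) :
    toCoord L c j (a • l) = a • toCoord L c j l := by
  apply ContinuousLinearMap.ext
  intro u
  exact map_smul (chartD (X := MomModel m F) (momTop c) (L.legendre j)) _ _

theorem toCoord_zero (j : Jet1 P) : toCoord L c j 0 = 0 := by
  have := toCoord_smul L (c := c) j 0 0
  rwa [zero_smul, zero_smul] at this

theorem toCoord_sum {ι : Type*} (t : Finset ι) (j : Jet1 P)
    (l : ι → TBase m (P.proj j.pt) →L[ℝ] TMom (L.legendre j)) :
    toCoord L c j (∑ i ∈ t, l i) = ∑ i ∈ t, toCoord L c j (l i) := by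
  classical
  induction t using Finset.induction_on with
  | empty => rw [Finset.sum_empty, Finset.sum_empty, toCoord_zero]
  | insert i t hi ih => rw [Finset.sum_insert hi, Finset.sum_insert hi, ← ih, toCoord_add]

/-- The natural basis of the tangent space of the base. -/
theorem exists_natural_basis {j : Jet1 P} (hj : j.pt ∈ c.top.source) :
    ∃ b : Module.Basis (Fin m) ℝ (TBase m (P.proj j.pt)),
      ∀ k, b k = chartDinv c.base (P.proj j.pt) (stdVec m k) := by
  obtain ⟨e, he⟩ := chartD_invertible c.base_mem (c.mapsTo _ hj)
  refine ⟨(stdBasis m).map e.symm.toLinearEquiv, fun k => ?_⟩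
  apply (chartD_invertible c.base_mem (c.mapsTo _ hj)).injective
  rw [chartD_chartDinv c.base_mem (c.mapsTo _ hj), ← he]
  simp

theorem isLift_toCoord_iff {j : Jet1 P} (hj : j.pt ∈ c.top.source)
    (l : TBase m (P.proj j.pt) →L[ℝ] TMom (L.legendre j)) :
    IsLift (c.jetCoord j) (toCoord L c j l) ↔ (L.legendre j).dpt.comp l = j.val.1 := by
  have h1 : ∀ u, momProj m F (toCoord L c j l u) =
      chartD c.top j.pt ((L.legendre j).dpt (l (chartDinv c.base (P.proj j.pt) u))) :=
    fun u => (chartD_dpt c (w := L.legendre j) hj _).symm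
  constructor
  · intro h
    apply ContinuousLinearMap.ext
    intro y
    apply (chartD_invertible c.top_mem hj).injective
    have h2 := h (chartD c.base (P.proj j.pt) y)
    rw [h1, chartDinv_chartD c.base_mem (c.mapsTo _ hj), ← c.chartD_jet hj,
      chartDinv_chartD c.base_mem (c.mapsTo _ hj)] at h2
    exact h2
  · intro h u
    rw [h1, ← c.chartD_jet hj]
    exact congrArg _ (DFunLike.congr_fun h _)

variable [IsManifold 𝓘(ℝ, Eu m) ∞ M]

/-- `stdOmega_cons` evaluates `Ω` in the chart and `fderiv_legC_tup` identifies the subtracted term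
with `densityD`. One natural basis of `T_x M` suffices, since the equation is of top degree in the
`Zᵢ`. -/
theorem isSolutionAt_iff {j : Jet1 P} (hj : j.pt ∈ c.top.source)
    (l : TBase m (P.proj j.pt) →L[ℝ] TMom (L.legendre j)) :
    IsSolutionAt L j l ↔ IsLift (c.jetCoord j) (toCoord L c j l) ∧
      ∀ z, ∑ k, (toCoord L c j l (stdVec m k)).2.2.1 (Function.update (tup (c.jetCoord j)) k z) =
        densityD L c (jetTop c j) z := by
  rw [IsSolutionAt, ← isLift_toCoord_iff L hj]
  refine and_congr_right fun hlift => ?_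
  obtain ⟨b, hb⟩ := exists_natural_basis hj
  have hq := (jetTop c).map_source (show j ∈ (jetTop c).source from hj)
  have key : ∀ W : TJet j, (L.legendre j).omega (Fin.cons (L.dlegendre j W) fun i => l (b i)) =
      ∑ k, (toCoord L c j l (stdVec m k)).2.2.1 (Function.update (tup (c.jetCoord j)) k
        (chartD (jetTop c) j W).1) - densityD L c (jetTop c j) (chartD (jetTop c) j W).1 := by
    intro W
    rw [omega_apply c (w := L.legendre j) hj]
    have h1 : (fun i => (chartD (momTop c) (L.legendre j)
        ((Fin.cons (L.dlegendre j W) fun i => l (b i) : Fin (m + 1) → TMom (L.legendre j)) i) :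
          MomModel m F)) = Fin.cons (chartD (momTop c) (L.legendre j) (L.dlegendre j W) :
            MomModel m F) fun k => toCoord L c j l (stdVec m k) := by
      funext i
      refine Fin.cases rfl (fun k => ?_) i
      simp only [Fin.cons_succ, hb]
      rfl
    rw [h1, stdOmega_cons, hlift.tup_eq, chartD_dlegendre L c hj]
    have h2 := fderiv_legC_tup L c hq (chartD (jetTop c) j W)
    have h3 := momProj_fderiv_legC L c hq (chartD (jetTop c) j W)
    have h4 : (jetTop c j).2 = c.jetCoord j := rfl
    rw [h4] at h2
    rw [h2, h3]
  constructor
  · intro H z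
    -- The equation depends on `W` only through its `(x, y)`-part, so the velocity part can be taken
    -- zero.
    have h1 := key (chartDinv (jetTop c) j (z, 0))
    rw [H, chartD_chartDinv (jetTop_mem c) hj] at h1
    exact (sub_eq_zero.1 h1.symm)
  · intro H Z W
    refine form_comp_eq_zero_of_basis _ l b _ ?_ Z
    rw [key, H, sub_self]

/-- An affine combination of solutions is a solution. -/
theorem IsSolutionAt.sum {ι : Type*} {t : Finset ι} {j : Jet1 P} {a : ι → ℝ}
    {l : ι → TBase m (P.proj j.pt) →L[ℝ] TMom (L.legendre j)}
    (hl : ∀ i ∈ t, IsSolutionAt L j (l i)) (ha : ∑ i ∈ t, a i = 1) :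
    IsSolutionAt L j (∑ i ∈ t, a i • l i) := by
  obtain ⟨c, hc⟩ := P.exists_chart j.pt
  rw [isSolutionAt_iff L hc]
  have e : ∀ u, toCoord L c j (∑ i ∈ t, a i • l i) u = ∑ i ∈ t, a i • toCoord L c j (l i) u := by
    intro u
    rw [toCoord_sum, sum_apply]
    refine Finset.sum_congr rfl fun i _ => ?_
    rw [toCoord_smul]
    rfl
  -- Lift condition and field equation both equate a linear expression in `l` with a fixed value, so
  -- weights of sum `1` preserve them.
  constructor
  · intro u
    rw [e, map_sum]
    have : ∀ i ∈ t, momProj m F (a i • toCoord L c j (l i) u) = a i • (u, c.jetCoord j u) := by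
      intro i hi
      rw [map_smul, ((isSolutionAt_iff L hc (l i)).1 (hl i hi)).1 u]
    rw [Finset.sum_congr rfl this, ← Finset.sum_smul, ha, one_smul]
  · intro z
    have e2 : ∀ k, (toCoord L c j (∑ i ∈ t, a i • l i) (stdVec m k)).2.2.1
        (Function.update (tup (c.jetCoord j)) k z) = ∑ i ∈ t, a i *
          (toCoord L c j (l i) (stdVec m k)).2.2.1 (Function.update (tup (c.jetCoord j)) k z) := by
      intro k
      let ev : MomModel m F →ₗ[ℝ] ℝ :=
        { toFun := fun x => x.2.2.1 (Function.update (tup (c.jetCoord j)) k z)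
          map_add' := fun _ _ => rfl
          map_smul' := fun _ _ => rfl }
      change ev _ = ∑ i ∈ t, a i * ev _
      rw [e, map_sum]
      simp only [map_smul, smul_eq_mul]
    simp only [e2]
    rw [Finset.sum_comm]
    simp only [← Finset.mul_sum]
    have : ∀ i ∈ t, a i * ∑ k, (toCoord L c j (l i) (stdVec m k)).2.2.1
        (Function.update (tup (c.jetCoord j)) k z) = a i * densityD L c (jetTop c j) z := by
      intro i hi
      rw [((isSolutionAt_iff L hc (l i)).1 (hl i hi)).2 z]
    rw [Finset.sum_congr rfl this, ← Finset.sum_mul, ha, one_mul]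

end PointwiseSolutions

/-! ### The affine space of coordinate solutions -/

section CoordinateSolutions

variable {m : ℕ} {F : Type*} [NormedAddCommGroup F] [NormedSpace ℝ F]

/-- Coefficients with trace `D` along the fibre. -/
def solCoef (D : Eu m × F →L[ℝ] ℝ) (k : Fin m) : F →L[ℝ] Eu m :=
  ((m : ℝ)⁻¹ • D.comp (ContinuousLinearMap.inr ℝ _ _)).smulRight (stdVec m k)

/-- The particular solution of the field equation in coordinates. -/
def baseSol (v : Eu m →L[ℝ] F) (D : Eu m × F →L[ℝ] ℝ) : EuHom m (MomModel m F) :=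
  horLift v + momHom v (solCoef D) fun k => D (tup v k)

theorem traceForm_solCoef (hm : 1 ≤ m) (D : Eu m × F →L[ℝ] ℝ) :
    traceForm m F (solCoef D) = D.comp (ContinuousLinearMap.inr ℝ _ _) := by
  ext η
  have : (m : ℝ) ≠ 0 := by positivity
  rw [traceForm_apply]
  simp [solCoef]
  field_simp

variable [FiniteDimensional ℝ F]

theorem tup_horLift_add (v : Eu m →L[ℝ] F) (T : Fin m → F →L[ℝ] Eu m) (s : Fin m → ℝ) (k : Fin m) :
    ((horLift v + momHom v T s) (stdVec m k)).2.2.1 (tup v) = s k := by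
  rw [add_apply, momHom_stdVec, horLift_apply]
  simp [mom_tup]

theorem baseSol_add_momHom (v : Eu m →L[ℝ] F) (D : Eu m × F →L[ℝ] ℝ)
    (T : Fin m → F →L[ℝ] Eu m) :
    baseSol v D + momHom v T 0 =
      horLift v + momHom v (solCoef D + T) fun k => D (tup v k) := by
  have h := momHom_add v (solCoef D) T (fun k => D (tup v k)) 0
  rw [add_zero] at h
  rw [baseSol, h, add_assoc]

theorem solves_baseSol_add (hm : 1 ≤ m) (v : Eu m →L[ℝ] F) (D : Eu m × F →L[ℝ] ℝ)
    {T : Fin m → F →L[ℝ] Eu m} (hT : traceForm m F T = 0) :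
    IsLift v (baseSol v D + momHom v T 0) ∧
      ∀ z, ∑ k, ((baseSol v D + momHom v T 0) (stdVec m k)).2.2.1 (Function.update (tup v) k z) =
        D z := by
  rw [lift_fieldEq_iff, baseSol_add_momHom]
  refine ⟨isLift_horLift_add _ _ _, fun k => tup_horLift_add _ _ _ k, ?_⟩
  rw [liftCoef_horLift_add, map_add, hT, traceForm_solCoef hm, add_zero]

/-- The horizontal values of a solution are forced and agree with those of `baseSol`, so the
deviation lies entirely in the coefficients and has trace zero. With `solves_baseSol_add` this
identifies the solution set with `baseSol` plus the kernel of the trace. -/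
theorem eq_baseSol_add (hm : 1 ≤ m) {v : Eu m →L[ℝ] F} {D : Eu m × F →L[ℝ] ℝ}
    {h : EuHom m (MomModel m F)} (hl : IsLift v h)
    (hf : ∀ z, ∑ k, (h (stdVec m k)).2.2.1 (Function.update (tup v) k z) = D z) :
    traceForm m F (liftCoef v h - solCoef D) = 0 ∧
      h = baseSol v D + momHom v (liftCoef v h - solCoef D) 0 := by
  rw [lift_fieldEq_iff] at hf
  refine ⟨by rw [map_sub, hf.2, traceForm_solCoef hm, sub_self], ?_⟩
  rw [baseSol_add_momHom, add_sub_cancel]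
  conv_lhs => rw [hl.eq]
  simp only [hf.1]

variable {Q J : Type*} [NormedAddCommGroup Q] [NormedSpace ℝ Q] [TopologicalSpace J]
  [ChartedSpace Q J] {S : Set J}

theorem contMDiffOn_solCoef {D : J → Eu m × F →L[ℝ] ℝ}
    (hD : ContMDiffOn 𝓘(ℝ, Q) 𝓘(ℝ, Eu m × F →L[ℝ] ℝ) ∞ D S) (k : Fin m) :
    ContMDiffOn 𝓘(ℝ, Q) 𝓘(ℝ, F →L[ℝ] Eu m) ∞ (fun q => solCoef (D q) k) S := by
  refine contMDiffOn_clm_of_apply (Module.finBasis ℝ F) fun i => ?_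
  have h : ∀ q, solCoef (D q) k (Module.finBasis ℝ F i) =
      ((m : ℝ)⁻¹ * D q (0, Module.finBasis ℝ F i)) • stdVec m k := fun q => rfl
  simp only [h]
  suffices h2 : ContMDiffOn 𝓘(ℝ, Q) 𝓘(ℝ, ℝ) ∞
      (fun q => (m : ℝ)⁻¹ * D q (0, Module.finBasis ℝ F i)) S from h2.smul contMDiffOn_const
  exact contMDiffOn_const.mul (hD.clm_apply contMDiffOn_const)

theorem contMDiffOn_baseSol {v : J → Eu m →L[ℝ] F} {D : J → Eu m × F →L[ℝ] ℝ}
    (hv : ContMDiffOn 𝓘(ℝ, Q) 𝓘(ℝ, Eu m →L[ℝ] F) ∞ v S)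
    (hD : ContMDiffOn 𝓘(ℝ, Q) 𝓘(ℝ, Eu m × F →L[ℝ] ℝ) ∞ D S) :
    ContMDiffOn 𝓘(ℝ, Q) 𝓘(ℝ, EuHom m (MomModel m F)) ∞ (fun q => baseSol (v q) (D q)) S :=
  ContMDiffOn.add (contMDiffOn_horLift hv) (contMDiffOn_momHom hv (contMDiffOn_solCoef hD) fun k =>
    hD.clm_apply (contMDiffOn_const.prodMk_space (hv.clm_apply contMDiffOn_const)))

end CoordinateSolutions

/-! ### Smoothness of vector, jet and tensor fields along the Legendre map -/

section SmoothnessInCoordinates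

variable {m : ℕ} {F M B : Type*} [NormedAddCommGroup F] [NormedSpace ℝ F] [FiniteDimensional ℝ F]
  [TopologicalSpace M] [ChartedSpace (Eu m) M]
  [TopologicalSpace B] [ChartedSpace (Eu m × F) B]
  {P : FibredManifold (Eu m) F M B} (L : LagrangianSystem P)
  {c : AdaptedChart (V := Eu m) (F := F) P.proj} [IsManifold 𝓘(ℝ, Eu m) ∞ M]
  {S : Set (Jet1 P)}

theorem isSmoothTensor_iff (hS : S ⊆ (jetTop c).source) (H : L.TensorAlong) :
    L.IsSmoothTensor S H ↔ ContMDiffOn 𝓘(ℝ, JetModel m F) 𝓘(ℝ, EuHom m (MomModel m F)) ∞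
      (fun j => toCoord L c j (H j)) S :=
  contMDiffOn_inTangentCoordinates_iff c.base_mem ((contMDiffOn_base_proj c).mono hS)
    (fun _ hj => c.mapsTo _ (hS hj)) (momTop_mem c) ((contMDiffOn_legendre L c).mono hS) hS H

theorem isSmoothVector_iff (hS : S ⊆ (jetTop c).source) (X : ∀ j, TMom (L.legendre j)) :
    L.IsSmoothVector S X ↔ ContMDiffOn 𝓘(ℝ, JetModel m F) 𝓘(ℝ, MomModel m F) ∞
      (fun j => (chartD (momTop c) (L.legendre j) (X j) : MomModel m F)) S :=
  contMDiffOn_tangent_iff (momTop_mem c) ((contMDiffOn_legendre L c).mono hS) hS X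

/-- In natural charts a jet is the tensor `u ↦ (u, A u)`, with `A` its jet coordinate. The remaining
jet coordinates are those of the base point, which the Legendre map makes smooth. -/
theorem isSmoothJet_iff_of_subset (hS : S ⊆ (jetTop c).source) (Y : L.JetAlong) :
    L.IsSmoothJet S Y ↔ L.IsSmoothTensor S fun j => (Y j).1 := by
  refine Iff.trans ?_ (isSmoothTensor_iff L hS _).symm
  let e := jetTop (momAdapted c)
  let f : Jet1 P → Jet1 (momentumFibred P m) := fun j => ⟨L.legendre j, Y j⟩
  have hf : ∀ j ∈ S, f j ∈ e.source := fun j hj => hS hj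
  have he : ∀ j ∈ S, ∀ u, toCoord L c j (Y j).1 u = (u, (e (f j)).2 u) :=
    fun j hj u => (momAdapted c).chartD_jet (j := f j) (hf j hj) u
  have hleg : ContMDiffOn 𝓘(ℝ, JetModel m F) 𝓘(ℝ, MomModel m F) ∞
      (fun j => momTop c (L.legendre j)) S :=
    (contMDiffOn_of_mem_maximalAtlas (momTop_mem c)).comp ((contMDiffOn_legendre L c).mono hS) hS
  constructor
  · intro h
    have h1 : ContMDiffOn 𝓘(ℝ, JetModel m F) 𝓘(ℝ, JetModel m (F × MomentumModel (Eu m) F m)) ∞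
        (fun j => e (f j)) S := (contMDiffOn_of_mem_maximalAtlas (jetTop_mem (momAdapted c))).comp h hf
    have h2 : ContMDiffOn 𝓘(ℝ, JetModel m F) 𝓘(ℝ, EuHom m (F × MomentumModel (Eu m) F m)) ∞
        (fun j => (e (f j)).2) S := contDiff_snd.contMDiff.comp_contMDiffOn h1
    refine contMDiffOn_euHom_of_apply fun k => ?_
    refine ContMDiffOn.congr (f := fun j => (stdVec m k, (e (f j)).2 (stdVec m k))) ?_
      fun j hj => he j hj _
    exact contMDiffOn_const.prodMk_space (h2.clm_apply contMDiffOn_const)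
  · intro h
    have h2 : ContMDiffOn 𝓘(ℝ, JetModel m F) 𝓘(ℝ, EuHom m (F × MomentumModel (Eu m) F m)) ∞
        (fun j => (e (f j)).2) S := by
      refine contMDiffOn_euHom_of_apply fun k => ?_
      have h3 : ContMDiffOn 𝓘(ℝ, JetModel m F) 𝓘(ℝ, MomModel m F) ∞
        (fun j => toCoord L c j (Y j).1 (stdVec m k)) S :=
        ContMDiffOn.clm_apply h contMDiffOn_const
      exact (contDiff_snd.contMDiff.comp_contMDiffOn h3).congr fun j hj =>
        (congrArg Prod.snd (he j hj (stdVec m k))).symm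
    have h1 : ContMDiffOn 𝓘(ℝ, JetModel m F) 𝓘(ℝ, JetModel m (F × MomentumModel (Eu m) F m)) ∞
        (fun j => e (f j)) S := hleg.prodMk_space h2
    exact ((contMDiffOn_symm_of_mem_maximalAtlas (jetTop_mem (momAdapted c))).comp h1
      fun j hj => e.map_source (hf j hj)).congr fun j hj => (e.left_inv (hf j hj)).symm

theorem IsSmoothTensor.mono {S T : Set (Jet1 P)} {H : L.TensorAlong} (h : L.IsSmoothTensor S H)
    (hT : T ⊆ S) : L.IsSmoothTensor T H :=
  fun j hj => (h j (hT hj)).mono hT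

theorem isSmoothTensor_of_locally {H : L.TensorAlong}
    (h : ∀ j ∈ S, ∃ U, IsOpen U ∧ j ∈ U ∧ L.IsSmoothTensor (S ∩ U) H) : L.IsSmoothTensor S H := by
  intro j hj
  obtain ⟨U, hU, hjU, hH⟩ := h j hj
  exact (contMDiffWithinAt_inter (hU.mem_nhds hjU)).1 (hH j ⟨hj, hjU⟩)

theorem isSmoothJet_iff (Y : L.JetAlong) :
    L.IsSmoothJet S Y ↔ L.IsSmoothTensor S fun j => (Y j).1 := by
  constructor
  · intro h
    refine isSmoothTensor_of_locally L fun j hj => ?_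
    obtain ⟨c, hc⟩ := P.exists_chart j.pt
    refine ⟨(jetTop c).source, (jetTop c).open_source, hc, ?_⟩
    exact (isSmoothJet_iff_of_subset L inter_subset_right Y).1 (h.mono inter_subset_left)
  · intro h
    refine contMDiffOn_of_locally_contMDiffOn fun j hj => ?_
    obtain ⟨c, hc⟩ := P.exists_chart j.pt
    refine ⟨(jetTop c).source, (jetTop c).open_source, hc, ?_⟩
    exact (isSmoothJet_iff_of_subset L inter_subset_right Y).2
      (IsSmoothTensor.mono L h inter_subset_left)

theorem isSmoothTensor_congr (hS : S ⊆ (jetTop c).source) {H H' : L.TensorAlong}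
    (h : L.IsSmoothTensor S H) (e : ∀ j ∈ S, H' j = H j) : L.IsSmoothTensor S H' := by
  rw [isSmoothTensor_iff L hS] at h ⊢
  exact h.congr fun j hj => by rw [e j hj]

end SmoothnessInCoordinates

/-! ### The affine family of smooth solutions over a chart -/

section SolutionFamilies

variable {m : ℕ} {F M B : Type*} [NormedAddCommGroup F] [NormedSpace ℝ F] [FiniteDimensional ℝ F]
  [TopologicalSpace M] [ChartedSpace (Eu m) M]
  [TopologicalSpace B] [ChartedSpace (Eu m × F) B]
  {P : FibredManifold (Eu m) F M B} (L : LagrangianSystem P)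
  (c : AdaptedChart (V := Eu m) (F := F) P.proj)

/-- The particular solution in natural coordinates. -/
def localSol : L.TensorAlong :=
  fun j => ofCoord L c j (baseSol (c.jetCoord j) (densityD L c (jetTop c j)))

/-- The tensor whose values are tangent to the fibres of the multimomentum bundle, with the given
coefficients in natural coordinates. -/
def localDir (T : Fin m → F →L[ℝ] Eu m) : L.TensorAlong :=
  fun j => ofCoord L c j (momHom (c.jetCoord j) T 0)

variable {c} {S : Set (Jet1 P)}

theorem contMDiffOn_jetCoord : ContMDiffOn 𝓘(ℝ, JetModel m F) 𝓘(ℝ, EuHom m F) ∞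
    c.jetCoord (jetTop c).source :=
  contDiff_snd.contMDiff.comp_contMDiffOn (contMDiffOn_of_mem_maximalAtlas (jetTop_mem c))

variable [IsManifold 𝓘(ℝ, Eu m) ∞ M]

theorem contMDiffOn_densityD_jetTop :
    ContMDiffOn 𝓘(ℝ, JetModel m F) 𝓘(ℝ, Eu m × F →L[ℝ] ℝ) ∞
      (fun j => densityD L c (jetTop c j)) (jetTop c).source :=
  (contMDiffOn_iff_contDiffOn.2 (contDiffOn_densityD L c)).comp
    (contMDiffOn_of_mem_maximalAtlas (jetTop_mem c)) fun _ hj => (jetTop c).map_source hj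

theorem isSmoothTensor_localSol : L.IsSmoothTensor (jetTop c).source (localSol L c) := by
  rw [isSmoothTensor_iff L subset_rfl]
  exact (contMDiffOn_baseSol contMDiffOn_jetCoord (contMDiffOn_densityD_jetTop L)).congr
    fun j hj => toCoord_ofCoord L hj _

theorem isSmoothTensor_localDir (T : Fin m → F →L[ℝ] Eu m) :
    L.IsSmoothTensor (jetTop c).source (localDir L c T) := by
  rw [isSmoothTensor_iff L subset_rfl]
  have h : ContMDiffOn 𝓘(ℝ, JetModel m F) 𝓘(ℝ, EuHom m (MomModel m F)) ∞
      (fun j => momHom (c.jetCoord j) T 0) (jetTop c).source :=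
    contMDiffOn_momHom (T := fun _ => T) (s := fun _ => 0) contMDiffOn_jetCoord
      (fun _ => contMDiffOn_const) fun _ => contMDiffOn_const
  exact h.congr fun _ hj => toCoord_ofCoord L hj _

theorem linearIndependent_localDir {n : ℕ} {τ : Fin n → Fin m → F →L[ℝ] Eu m}
    (hτ : LinearIndependent ℝ τ) {j : Jet1 P} (hj : j.pt ∈ c.top.source) :
    LinearIndependent ℝ fun i => localDir L c (τ i) j := by
  rw [Fintype.linearIndependent_iff] at hτ ⊢
  intro g hg
  refine hτ g (eq_zero_of_momHom_eq_zero (v := c.jetCoord j) ?_)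
  rw [momHom_sum]
  have h := congrArg (toCoord L c j) hg
  rw [toCoord_sum, toCoord_zero] at h
  rw [← h]
  refine Finset.sum_congr rfl fun i _ => ?_
  rw [toCoord_smul, localDir, toCoord_ofCoord L hj]

theorem toCoord_family {n : ℕ} (τ : Fin n → Fin m → F →L[ℝ] Eu m) (g : Jet1 P → Fin n → ℝ)
    {j : Jet1 P} (hj : j.pt ∈ c.top.source) :
    toCoord L c j (L.family (localSol L c) (fun i => localDir L c (τ i)) g j) =
      baseSol (c.jetCoord j) (densityD L c (jetTop c j)) +
        momHom (c.jetCoord j) (∑ i, g j i • τ i) 0 := by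
  rw [LagrangianSystem.family, toCoord_add, localSol, toCoord_ofCoord L hj, toCoord_sum, momHom_sum]
  congr 1
  refine Finset.sum_congr rfl fun i _ => ?_
  rw [toCoord_smul, localDir, toCoord_ofCoord L hj]

/-- The smooth solutions of the field equation form the affine family. -/
theorem smooth_solution_iff (hm : 1 ≤ m) {n : ℕ} {τ : Fin n → Fin m → F →L[ℝ] Eu m}
    {γ : (Fin m → F →L[ℝ] Eu m) →L[ℝ] (Fin n → ℝ)} (hτ : ∀ i, traceForm m F (τ i) = 0)
    (hγ : ∀ T, traceForm m F T = 0 → ∑ i, γ T i • τ i = T)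
    (hS : S ⊆ (jetTop c).source) (H : L.TensorAlong) :
    (L.IsSmoothTensor S H ∧ ∀ j ∈ S, IsSolutionAt L j (H j)) ↔
      ∃ g : Jet1 P → Fin n → ℝ, ContMDiffOn 𝓘(ℝ, JetModel m F) 𝓘(ℝ, Fin n → ℝ) ∞ g S ∧
        ∀ j ∈ S, H j = L.family (localSol L c) (fun i => localDir L c (τ i)) g j := by
  have hinj : ∀ j ∈ S, ∀ l l', toCoord L c j l = toCoord L c j l' → l = l' := by
    intro j hj l l' h
    rw [← ofCoord_toCoord L (hS hj) l, h, ofCoord_toCoord L (hS hj)]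
  rw [isSmoothTensor_iff L hS]
  constructor
  · rintro ⟨h1, h2⟩
    -- The functions `gᵢ` are the `γ`-coordinates of the deviation of the coefficients from those of
    -- the particular solution.
    refine ⟨fun j => γ (liftCoef (c.jetCoord j) (toCoord L c j (H j)) -
      solCoef (densityD L c (jetTop c j))), ?_, fun j hj => ?_⟩
    · refine γ.contMDiff.comp_contMDiffOn (ContMDiffOn.sub
        (contMDiffOn_liftCoef (contMDiffOn_jetCoord.mono hS) h1) (contMDiffOn_pi_space.2 fun k => ?_))
      exact contMDiffOn_solCoef ((contMDiffOn_densityD_jetTop L).mono hS) k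
    · obtain ⟨hl, hf⟩ := (isSolutionAt_iff L (hS hj) (H j)).1 (h2 j hj)
      obtain ⟨ht, he⟩ := eq_baseSol_add hm hl hf
      refine hinj j hj _ _ ?_
      rw [toCoord_family L τ _ (hS hj), hγ _ ht]
      exact he
  · rintro ⟨g, hg, hH⟩
    have hc : ∀ j ∈ S, toCoord L c j (H j) =
        baseSol (c.jetCoord j) (densityD L c (jetTop c j)) +
          momHom (c.jetCoord j) (∑ i, g j i • τ i) 0 := fun j hj => by
      rw [hH j hj, toCoord_family L τ g (hS hj)]
    constructor
    · refine ContMDiffOn.congr (ContMDiffOn.add (contMDiffOn_baseSol (contMDiffOn_jetCoord.mono hS)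
        ((contMDiffOn_densityD_jetTop L).mono hS)) (contMDiffOn_momHom (contMDiffOn_jetCoord.mono hS)
          (fun k => ?_) fun _ => contMDiffOn_const)) hc
      have : ∀ j, (∑ i, g j i • τ i) k = ∑ i, g j i • τ i k := fun j => by simp
      simp only [this]
      refine contMDiffOn_finsetSum fun i _ => ?_
      suffices h : ContMDiffOn 𝓘(ℝ, JetModel m F) 𝓘(ℝ, ℝ) ∞ (fun j => g j i) S from
        h.smul contMDiffOn_const
      exact contMDiffOn_pi_space.1 hg i
    · intro j hj
      rw [isSolutionAt_iff L (hS hj), hc j hj]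
      refine solves_baseSol_add hm _ _ ?_
      simp [hτ]

theorem isSolutionAt_localSol (hm : 1 ≤ m) {j : Jet1 P} (hj : j.pt ∈ c.top.source) :
    IsSolutionAt L j (localSol L c j) := by
  have h := solves_baseSol_add hm (c.jetCoord j) (densityD L c (jetTop c j)) (map_zero _)
  rw [momHom_zero, add_zero] at h
  rw [isSolutionAt_iff L hj, localSol, toCoord_ofCoord L hj]
  exact h

end SolutionFamilies

/-! ### Bases, Cramer's rule and rescaling of decomposables -/

section Decomposables

variable {X Y : Type*} [AddCommGroup X] [Module ℝ X] [TopologicalSpace X]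
  [AddCommGroup Y] [Module ℝ Y] [TopologicalSpace Y] {m : ℕ}

theorem exists_basis_of_form_ne_zero [FiniteDimensional ℝ Y] (hY : Module.finrank ℝ Y = m)
    (w : Y [⋀^Fin m]→L[ℝ] ℝ) (y : Fin m → Y) (hy : w y ≠ 0) :
    ∃ b : Module.Basis (Fin m) ℝ Y, ∀ i, b i = y i := by
  have hli : LinearIndependent ℝ y := by
    by_contra h
    exact hy (w.toAlternatingMap.map_linearDependent y h)
  -- `basisOfLinearIndependentOfCardEqFinrank` needs a nonempty index type.
  rcases Nat.eq_zero_or_pos m with rfl | hm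
  · have := Module.finrank_zero_iff.1 hY
    exact ⟨Module.Basis.empty Y, fun i => i.elim0⟩
  · have : Nonempty (Fin m) := ⟨⟨0, hm⟩⟩
    exact ⟨basisOfLinearIndependentOfCardEqFinrank hli (by simp [hY]), fun i => by simp⟩

theorem form_comp_eq_zero_of_lt [FiniteDimensional ℝ Y] {n : ℕ} (hY : Module.finrank ℝ Y < n)
    (w : X [⋀^Fin n]→L[ℝ] ℝ) (l : Y →L[ℝ] X) (y : Fin n → Y) : w (fun i => l (y i)) = 0 := by
  refine (w.toAlternatingMap.compLinearMap l.toLinearMap).map_linearDependent y fun h => ?_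
  have := h.fintype_card_le_finrank
  simp at this
  omega

theorem ιMulti_update_smul_zero (hm : 1 ≤ m) (x : Fin m → X) (a : ℝ) :
    exteriorPower.ιMulti ℝ m (Function.update x ⟨0, hm⟩ (a • x ⟨0, hm⟩)) =
      a • exteriorPower.ιMulti ℝ m x := by
  rw [AlternatingMap.map_update_smul, Function.update_eq_self]

/-- Cramer's rule for a linear map with given values on a basis. -/
theorem apply_eq_sum_of_basis (w : Y [⋀^Fin m]→L[ℝ] ℝ) (b : Module.Basis (Fin m) ℝ Y) (hw : w b ≠ 0)
    (l : Y →ₗ[ℝ] X) (y : Y) :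
    l y = ∑ i, ((w b)⁻¹ * w (Function.update b i y)) • l (b i) := by
  conv_lhs => rw [← b.sum_repr y, map_sum]
  refine Finset.sum_congr rfl fun i _ => ?_
  rw [map_smul, form_update_basis]
  congr 1
  field_simp

theorem represents_map_smul (hm : 1 ≤ m) {Z : Type*} [AddCommGroup Z] [Module ℝ Z]
    [TopologicalSpace Z] (D : X →L[ℝ] Z) {l : Y →L[ℝ] X} {l' : Y →L[ℝ] Z}
    (b : Module.Basis (Fin m) ℝ Y) (h : D.comp l = l') {a : ℝ} (ha : a ≠ 0) :
    Represents l' (exteriorPower.map m D.toLinearMap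
      (a • exteriorPower.ιMulti ℝ m fun i => l (b i))) := by
  rw [represents_iff hm l' b, ← h]
  exact ⟨a, ha, by rw [map_smul, exteriorPower.map_apply_ιMulti]; rfl⟩

end Decomposables

/-! ### Dimension and dual separation for tangent spaces -/

section TangentInstances

variable {m : ℕ} {F M B : Type*} [NormedAddCommGroup F] [NormedSpace ℝ F]
  [TopologicalSpace M] [ChartedSpace (Eu m) M]
  [TopologicalSpace B] [ChartedSpace (Eu m × F) B]
  {P : FibredManifold (Eu m) F M B}

instance finiteDimensional_tBase (x : M) : FiniteDimensional ℝ (TBase m x) :=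
  inferInstanceAs (FiniteDimensional ℝ (Eu m))

theorem finrank_tBase (x : M) : Module.finrank ℝ (TBase m x) = m :=
  finrank_euclideanSpace_fin (𝕜 := ℝ) (n := m)

theorem separatingDual_of_chart {X N : Type*} [NormedAddCommGroup X] [NormedSpace ℝ X]
    [TopologicalSpace N] [ChartedSpace X N] (x : N) : SeparatingDual ℝ (TangentSpace 𝓘(ℝ, X) x) :=
  inferInstanceAs (SeparatingDual ℝ X)

instance separatingDual_tTotal (b : B) : SeparatingDual ℝ (TTotal m F b) :=
  separatingDual_of_chart b

variable [FiniteDimensional ℝ F]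

instance separatingDual_tMom (w : Momentum P m) : SeparatingDual ℝ (TMom w) :=
  separatingDual_of_chart (X := MomModel m F) w

end TangentInstances

/-! ### From multivectors to solutions, and the connection form of the equation -/

section Solutions

variable {m : ℕ} {F M B : Type*} [NormedAddCommGroup F] [NormedSpace ℝ F] [FiniteDimensional ℝ F]
  [TopologicalSpace M] [ChartedSpace (Eu m) M]
  [TopologicalSpace B] [ChartedSpace (Eu m × F) B]
  {P : FibredManifold (Eu m) F M B} {L : LagrangianSystem P}
  {c : AdaptedChart (V := Eu m) (F := F) P.proj} {S : Set (Jet1 P)}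

theorem dbase_eq (j : Jet1 P) (Z : TMom (L.legendre j)) :
    L.dbase j Z = P.dproj j.pt ((L.legendre j).dpt Z) :=
  dproj_momentumFibred Z

/-- The projection to `M` factors through `E`, where `l` becomes the jet `j`, itself a section. -/
theorem dbase_section {j : Jet1 P} {l : TBase m (P.proj j.pt) →L[ℝ] TMom (L.legendre j)}
    (h : (L.legendre j).dpt.comp l = j.val.1) (y : TBase m (P.proj j.pt)) :
    L.dbase j (l y) = y := by
  rw [dbase_eq]
  have h1 : (L.legendre j).dpt (l y) = j.val.1 y := DFunLike.congr_fun h y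
  rw [h1]
  exact DFunLike.congr_fun j.val.2 y

theorem vol_basis_ne_zero (x : M) (b : Module.Basis (Fin m) ℝ (TBase m x)) : L.vol x b ≠ 0 := by
  intro h
  refine L.vol_ne_zero x ?_
  apply ContinuousAlternatingMap.ext
  exact fun y => form_eq_zero_of_basis (L.vol x) b h y

/-- A section along the Legendre map is determined by the multivector that represents its range. -/
theorem eq_of_represents {j : Jet1 P} {l l' : TBase m (P.proj j.pt) →L[ℝ] TMom (L.legendre j)}
    (hl : ∀ y, L.dbase j (l y) = y) (hl' : ∀ y, L.dbase j (l' y) = y)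
    {u : ⋀[ℝ]^m (TMom (L.legendre j))} (hu : Represents l u) (hu' : Represents l' u) : l = l' := by
  let b := Module.finBasisOfFinrankEq ℝ (TBase m (P.proj j.pt)) (finrank_tBase _)
  exact section_unique (L.vol _) (L.dbase j) b (vol_basis_ne_zero _ b) hl hl' hu hu'

theorem chartD_dbase {j : Jet1 P} (hj : j.pt ∈ c.top.source) (Z : TMom (L.legendre j)) :
    chartD c.base (P.proj j.pt) (L.dbase j Z) =
      (chartD (momTop c) (L.legendre j) Z : MomModel m F).1 := by
  rw [dbase_eq]
  exact chartD_dproj_dpt c (w := L.legendre j) hj Z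

theorem wedge_eq {j : Jet1 P} {b : Module.Basis (Fin m) ℝ (TBase m (P.proj j.pt))}
    (hb : ∀ k, b k = chartDinv c.base (P.proj j.pt) (stdVec m k)) (H : L.TensorAlong) :
    L.wedge c H j = exteriorPower.ιMulti ℝ m fun i => H j (b i) := by
  simp only [hb]
  rfl

/-- Existence of the linear section with a given decomposable multivector. -/
theorem exists_section_of_transverse {j : Jet1 P} (hj : j.pt ∈ c.top.source)
    (X : Fin m → TMom (L.legendre j)) (hX : L.vol (P.proj j.pt) (fun i => L.dbase j (X i)) ≠ 0) :
    ∃ (b : Module.Basis (Fin m) ℝ (TBase m (P.proj j.pt)))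
      (l : TBase m (P.proj j.pt) →L[ℝ] TMom (L.legendre j)),
      (∀ i, b i = L.dbase j (X i)) ∧ (∀ i, l (b i) = X i) ∧ ∀ y, L.dbase j (l y) = y := by
  obtain ⟨b, hb⟩ := exists_basis_of_form_ne_zero (finrank_tBase _) _ _ hX
  obtain ⟨e, he⟩ := chartD_invertible c.base_mem (c.mapsTo _ hj)
  let b' : Module.Basis (Fin m) ℝ (Eu m) := b.map e.toLinearEquiv
  let X' : Fin m → MomModel m F := fun i => chartD (momTop c) (L.legendre j) (X i)
  -- Built in coordinates, where a linear map out of `ℝᵐ` is automatically continuous.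
  let h : EuHom m (MomModel m F) := LinearMap.toContinuousLinearMap (b'.constr ℝ X')
  have h1 : ∀ i, ofCoord L c j h (b i) = X i := by
    intro i
    refine Eq.trans ?_ (chartDinv_chartD (momTop_mem c)
      (show L.legendre j ∈ (momTop c).source from hj) (X i))
    refine congrArg (chartDinv (X := MomModel m F) (momTop c) (L.legendre j)) ?_
    have h2 : chartD c.base (P.proj j.pt) (b i) = b' i := by rw [← he]; simp [b']
    change h (chartD c.base (P.proj j.pt) (b i)) = X' i
    rw [h2]
    exact b'.constr_basis ℝ X' i
  refine ⟨b, ofCoord L c j h, hb, h1, fun y => ?_⟩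
  have h3 : (L.dbase j).toLinearMap.comp (ofCoord L c j h).toLinearMap = LinearMap.id := by
    refine b.ext fun i => ?_
    change L.dbase j (ofCoord L c j h (b i)) = b i
    rw [h1, hb]
  exact DFunLike.congr_fun h3 y

/-- The section spanned by a transverse decomposable multivector that satisfies the semiholonomy
condition and the field equation is a solution. -/
theorem isSolutionAt_of_basis {j : Jet1 P} {l : TBase m (P.proj j.pt) →L[ℝ] TMom (L.legendre j)}
    (b : Module.Basis (Fin m) ℝ (TBase m (P.proj j.pt))) (hl : ∀ y, L.dbase j (l y) = y)
    {u : ⋀[ℝ]^m (TMom (L.legendre j))} (hu : u = exteriorPower.ιMulti ℝ m fun i => l (b i))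
    (hf : ∀ Z : TJet j, contractForm (L.legendre j).omega u (L.dlegendre j Z) = 0)
    (hs : Represents j.val.1 (exteriorPower.map m (L.legendre j).dpt.toLinearMap u)) :
    IsSolutionAt L j l := by
  subst hu
  constructor
  · rw [exteriorPower.map_apply_ιMulti] at hs
    -- Semi-holonomy speaks only of the represented multivector. The projection of `l` to `E` and
    -- `j` are both sections of the projection to `M`, so equality of maps follows.
    refine section_unique (L.vol _) (P.dproj j.pt) b (vol_basis_ne_zero _ b) (fun y => ?_)
      (fun y => DFunLike.congr_fun j.val.2 y) ⟨b, rfl⟩ hs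
    exact (dbase_eq j (l y)).symm.trans (hl y)
  · intro Z W
    refine form_comp_eq_zero_of_basis _ l b _ ?_ Z
    have h := hf W
    rw [contractForm_ιMulti] at h
    exact (mul_eq_zero.1 h).resolve_left (pow_ne_zero _ (by norm_num))

theorem omega_eq_zero_of_three {j : Jet1 P} (Z : Fin (m + 1) → TMom (L.legendre j))
    {i k l : Fin (m + 1)} (hik : i ≠ k) (hil : i ≠ l) (hkl : k ≠ l) (hi : L.dbase j (Z i) = 0)
    (hk : L.dbase j (Z k) = 0) (hl : L.dbase j (Z l) = 0) : (L.legendre j).omega Z = 0 := by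
  obtain ⟨c, hc⟩ := P.exists_chart j.pt
  have h : ∀ i, L.dbase j (Z i) = 0 →
      (chartD (momTop c) (L.legendre j) (Z i) : MomModel m F).1 = 0 := by
    intro i hi
    rw [← chartD_dbase hc, hi, map_zero]
  rw [omega_apply c (w := L.legendre j) hc]
  exact stdOmega_eq_zero_of_three _ hik hil hkl (h i hi) (h k hk) (h l hl)

/-- The field equation in terms of the connection form. -/
theorem IsSolutionAt.connection_eq {j : Jet1 P}
    {l : TBase m (P.proj j.pt) →L[ℝ] TMom (L.legendre j)} (h : IsSolutionAt L j l)
    (Z : Fin (m + 1) → TJet j) :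
    ∑ i, (L.legendre j).omega (Function.update (fun k => L.dlegendre j (Z k)) i
      (l (L.dbase j (L.dlegendre j (Z i))))) =
      ((m : ℝ) - 1) * (L.legendre j).omega fun k => L.dlegendre j (Z k) := by
  refine sum_form_update_eq (L.legendre j).omega (fun k => L.dlegendre j (Z k))
    (fun i => l (L.dbase j (L.dlegendre j (Z i)))) ?_ ?_ ?_
  -- No vertical entry: `m + 1` vectors in the image of an `m`-dimensional space.
  · exact form_comp_eq_zero_of_lt (by rw [finrank_tBase]; omega) _ l _
  · intro i
    -- One unprojected entry: moved to the front, it is the vector `T𝔉(W)` of the field equation.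
    have h1 := form_cons_removeNth (L.legendre j).omega
      (fun k => l (L.dbase j (L.dlegendre j (Z k)))) i (L.dlegendre j (Z i))
    have h2 := h.2 (fun k => L.dbase j (L.dlegendre j (Z (i.succAbove k)))) (Z i)
    have h3 := h1.symm.trans h2
    exact (mul_eq_zero.1 h3).resolve_left (pow_ne_zero _ (by norm_num))
  · intro Y i k n hik hin hkn hi hk hn
    have hd : ∀ i, L.dbase j (L.dlegendre j (Z i) - l (L.dbase j (L.dlegendre j (Z i)))) = 0 := by
      intro i
      rw [map_sub, dbase_section h.1, sub_self]
    exact omega_eq_zero_of_three Y hik hin hkn (by rw [hi, hd]) (by rw [hk, hd]) (by rw [hn, hd])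

end Solutions

/-! ### Solutions give operators -/

section Operators

variable {m : ℕ} {F M B : Type*} [NormedAddCommGroup F] [NormedSpace ℝ F] [FiniteDimensional ℝ F]
  [TopologicalSpace M] [ChartedSpace (Eu m) M]
  [TopologicalSpace B] [ChartedSpace (Eu m × F) B]
  {P : FibredManifold (Eu m) F M B} {L : LagrangianSystem P}
  {c : AdaptedChart (V := Eu m) (F := F) P.proj} {S : Set (Jet1 P)}
  [IsManifold 𝓘(ℝ, Eu m) ∞ M]

theorem isConnectionOperator_of_solution {H : L.TensorAlong} (hs : L.IsSmoothTensor S H)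
    (ho : L.IsOrientable S H) (h : ∀ j ∈ S, IsSolutionAt L j (H j)) :
    L.IsConnectionOperator S H where
  smooth := hs
  isConnection j hj ξ hξ Z := by
    rw [← sub_eq_zero, ← map_sub]
    refine hξ _ ?_
    rw [map_sub, dbase_section (h j hj).1, sub_self]
  orientable := ho
  field_eq j hj Z := sub_eq_zero.2 ((h j hj).connection_eq Z)
  semiholonomic j hj := (h j hj).1

theorem isJetOperator_of_solution {Y : L.JetAlong} (hs : L.IsSmoothTensor S fun j => (Y j).1)
    (ho : L.IsOrientable S fun j => (Y j).1) (h : ∀ j ∈ S, IsSolutionAt L j (Y j).1) :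
    L.IsJetOperator S Y where
  smooth := (isSmoothJet_iff L Y).2 hs
  orientable := ho
  field_eq j hj Z W := (form_snoc_eq_zero_iff _ _ _).2 ((h j hj).2 Z W)
  semiholonomic j hj := (h j hj).1

theorem IsJetOperator.isSolutionAt {Y : L.JetAlong} (h : L.IsJetOperator S Y) {j : Jet1 P}
    (hj : j ∈ S) : IsSolutionAt L j (Y j).1 :=
  ⟨h.semiholonomic j hj, fun Z W => (form_snoc_eq_zero_iff _ _ _).1 (h.field_eq j hj Z W)⟩

theorem IsMVectorOperator.isOrientable {K : L.MVectorAlong} {H : L.TensorAlong}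
    (h : L.IsMVectorOperator S K) (hr : ∀ j ∈ S, Represents (H j) (K j)) : L.IsOrientable S H :=
  ⟨K, h.locallyDecomposable, hr⟩

theorem isMVectorOperator_of_locally {K : L.MVectorAlong}
    (h : ∀ j ∈ S, ∃ U, IsOpen U ∧ j ∈ U ∧ U ⊆ S ∧ L.IsMVectorOperator U K) :
    L.IsMVectorOperator S K where
  ne_zero j hj := by
    obtain ⟨U, -, hjU, -, hK⟩ := h j hj
    exact hK.ne_zero j hjU
  locallyDecomposable j hj := by
    obtain ⟨U, -, hjU, hUS, hK⟩ := h j hj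
    obtain ⟨V, hV, hjV, hVU, hX⟩ := hK.locallyDecomposable j hjU
    exact ⟨V, hV, hjV, hVU.trans hUS, hX⟩
  transverse j hj := by
    obtain ⟨U, -, hjU, -, hK⟩ := h j hj
    exact hK.transverse j hjU
  field_eq j hj := by
    obtain ⟨U, -, hjU, -, hK⟩ := h j hj
    exact hK.field_eq j hjU
  semiholonomic j hj := by
    obtain ⟨U, -, hjU, -, hK⟩ := h j hj
    exact hK.semiholonomic j hjU

/-- A smooth multiple of the exterior product of a smooth tensor is locally decomposable. -/
theorem isLocallyDecomposable_smul_wedge (hm : 1 ≤ m) (hSo : IsOpen S) (hS : S ⊆ (jetTop c).source)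
    {K : L.MVectorAlong} {f : Jet1 P → ℝ} {H : L.TensorAlong}
    (hf : ContMDiffOn 𝓘(ℝ, JetModel m F) 𝓘(ℝ, ℝ) ∞ f S) (hH : L.IsSmoothTensor S H)
    (hK : ∀ j ∈ S, K j = f j • L.wedge c H j) : L.IsLocallyDecomposable S K := by
  let X : Fin m → ∀ j : Jet1 P, TMom (L.legendre j) := fun α j =>
    H j (chartDinv c.base (P.proj j.pt) (stdVec m α))
  have hX : ∀ α, ContMDiffOn 𝓘(ℝ, JetModel m F) 𝓘(ℝ, MomModel m F) ∞
      (fun j => (chartD (momTop c) (L.legendre j) (X α j) : MomModel m F)) S := by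
    intro α
    exact ContMDiffOn.clm_apply ((isSmoothTensor_iff L hS H).1 hH) contMDiffOn_const
  intro j hj
  -- The factor `f` is absorbed into the vector field of index `0`, which exists because `m ≥ 1`.
  refine ⟨S, hSo, hj, subset_rfl, fun α j => Function.update (fun β => X β j) ⟨0, hm⟩
    (f j • X ⟨0, hm⟩ j) α, fun α => ?_, fun j hj => ?_⟩
  · rw [isSmoothVector_iff L hS]
    rcases eq_or_ne α ⟨0, hm⟩ with rfl | hα
    · simp only [Function.update_self]
      refine ContMDiffOn.congr (f := fun j => f j •
        (chartD (momTop c) (L.legendre j) (X ⟨0, hm⟩ j) : MomModel m F)) (hf.smul (hX _))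
        fun j _ => ?_
      exact map_smul (chartD (X := MomModel m F) (momTop c) (L.legendre j)) _ _
    · simp only [Function.update_of_ne hα]
      exact hX α
  · rw [hK j hj]
    exact (ιMulti_update_smul_zero hm (fun β => X β j) (f j)).symm

set_option maxHeartbeats 800000 in
theorem isMVectorOperator_of_solution (hm : 1 ≤ m) (hSo : IsOpen S) (hS : S ⊆ (jetTop c).source)
    {K : L.MVectorAlong} {f : Jet1 P → ℝ} {H : L.TensorAlong}
    (hf : ContMDiffOn 𝓘(ℝ, JetModel m F) 𝓘(ℝ, ℝ) ∞ f S) (hH : L.IsSmoothTensor S H)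
    (hK : ∀ j ∈ S, f j ≠ 0 ∧ IsSolutionAt L j (H j) ∧ K j = f j • L.wedge c H j) :
    L.IsMVectorOperator S K := by
  have hb : ∀ j ∈ S, ∃ b : Module.Basis (Fin m) ℝ (TBase m (P.proj j.pt)),
      K j = f j • exteriorPower.ιMulti ℝ m fun i => H j (b i) := by
    intro j hj
    obtain ⟨b, hb⟩ := exists_natural_basis (hS hj)
    exact ⟨b, (hK j hj).2.2.trans (congrArg (f j • ·) (wedge_eq hb H))⟩
  have ht : ∀ j ∈ S, evalForm ((L.vol (P.proj j.pt)).compContinuousLinearMap (L.dbase j))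
      (K j) ≠ 0 := by
    intro j hj
    obtain ⟨b, hb⟩ := hb j hj
    rw [hb, evalForm_smul, evalForm_ιMulti]
    refine mul_ne_zero (hK j hj).1 ?_
    have h : (L.vol (P.proj j.pt)).compContinuousLinearMap (L.dbase j) (fun i => H j (b i)) =
        L.vol (P.proj j.pt) b :=
      congrArg (L.vol (P.proj j.pt)) (funext fun i => dbase_section (hK j hj).2.1.1 (b i))
    rw [h]
    exact vol_basis_ne_zero _ b
  -- Nonvanishing of `K` comes from transversality, since `evalForm` kills `0`.
  refine ⟨fun j hj h => ht j hj ?_, isLocallyDecomposable_smul_wedge hm hSo hS hf hH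
    fun j hj => (hK j hj).2.2, ht, fun j hj Z => ?_, fun j hj => ?_⟩
  · rw [h, evalForm, map_zero]
  · obtain ⟨b, hb⟩ := hb j hj
    rw [hb, contractForm_smul, contractForm_ιMulti, (hK j hj).2.1.2, mul_zero, mul_zero]
  · obtain ⟨b, hb⟩ := hb j hj
    rw [hb]
    exact represents_map_smul hm (L.legendre j).dpt b (hK j hj).2.1.1 (hK j hj).1

end Operators

/-! ### Operators give solutions -/

section MVectorSolutions

variable {m : ℕ} {F M B : Type*} [NormedAddCommGroup F] [NormedSpace ℝ F] [FiniteDimensional ℝ F]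
  [TopologicalSpace M] [ChartedSpace (Eu m) M]
  [TopologicalSpace B] [ChartedSpace (Eu m × F) B]
  {P : FibredManifold (Eu m) F M B} {L : LagrangianSystem P}
  {c : AdaptedChart (V := Eu m) (F := F) P.proj} {S : Set (Jet1 P)}

theorem vol_eq_volC {j : Jet1 P} (hj : j.pt ∈ c.top.source)
    (Z : Fin m → TBase m (P.proj j.pt)) :
    L.vol (P.proj j.pt) Z =
      volC L c (jetTop c j).1.1 fun i => chartD c.base (P.proj j.pt) (Z i) := by
  have h1 : (jetTop c j).1.1 = c.base (P.proj j.pt) := c.fst_eq _ hj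
  have h2 : ∀ x, x = P.proj j.pt → (L.vol x).compContinuousLinearMap (chartDinv c.base x)
      (fun i => chartD c.base (P.proj j.pt) (Z i)) = L.vol (P.proj j.pt) Z := by
    rintro _ rfl
    exact congrArg (L.vol _) (funext fun i => chartDinv_chartD c.base_mem (c.mapsTo _ hj) (Z i))
  rw [h1]
  exact (h2 _ (c.base.left_inv (c.mapsTo _ hj))).symm

theorem volC_stdVec_ne_zero {j : Jet1 P} (hj : j.pt ∈ c.top.source) :
    volC L c (jetTop c j).1.1 (stdVec m) ≠ 0 := by
  obtain ⟨b, hb⟩ := exists_natural_basis hj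
  have h := vol_basis_ne_zero (L := L) _ b
  rw [vol_eq_volC hj] at h
  simpa only [hb, chartD_chartDinv c.base_mem (c.mapsTo _ hj)] using h

theorem represents_of_eq_smul_wedge (hm : 1 ≤ m) {j : Jet1 P} (hj : j.pt ∈ c.top.source)
    {H : L.TensorAlong} {u : ⋀[ℝ]^m (TMom (L.legendre j))} {a : ℝ} (ha : a ≠ 0)
    (hu : u = a • L.wedge c H j) : Represents (H j) u := by
  obtain ⟨b, hb⟩ := exists_natural_basis hj
  rw [wedge_eq hb] at hu
  exact (represents_iff hm (H j) b u).2 ⟨a, ha, hu⟩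

/-- A decomposable value of an `m`-vector operator is spanned by a solution. -/
theorem IsMVectorOperator.exists_section {K : L.MVectorAlong} (h : L.IsMVectorOperator S K)
    {j : Jet1 P} (hj : j ∈ S) (X : Fin m → TMom (L.legendre j))
    (hX : K j = exteriorPower.ιMulti ℝ m X) :
    ∃ (b : Module.Basis (Fin m) ℝ (TBase m (P.proj j.pt)))
      (l : TBase m (P.proj j.pt) →L[ℝ] TMom (L.legendre j)),
      (∀ i, b i = L.dbase j (X i)) ∧ (∀ i, l (b i) = X i) ∧ IsSolutionAt L j l := by
  obtain ⟨c, hc⟩ := P.exists_chart j.pt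
  have ht := h.transverse j hj
  rw [hX, evalForm_ιMulti] at ht
  obtain ⟨b, l, hb, hlb, hl⟩ := exists_section_of_transverse hc X ht
  have hu := hX.trans (congrArg (exteriorPower.ιMulti ℝ m) (funext fun i => (hlb i).symm))
  exact ⟨b, l, hb, hlb, isSolutionAt_of_basis b hl hu (h.field_eq j hj) (h.semiholonomic j hj)⟩

variable [IsManifold 𝓘(ℝ, Eu m) ∞ M]

theorem contMDiffOn_volC_jetTop : ContMDiffOn 𝓘(ℝ, JetModel m F) 𝓘(ℝ, FormOn m (Eu m)) ∞
    (fun j => volC L c (jetTop c j).1.1) (jetTop c).source :=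
  (contMDiffOn_iff_contDiffOn.2 (contDiffOn_volC L c)).comp
    (contMDiffOn_of_mem_maximalAtlas (jetTop_mem c)) fun _ hj => (jetTop c).map_source hj

theorem contMDiffOn_volC_apply (hS : S ⊆ (jetTop c).source) {Z : Fin m → Jet1 P → Eu m}
    (hZ : ∀ i, ContMDiffOn 𝓘(ℝ, JetModel m F) 𝓘(ℝ, Eu m) ∞ (Z i) S) :
    ContMDiffOn 𝓘(ℝ, JetModel m F) 𝓘(ℝ, ℝ) ∞
      (fun j => volC L c (jetTop c j).1.1 fun i => Z i j) S :=
  contMDiffOn_form_apply (contMDiffOn_volC_jetTop.mono hS) hZ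

theorem contMDiffOn_inv {f : Jet1 P → ℝ} (hf : ContMDiffOn 𝓘(ℝ, JetModel m F) 𝓘(ℝ, ℝ) ∞ f S)
    (h0 : ∀ j ∈ S, f j ≠ 0) :
    ContMDiffOn 𝓘(ℝ, JetModel m F) 𝓘(ℝ, ℝ) ∞ (fun j => (f j)⁻¹) S := fun j hj =>
  (contDiffAt_inv ℝ (h0 j hj)).contMDiffAt.comp_contMDiffWithinAt j (hf j hj)

set_option maxHeartbeats 1000000 in
/-- The section spanned by smooth vector fields is smooth. -/
theorem isSmoothTensor_of_basis (hS : S ⊆ (jetTop c).source)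
    {X : Fin m → ∀ j : Jet1 P, TMom (L.legendre j)} {H : L.TensorAlong}
    (hX : ∀ α, L.IsSmoothVector S (X α))
    (hH : ∀ j ∈ S, ∃ b : Module.Basis (Fin m) ℝ (TBase m (P.proj j.pt)),
      (∀ i, b i = L.dbase j (X i j)) ∧ ∀ i, H j (b i) = X i j) : L.IsSmoothTensor S H := by
  rw [isSmoothTensor_iff L hS]
  let X' : Fin m → Jet1 P → MomModel m F := fun α j => chartD (momTop c) (L.legendre j) (X α j)
  have hX' : ∀ α, ContMDiffOn 𝓘(ℝ, JetModel m F) 𝓘(ℝ, MomModel m F) ∞ (X' α) S :=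
    fun α => (isSmoothVector_iff L hS (X α)).1 (hX α)
  have hX1 : ∀ α, ContMDiffOn 𝓘(ℝ, JetModel m F) 𝓘(ℝ, Eu m) ∞ (fun j => (X' α j).1) S :=
    fun α => contDiff_fst.contMDiff.comp_contMDiffOn (hX' α)
  have hv : ∀ j ∈ S, ∀ b : Module.Basis (Fin m) ℝ (TBase m (P.proj j.pt)),
      (∀ i, b i = L.dbase j (X i j)) →
        L.vol (P.proj j.pt) b = volC L c (jetTop c j).1.1 fun i => (X' i j).1 := by
    intro j hj b hb
    rw [vol_eq_volC (hS hj)]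
    simp only [hb, chartD_dbase (hS hj)]
    rfl
  have hv0 : ∀ j ∈ S, (volC L c (jetTop c j).1.1 fun i => (X' i j).1) ≠ 0 := by
    intro j hj
    obtain ⟨b, hb, -⟩ := hH j hj
    rw [← hv j hj b hb]
    exact vol_basis_ne_zero _ b
  refine contMDiffOn_euHom_of_apply fun k => ?_
  -- Cramer coefficients of the coordinate vector `∂/∂xᵏ` in the moving basis formed by the
  -- projections of the `X i`; as quotients of determinants they are smooth.
  let a : Fin m → Jet1 P → ℝ := fun i j => (volC L c (jetTop c j).1.1 fun i => (X' i j).1)⁻¹ *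
    volC L c (jetTop c j).1.1 (Function.update (fun i => (X' i j).1) i (stdVec m k))
  have ha : ∀ i, ContMDiffOn 𝓘(ℝ, JetModel m F) 𝓘(ℝ, ℝ) ∞ (a i) S := fun i =>
    (contMDiffOn_inv (contMDiffOn_volC_apply hS hX1) hv0).mul
      (contMDiffOn_volC_apply (Z := fun l j => Function.update (fun i => (X' i j).1) i (stdVec m k) l)
        hS fun l => contMDiffOn_update hX1 contMDiffOn_const l)
  have hsum : ContMDiffOn 𝓘(ℝ, JetModel m F) 𝓘(ℝ, MomModel m F) ∞
      (fun j => ∑ i, a i j • X' i j) S :=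
    contMDiffOn_finsetSum fun i _ => (ha i).smul (hX' i)
  refine hsum.congr fun j hj => ?_
  obtain ⟨b, hb, hHb⟩ := hH j hj
  have h1 := apply_eq_sum_of_basis (L.vol (P.proj j.pt)) b (vol_basis_ne_zero _ b)
    (H j).toLinearMap (chartDinv c.base (P.proj j.pt) (stdVec m k))
  have h2 : ∀ i, (L.vol (P.proj j.pt) b)⁻¹ * L.vol (P.proj j.pt)
      (Function.update b i (chartDinv c.base (P.proj j.pt) (stdVec m k))) = a i j := by
    intro i
    rw [hv j hj b hb, vol_eq_volC (hS hj)]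
    change _ = (volC L c (jetTop c j).1.1 fun i => (X' i j).1)⁻¹ *
      volC L c (jetTop c j).1.1 (Function.update (fun i => (X' i j).1) i (stdVec m k))
    congr 1
    refine congrArg (volC L c (jetTop c j).1.1) (funext fun l => ?_)
    rcases eq_or_ne l i with rfl | hl
    · rw [Function.update_self, Function.update_self,
        chartD_chartDinv c.base_mem (c.mapsTo _ (hS hj))]
    · rw [Function.update_of_ne hl, Function.update_of_ne hl, hb, chartD_dbase (hS hj)]
  have h3 : ∀ i, (H j).toLinearMap (b i) = X i j := hHb
  simp only [h2, h3] at h1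
  refine (congrArg (chartD (X := MomModel m F) (momTop c) (L.legendre j)) h1).trans ?_
  rw [map_sum]
  exact Finset.sum_congr rfl fun i _ =>
    map_smul (chartD (X := MomModel m F) (momTop c) (L.legendre j)) _ _

/-- `H` may have been chosen pointwise. Near each jet the smooth factors of `K` span a section that
represents `K`, and uniqueness (`eq_of_represents`) makes it equal to `H`. -/
theorem IsMVectorOperator.isSmoothTensor (hS : S ⊆ (jetTop c).source) {K : L.MVectorAlong}
    (h : L.IsMVectorOperator S K) {H : L.TensorAlong}
    (hH : ∀ j ∈ S, IsSolutionAt L j (H j) ∧ Represents (H j) (K j)) : L.IsSmoothTensor S H := by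
  refine isSmoothTensor_of_locally L fun j hj => ?_
  obtain ⟨U, hU, hjU, hUS, X, hX, hKX⟩ := h.locallyDecomposable j hj
  refine ⟨U, hU, hjU, IsSmoothTensor.mono L (S := U) ?_ inter_subset_right⟩
  refine isSmoothTensor_of_basis (hUS.trans hS) hX fun j hj => ?_
  obtain ⟨b, l, hb, hlb, hsol⟩ := IsMVectorOperator.exists_section h (hUS hj) _ (hKX j hj)
  have hu := (hKX j hj).trans
    (congrArg (exteriorPower.ιMulti ℝ m) (funext fun i => (hlb i).symm))
  have hl : H j = l := eq_of_represents (dbase_section (hH j (hUS hj)).1.1)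
    (dbase_section hsol.1) (hH j (hUS hj)).2 ⟨b, hu⟩
  exact ⟨b, hb, fun i => (DFunLike.congr_fun hl _).trans (hlb i)⟩

/-- The factor relating an `m`-vector operator to the exterior product of a section is smooth. -/
theorem IsLocallyDecomposable.contMDiffOn_factor (hS : S ⊆ (jetTop c).source)
    {K : L.MVectorAlong} (h : L.IsLocallyDecomposable S K) {H : L.TensorAlong} {f : Jet1 P → ℝ}
    (hH : ∀ j ∈ S, ∀ y, L.dbase j (H j y) = y) (hf : ∀ j ∈ S, K j = f j • L.wedge c H j) :
    ContMDiffOn 𝓘(ℝ, JetModel m F) 𝓘(ℝ, ℝ) ∞ f S := by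
  refine contMDiffOn_of_locally_contMDiffOn fun j hj => ?_
  obtain ⟨U, hU, hjU, hUS, X, hX, hKX⟩ := h j hj
  refine ⟨U, hU, hjU, ContMDiffOn.mono (s := U) ?_ inter_subset_right⟩
  have hXs : ∀ α, ContMDiffOn 𝓘(ℝ, JetModel m F) 𝓘(ℝ, Eu m) ∞ (fun j =>
      (chartD (momTop c) (L.legendre j) (X α j) : MomModel m F).1) U := fun α =>
    contDiff_fst.contMDiff.comp_contMDiffOn
      ((isSmoothVector_iff L (hUS.trans hS) (X α)).1 (hX α))
  -- Evaluating the pulled-back volume form on `K` gives a smooth function by decomposability, and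
  -- `f` times the nonvanishing `ρ` by `hf`; so `f` is their quotient.
  have hq := (contMDiffOn_inv (contMDiffOn_volC_apply (L := L) (c := c) (hUS.trans hS)
    (Z := fun i _ => stdVec m i) fun i => contMDiffOn_const)
      fun j hj => volC_stdVec_ne_zero (hS (hUS hj))).mul
    (contMDiffOn_volC_apply (L := L) (hUS.trans hS) hXs)
  refine hq.congr fun j hj => ?_
  have hjS := hUS hj
  obtain ⟨b, hb⟩ := exists_natural_basis (hS hjS)
  have e1 : evalForm ((L.vol (P.proj j.pt)).compContinuousLinearMap (L.dbase j)) (K j) =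
      volC L c (jetTop c j).1.1 fun α =>
        (chartD (momTop c) (L.legendre j) (X α j) : MomModel m F).1 := by
    rw [hKX j hj, evalForm_ιMulti]
    refine (vol_eq_volC (hS hjS) _).trans (congrArg _ (funext fun α => ?_))
    exact chartD_dbase (hS hjS) _
  have e2 : evalForm ((L.vol (P.proj j.pt)).compContinuousLinearMap (L.dbase j)) (K j) =
      f j * volC L c (jetTop c j).1.1 (stdVec m) := by
    rw [hf j hjS, evalForm_smul, wedge_eq hb, evalForm_ιMulti]
    refine congrArg (f j * ·) ((vol_eq_volC (hS hjS) _).trans (congrArg _ (funext fun α => ?_)))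
    change chartD c.base (P.proj j.pt) (L.dbase j (H j (b α))) = stdVec m α
    rw [hH j hjS, hb, chartD_chartDinv c.base_mem (c.mapsTo _ (hS hjS))]
  have h0 := volC_stdVec_ne_zero (L := L) (hS hjS)
  have e3 : f j = (volC L c (jetTop c j).1.1 (stdVec m))⁻¹ * volC L c (jetTop c j).1.1 fun α =>
      (chartD (momTop c) (L.legendre j) (X α j) : MomModel m F).1 := by
    rw [← e1, e2]
    field_simp
  exact e3

/-- Every `m`-vector operator is a multiple of the exterior product of a solution. -/
theorem IsMVectorOperator.exists_solution (hm : 1 ≤ m) (hS : S ⊆ (jetTop c).source)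
    {K : L.MVectorAlong} (h : L.IsMVectorOperator S K) :
    ∃ (f : Jet1 P → ℝ) (H : L.TensorAlong),
      ContMDiffOn 𝓘(ℝ, JetModel m F) 𝓘(ℝ, ℝ) ∞ f S ∧ L.IsSmoothTensor S H ∧
        ∀ j ∈ S, f j ≠ 0 ∧ IsSolutionAt L j (H j) ∧ K j = f j • L.wedge c H j := by
  have h1 : ∀ j : Jet1 P, ∃ (l : TBase m (P.proj j.pt) →L[ℝ] TMom (L.legendre j)),
      j ∈ S → IsSolutionAt L j l ∧ Represents l (K j) := by
    intro j
    by_cases hj : j ∈ S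
    · obtain ⟨U, -, hjU, -, X, -, hKX⟩ := h.locallyDecomposable j hj
      obtain ⟨b, l, -, hlb, hsol⟩ := IsMVectorOperator.exists_section h hj _ (hKX j hjU)
      exact ⟨l, fun _ => ⟨hsol, b, (hKX j hjU).trans
        (congrArg (exteriorPower.ιMulti ℝ m) (funext fun i => (hlb i).symm))⟩⟩
    -- Off `S` any value will do: all conclusions are restricted to `S`.
    · exact ⟨0, fun h => absurd h hj⟩
  choose H hH using h1
  have h2 : ∀ j : Jet1 P, ∃ a : ℝ, j ∈ S → a ≠ 0 ∧ K j = a • L.wedge c H j := by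
    intro j
    by_cases hj : j ∈ S
    · obtain ⟨b, hb⟩ := exists_natural_basis (hS hj)
      obtain ⟨a, ha, hK⟩ := (represents_iff hm (H j) b (K j)).1 (hH j hj).2
      exact ⟨a, fun _ => ⟨ha, hK.trans (congrArg (a • ·) (wedge_eq hb H).symm)⟩⟩
    · exact ⟨0, fun h => absurd h hj⟩
  choose f hf using h2
  exact ⟨f, H, IsLocallyDecomposable.contMDiffOn_factor hS h.locallyDecomposable
    (fun j hj => dbase_section (hH j hj).1.1) fun j hj => (hf j hj).2,
    IsMVectorOperator.isSmoothTensor hS h hH,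
    fun j hj => ⟨(hf j hj).1, (hH j hj).1, (hf j hj).2⟩⟩

theorem isMVectorOperator_wedge (hm : 1 ≤ m) (hSo : IsOpen S) (hS : S ⊆ (jetTop c).source)
    {H : L.TensorAlong} (hs : L.IsSmoothTensor S H) (h : ∀ j ∈ S, IsSolutionAt L j (H j)) :
    L.IsMVectorOperator S (L.wedge c H) :=
  isMVectorOperator_of_solution hm hSo hS (f := fun _ => 1) contMDiffOn_const hs
    fun j hj => ⟨one_ne_zero, h j hj, (one_smul ℝ _).symm⟩

theorem represents_wedge (hm : 1 ≤ m) {j : Jet1 P} (hj : j.pt ∈ c.top.source) (H : L.TensorAlong) :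
    Represents (H j) (L.wedge c H j) :=
  represents_of_eq_smul_wedge hm hj one_ne_zero (one_smul ℝ _).symm

/-- Over a chart orientability is automatic: the coordinate wedge of `Y` generates its distribution.
-/
theorem isJetOperator_iff (hm : 1 ≤ m) (hSo : IsOpen S) (hS : S ⊆ (jetTop c).source)
    (Y : L.JetAlong) : L.IsJetOperator S Y ↔
      L.IsSmoothTensor S (fun j => (Y j).1) ∧ ∀ j ∈ S, IsSolutionAt L j (Y j).1 :=
  ⟨fun h => ⟨(isSmoothJet_iff L Y).1 h.smooth, fun _ hj => IsJetOperator.isSolutionAt h hj⟩,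
    fun ⟨h, h'⟩ => isJetOperator_of_solution h (IsMVectorOperator.isOrientable
      (isMVectorOperator_wedge hm hSo hS h h') fun _ hj => represents_wedge hm (hS hj) _) h'⟩

/-- Association with `K` brings in the field equation: `K` comes from a solution `H'`, and sections
representing the same multivector coincide. In return, a solution is associated with its coordinate
wedge. -/
theorem isConnectionOperator_iff (hm : 1 ≤ m) (hSo : IsOpen S) (hS : S ⊆ (jetTop c).source)
    (H : L.TensorAlong) : (L.IsConnectionOperator S H ∧
        ∃ K, L.IsMVectorOperator S K ∧ ∀ j ∈ S, Represents (H j) (K j)) ↔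
      L.IsSmoothTensor S H ∧ ∀ j ∈ S, IsSolutionAt L j (H j) := by
  constructor
  · rintro ⟨h, K, hK, hr⟩
    refine ⟨h.smooth, fun j hj => ?_⟩
    obtain ⟨f, H', -, -, hf⟩ := IsMVectorOperator.exists_solution (c := c) hm hS hK
    obtain ⟨h0, hsol, hKj⟩ := hf j hj
    have e : H j = H' j := eq_of_represents (dbase_section (h.semiholonomic j hj))
      (dbase_section hsol.1) (hr j hj) (represents_of_eq_smul_wedge hm (hS hj) h0 hKj)
    rw [e]
    exact hsol
  · rintro ⟨h, h'⟩
    have hK := isMVectorOperator_wedge hm hSo hS h h'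
    have hr : ∀ j ∈ S, Represents (H j) (L.wedge c H j) := fun _ hj =>
      represents_wedge hm (hS hj) _
    exact ⟨isConnectionOperator_of_solution h (IsMVectorOperator.isOrientable hK hr) h', _, hK, hr⟩

end MVectorSolutions

/-! ### Multivectors normalized by volume -/

section Normalization

variable {X Y : Type*} [AddCommGroup X] [Module ℝ X] [TopologicalSpace X]
  [AddCommGroup Y] [Module ℝ Y] [TopologicalSpace Y] {m : ℕ}

/-- A change of basis multiplies the volume and the exterior product by the same determinant. -/
theorem inv_smul_eq_of_basis (w : Y [⋀^Fin m]→L[ℝ] ℝ) (l : Y →L[ℝ] X)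
    (b b' : Module.Basis (Fin m) ℝ Y) (hw : w b ≠ 0) {a a' : ℝ} {u u' : ⋀[ℝ]^m X} (ha : w b = a)
    (ha' : w b' = a') (hu : u = exteriorPower.ιMulti ℝ m fun i => l (b i))
    (hu' : u' = exteriorPower.ιMulti ℝ m fun i => l (b' i)) : a'⁻¹ • u' = a⁻¹ • u := by
  subst ha ha' hu hu'
  have h1 : w b' = b.det b' * w b := alternating_eq_det_smul w.toAlternatingMap b b'
  have h4 : b.det b' ≠ 0 := (b.isUnit_det b').ne_zero
  rw [ιMulti_comp_eq_smul l b b', smul_smul, h1]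
  congr 1
  field_simp

end Normalization

/-! ### Sums and cutoffs of smooth tensors -/

section SmoothTensors

variable {m : ℕ} {F M B : Type*} [NormedAddCommGroup F] [NormedSpace ℝ F] [FiniteDimensional ℝ F]
  [TopologicalSpace M] [ChartedSpace (Eu m) M]
  [TopologicalSpace B] [ChartedSpace (Eu m × F) B]
  {P : FibredManifold (Eu m) F M B} {L : LagrangianSystem P}
  {c : AdaptedChart (V := Eu m) (F := F) P.proj} {S : Set (Jet1 P)}

theorem contMDiff_jet_pt : ContMDiff 𝓘(ℝ, JetModel m F) 𝓘(ℝ, Eu m × F) ∞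
    (Jet1.pt (P := P)) := by
  intro j
  obtain ⟨c, hc⟩ := P.exists_chart j.pt
  exact (contMDiffOn_jet_pt c).contMDiffAt ((jetTop c).open_source.mem_nhds hc)

variable [IsManifold 𝓘(ℝ, Eu m) ∞ M]

theorem IsSmoothTensor.sum {ι : Type*} {t : Finset ι} {H : ι → L.TensorAlong}
    (hH : ∀ i ∈ t, L.IsSmoothTensor S (H i)) : L.IsSmoothTensor S fun j => ∑ i ∈ t, H i j := by
  refine isSmoothTensor_of_locally L fun j _ => ?_
  obtain ⟨c, hc⟩ := P.exists_chart j.pt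
  refine ⟨(jetTop c).source, (jetTop c).open_source, hc, ?_⟩
  rw [isSmoothTensor_iff L inter_subset_right]
  simp only [toCoord_sum]
  exact contMDiffOn_finsetSum fun i hi => (isSmoothTensor_iff L inter_subset_right _).1
    (IsSmoothTensor.mono L (hH i hi) inter_subset_left)

/-- Extension by zero of a tensor in a chart, with a cutoff function. -/
theorem isSmoothTensor_smul_of_tsupport {ρ : B → ℝ} (hρ : ContMDiff 𝓘(ℝ, Eu m × F) 𝓘(ℝ, ℝ) ∞ ρ)
    (hs : tsupport ρ ⊆ c.top.source) {H : L.TensorAlong} (hH : L.IsSmoothTensor (jetTop c).source H) :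
    L.IsSmoothTensor univ fun j => ρ j.pt • H j := by
  have hρ' : ContMDiff 𝓘(ℝ, JetModel m F) 𝓘(ℝ, ℝ) ∞ fun j : Jet1 P => ρ j.pt :=
    hρ.comp contMDiff_jet_pt
  refine isSmoothTensor_of_locally L fun j _ => ?_
  by_cases hj : j.pt ∈ c.top.source
  · refine ⟨(jetTop c).source, (jetTop c).open_source, hj, ?_⟩
    rw [isSmoothTensor_iff L inter_subset_right]
    simp only [toCoord_smul]
    exact ContMDiffOn.smul hρ'.contMDiffOn ((isSmoothTensor_iff L inter_subset_right _).1
      (IsSmoothTensor.mono L hH inter_subset_right))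
  -- Outside the domain of `c` the point is off the closed support of `ρ`, so the tensor is zero on
  -- a neighbourhood, seen in another chart `c'`.
  · obtain ⟨c', hc'⟩ := P.exists_chart j.pt
    refine ⟨(jetTop c').source ∩ Jet1.pt ⁻¹' (tsupport ρ)ᶜ, (jetTop c').open_source.inter
      ((isClosed_tsupport ρ).isOpen_compl.preimage contMDiff_jet_pt.continuous),
      ⟨hc', fun h => hj (hs h)⟩, ?_⟩
    rw [isSmoothTensor_iff (c := c') L fun j hj => hj.2.1]
    have h0 : ContMDiffOn 𝓘(ℝ, JetModel m F) 𝓘(ℝ, EuHom m (MomModel m F)) ∞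
      (fun _ : Jet1 P => (0 : EuHom m (MomModel m F)))
      (univ ∩ ((jetTop c').source ∩ Jet1.pt ⁻¹' (tsupport ρ)ᶜ)) := contMDiffOn_const
    refine h0.congr fun j hj => ?_
    rw [toCoord_smul, image_eq_zero_of_notMem_tsupport hj.2.2, zero_smul]

end SmoothTensors

/-! ### Global existence -/

section GlobalSolutions

variable {m : ℕ} {F M B : Type*} [NormedAddCommGroup F] [NormedSpace ℝ F] [FiniteDimensional ℝ F]
  [TopologicalSpace M] [ChartedSpace (Eu m) M]
  [TopologicalSpace B] [ChartedSpace (Eu m × F) B]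
  {P : FibredManifold (Eu m) F M B} (L : LagrangianSystem P)

/-- The exterior product of the image under `H` of a basis with volume one. -/
def unitWedge (H : L.TensorAlong) : L.MVectorAlong := fun j =>
  (volC L (P.exists_chart j.pt).choose (jetTop (P.exists_chart j.pt).choose j).1.1
    (stdVec m))⁻¹ • L.wedge (P.exists_chart j.pt).choose H j

variable {L}

theorem vol_natural_basis {c : AdaptedChart (V := Eu m) (F := F) P.proj} {j : Jet1 P}
    (hj : j.pt ∈ c.top.source) {b : Module.Basis (Fin m) ℝ (TBase m (P.proj j.pt))}
    (hb : ∀ k, b k = chartDinv c.base (P.proj j.pt) (stdVec m k)) :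
    L.vol (P.proj j.pt) b = volC L c (jetTop c j).1.1 (stdVec m) := by
  rw [vol_eq_volC hj]
  simp only [hb, chartD_chartDinv c.base_mem (c.mapsTo _ hj)]

theorem inv_volC_smul_wedge_eq {c c' : AdaptedChart (V := Eu m) (F := F) P.proj} {j : Jet1 P}
    (hj : j.pt ∈ c.top.source) (hj' : j.pt ∈ c'.top.source) (H : L.TensorAlong) :
    (volC L c' (jetTop c' j).1.1 (stdVec m))⁻¹ • L.wedge c' H j =
      (volC L c (jetTop c j).1.1 (stdVec m))⁻¹ • L.wedge c H j := by
  obtain ⟨b, hb⟩ := exists_natural_basis hj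
  obtain ⟨b', hb'⟩ := exists_natural_basis hj'
  exact inv_smul_eq_of_basis (L.vol (P.proj j.pt)) (H j) b b' (vol_basis_ne_zero _ b)
    (vol_natural_basis hj hb) (vol_natural_basis hj' hb') (wedge_eq hb H) (wedge_eq hb' H)

/-- The chart chosen in `unitWedge` can be replaced by any other, so on each chart domain the
globally defined field has a smooth coordinate expression. -/
theorem unitWedge_eq {c : AdaptedChart (V := Eu m) (F := F) P.proj} {j : Jet1 P}
    (hj : j.pt ∈ c.top.source) (H : L.TensorAlong) :
    unitWedge L H j = (volC L c (jetTop c j).1.1 (stdVec m))⁻¹ • L.wedge c H j :=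
  inv_volC_smul_wedge_eq hj (P.exists_chart j.pt).choose_spec H

theorem represents_unitWedge (hm : 1 ≤ m) (H : L.TensorAlong) (j : Jet1 P) :
    Represents (H j) (unitWedge L H j) := by
  obtain ⟨c, hc⟩ := P.exists_chart j.pt
  exact represents_of_eq_smul_wedge hm hc (inv_ne_zero (volC_stdVec_ne_zero hc)) (unitWedge_eq hc H)

variable [IsManifold 𝓘(ℝ, Eu m) ∞ M]

theorem isMVectorOperator_of_sameClass (hm : 1 ≤ m) {H : L.TensorAlong}
    (hs : L.IsSmoothTensor univ H) (h : ∀ j, IsSolutionAt L j (H j)) {K : L.MVectorAlong}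
    (hK : L.SameClass univ (unitWedge L H) K) : L.IsMVectorOperator univ K := by
  obtain ⟨f, hf, hfK⟩ := hK
  refine isMVectorOperator_of_locally fun j _ => ?_
  obtain ⟨c, hc⟩ := P.exists_chart j.pt
  have h0 : ∀ j ∈ (jetTop c).source, volC L c (jetTop c j).1.1 (stdVec m) ≠ 0 :=
    fun j hj => volC_stdVec_ne_zero hj
  refine ⟨(jetTop c).source, (jetTop c).open_source, hc, subset_univ _, ?_⟩
  refine isMVectorOperator_of_solution hm (jetTop c).open_source subset_rfl
    (f := fun j => f j * (volC L c (jetTop c j).1.1 (stdVec m))⁻¹) ?_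
    (IsSmoothTensor.mono L hs (subset_univ _)) fun j hj => ⟨?_, h j, ?_⟩
  · exact (hf.mono (subset_univ _)).mul (contMDiffOn_inv (contMDiffOn_volC_apply subset_rfl
      (Z := fun i _ => stdVec m i) fun i => contMDiffOn_const) h0)
  · exact mul_ne_zero (hfK j (mem_univ _)).1 (inv_ne_zero (h0 j hj))
  · rw [(hfK j (mem_univ _)).2, unitWedge_eq hj, smul_smul]

/-- Solutions exist globally. -/
theorem exists_global_solution (hm : 1 ≤ m) [T2Space B] [SigmaCompactSpace B]
    [IsManifold 𝓘(ℝ, Eu m × F) ∞ B] (L : LagrangianSystem P) :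
    ∃ H : L.TensorAlong, L.IsSmoothTensor univ H ∧ ∀ j, IsSolutionAt L j (H j) := by
  -- The partition lives on `E`, indexed by all natural charts; since the natural charts of `J¹E`
  -- lie over those of `E`, pulling it back is enough.
  obtain ⟨ρ, hρ⟩ := SmoothPartitionOfUnity.exists_isSubordinate 𝓘(ℝ, Eu m × F) (s := univ)
    isClosed_univ (fun c : AdaptedChart (V := Eu m) (F := F) P.proj => c.top.source)
    (fun c => c.top.open_source) fun b _ => mem_iUnion.2 (P.exists_chart b)
  refine ⟨fun j => ∑ c ∈ ρ.finsupport j.pt, ρ c j.pt • localSol L c j, ?_, fun j => ?_⟩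
  · refine isSmoothTensor_of_locally L fun j _ => ?_
    obtain ⟨U, hU, hfin⟩ := ρ.locallyFinite j.pt
    obtain ⟨V, hVU, hV, hjV⟩ := mem_nhds_iff.1 hU
    obtain ⟨c₀, hc₀⟩ := P.exists_chart j.pt
    refine ⟨(jetTop c₀).source ∩ Jet1.pt ⁻¹' V, (jetTop c₀).open_source.inter
      (hV.preimage contMDiff_jet_pt.continuous), ⟨hc₀, hjV⟩, ?_⟩
    -- The index set `finsupport` varies with the point; near `j` it lies in the fixed finite set
    -- `hfin.toFinset`, and the extra terms are zero.
    have h1 : L.IsSmoothTensor univ fun j => ∑ c ∈ hfin.toFinset, ρ c j.pt • localSol L c j :=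
      IsSmoothTensor.sum (H := fun c j => ρ c j.pt • localSol L c j) fun c _ =>
        isSmoothTensor_smul_of_tsupport (ρ c).contMDiff (hρ c) (isSmoothTensor_localSol L)
    refine isSmoothTensor_congr (c := c₀) L (fun j hj => hj.2.1)
      (IsSmoothTensor.mono L h1 (subset_univ _)) fun j hj => ?_
    refine Finset.sum_subset (fun c hc => ?_) fun c _ hc => ?_
    · rw [SmoothPartitionOfUnity.mem_finsupport] at hc
      exact hfin.mem_toFinset.2 ⟨j.pt, hc, hVU hj.2.2⟩
    · rw [SmoothPartitionOfUnity.mem_finsupport, Function.notMem_support] at hc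
      rw [hc, zero_smul]
  · refine IsSolutionAt.sum L (fun c hc => isSolutionAt_localSol L hm (hρ c ?_))
      (ρ.sum_finsupport j.pt (mem_univ _))
    exact subset_tsupport _ ((SmoothPartitionOfUnity.mem_finsupport _ _).1 hc)

theorem exists_global_operators (hm : 1 ≤ m) [T2Space B] [SigmaCompactSpace B]
    [IsManifold 𝓘(ℝ, Eu m × F) ∞ B] (L : LagrangianSystem P) :
    ∃ (K : L.MVectorAlong) (Y : L.JetAlong) (H : L.TensorAlong),
      (∀ K', L.SameClass univ K K' → L.IsMVectorOperator univ K') ∧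
      L.IsJetOperator univ Y ∧ L.IsConnectionOperator univ H ∧
      ∀ j, Represents (H j) (K j) ∧ (Y j).1 = H j := by
  obtain ⟨H, hs, h⟩ := exists_global_solution hm L
  have hY : ∀ j, ((momentumFibred P m).dproj (L.legendre j)).comp (H j) =
      ContinuousLinearMap.id ℝ _ := fun j =>
    ContinuousLinearMap.ext fun y => dbase_section (h j).1 y
  have hK : ∀ K', L.SameClass univ (unitWedge L H) K' → L.IsMVectorOperator univ K' :=
    fun K' => isMVectorOperator_of_sameClass hm hs h
  -- The volume form orients the distribution: the unit wedge generates it globally.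
  have ho : L.IsOrientable univ H := IsMVectorOperator.isOrientable
    (hK _ ⟨fun _ => 1, contMDiffOn_const, fun j _ => ⟨one_ne_zero, (one_smul ℝ _).symm⟩⟩)
    fun j _ => represents_unitWedge hm H j
  exact ⟨unitWedge L H, fun j => ⟨H j, hY j⟩, H, hK,
    isJetOperator_of_solution hs ho fun j _ => h j,
    isConnectionOperator_of_solution hs ho fun j _ => h j,
    fun j => ⟨represents_unitWedge hm H j, rfl⟩⟩

end GlobalSolutions

/-! ### The families of operators over a chart -/

section LocalMultiplicity

variable {m : ℕ} {F M B : Type*} [NormedAddCommGroup F] [NormedSpace ℝ F] [FiniteDimensional ℝ F]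
  [TopologicalSpace M] [ChartedSpace (Eu m) M] [IsManifold 𝓘(ℝ, Eu m) ∞ M]
  [TopologicalSpace B] [ChartedSpace (Eu m × F) B]
  {P : FibredManifold (Eu m) F M B}

theorem wedge_congr {L : LagrangianSystem P} (c : AdaptedChart (V := Eu m) (F := F) P.proj)
    {H H' : L.TensorAlong} {j : Jet1 P} (h : H j = H' j) : L.wedge c H j = L.wedge c H' j := by
  unfold LagrangianSystem.wedge
  rw [h]

theorem isMVectorOperator_iff_family (hm : 1 ≤ m) {L : LagrangianSystem P}
    {c : AdaptedChart (V := Eu m) (F := F) P.proj} {S : Set (Jet1 P)} (hSo : IsOpen S)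
    (hS : S ⊆ (jetTop c).source) {n : ℕ} {H₀ : L.TensorAlong} {G : Fin n → L.TensorAlong}
    (h : ∀ H : L.TensorAlong, (L.IsSmoothTensor S H ∧ ∀ j ∈ S, IsSolutionAt L j (H j)) ↔
      ∃ g : Jet1 P → Fin n → ℝ, ContMDiffOn 𝓘(ℝ, JetModel m F) 𝓘(ℝ, Fin n → ℝ) ∞ g S ∧
        ∀ j ∈ S, H j = L.family H₀ G g j) (K : L.MVectorAlong) :
    L.IsMVectorOperator S K ↔ ∃ (f : Jet1 P → ℝ) (g : Jet1 P → Fin n → ℝ),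
      ContMDiffOn 𝓘(ℝ, JetModel m F) 𝓘(ℝ, ℝ) ∞ f S ∧
      ContMDiffOn 𝓘(ℝ, JetModel m F) 𝓘(ℝ, Fin n → ℝ) ∞ g S ∧
      ∀ j ∈ S, f j ≠ 0 ∧ K j = f j • L.wedge c (L.family H₀ G g) j := by
  constructor
  · intro hK
    obtain ⟨f, H, hf, hH, hf'⟩ := IsMVectorOperator.exists_solution (c := c) hm hS hK
    obtain ⟨g, hg, hHg⟩ := (h H).1 ⟨hH, fun j hj => (hf' j hj).2.1⟩
    exact ⟨f, g, hf, hg, fun j hj => ⟨(hf' j hj).1,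
      (hf' j hj).2.2.trans (congrArg (f j • ·) (wedge_congr c (hHg j hj)))⟩⟩
  · rintro ⟨f, g, hf, hg, hf'⟩
    obtain ⟨hH, hsol⟩ := (h (L.family H₀ G g)).2 ⟨g, hg, fun j _ => rfl⟩
    exact isMVectorOperator_of_solution hm hSo hS hf hH
      fun j hj => ⟨(hf' j hj).1, hsol j hj, (hf' j hj).2⟩

/-- In natural coordinates the operators depend on `N(m² - 1)` arbitrary functions. -/
theorem local_multiplicity (hm : 1 ≤ m) {N : ℕ} (hN : Module.finrank ℝ F = N)
    (L : LagrangianSystem P) (c : AdaptedChart (V := Eu m) (F := F) P.proj) :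
    ∃ (H₀ : L.TensorAlong) (G : Fin (N * (m ^ 2 - 1)) → L.TensorAlong),
      L.IsSmoothTensor {j | j.pt ∈ c.top.source} H₀ ∧
      (∀ i, L.IsSmoothTensor {j | j.pt ∈ c.top.source} (G i)) ∧
      (∀ j : Jet1 P, j.pt ∈ c.top.source → LinearIndependent ℝ fun i => G i j) ∧
      ∀ S : Set (Jet1 P), IsOpen S → S ⊆ {j | j.pt ∈ c.top.source} →
        (∀ K : L.MVectorAlong, L.IsMVectorOperator S K ↔
          ∃ (f : Jet1 P → ℝ) (g : Jet1 P → Fin (N * (m ^ 2 - 1)) → ℝ),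
            ContMDiffOn 𝓘(ℝ, JetModel m F) 𝓘(ℝ, ℝ) ∞ f S ∧
            ContMDiffOn 𝓘(ℝ, JetModel m F) 𝓘(ℝ, Fin (N * (m ^ 2 - 1)) → ℝ) ∞ g S ∧
            ∀ j ∈ S, f j ≠ 0 ∧ K j = f j • L.wedge c (L.family H₀ G g) j) ∧
        (∀ Y : L.JetAlong, L.IsJetOperator S Y ↔
          ∃ g : Jet1 P → Fin (N * (m ^ 2 - 1)) → ℝ,
            ContMDiffOn 𝓘(ℝ, JetModel m F) 𝓘(ℝ, Fin (N * (m ^ 2 - 1)) → ℝ) ∞ g S ∧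
            ∀ j ∈ S, (Y j).1 = L.family H₀ G g j) ∧
        (∀ H : L.TensorAlong,
          (L.IsConnectionOperator S H ∧
            ∃ K, L.IsMVectorOperator S K ∧ ∀ j ∈ S, Represents (H j) (K j)) ↔
          ∃ g : Jet1 P → Fin (N * (m ^ 2 - 1)) → ℝ,
            ContMDiffOn 𝓘(ℝ, JetModel m F) 𝓘(ℝ, Fin (N * (m ^ 2 - 1)) → ℝ) ∞ g S ∧
            ∀ j ∈ S, H j = L.family H₀ G g j) := by
  obtain ⟨τ, γ, hli, hτ, hγ⟩ := exists_tracefree_basis (m := m) (F := F) hm hN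
  refine ⟨localSol L c, fun i => localDir L c (τ i), isSmoothTensor_localSol L,
    fun i => isSmoothTensor_localDir L (τ i), fun j hj => linearIndependent_localDir L hli hj,
    fun S hSo hS => ⟨fun K => ?_, fun Y => ?_, fun H => ?_⟩⟩
  · exact isMVectorOperator_iff_family hm hSo hS (smooth_solution_iff L hm hτ hγ hS) K
  · exact (isJetOperator_iff hm hSo hS Y).trans (smooth_solution_iff L hm hτ hγ hS _)
  · exact (isConnectionOperator_iff hm hSo hS H).trans (smooth_solution_iff L hm hτ hγ hS H)

end LocalMultiplicity

end

/-! ### The theorem for smooth fibre bundles -/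

theorem mainTheorem5 {m N : ℕ} (hm : 1 ≤ m) {M E Φ : Type*}
    [TopologicalSpace M] [ChartedSpace (EuclideanSpace ℝ (Fin m)) M]
    [IsManifold (𝓡 m) ∞ M]
    [TopologicalSpace Φ] [ChartedSpace (EuclideanSpace ℝ (Fin N)) Φ]
    [IsManifold (𝓡 N) ∞ Φ]
    [TopologicalSpace E] [T2Space E] [SigmaCompactSpace E]
    [ChartedSpace (EuclideanSpace ℝ (Fin m) × EuclideanSpace ℝ (Fin N)) E]
    [IsManifold 𝓘(ℝ, EuclideanSpace ℝ (Fin m) × EuclideanSpace ℝ (Fin N)) ∞ E]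
    (π : SmoothFibreBundle m N M E Φ) (L : LagrangianSystem π.fibred) :
    (∃ (K : L.MVectorAlong) (Y : L.JetAlong) (H : L.TensorAlong),
      (∀ K', L.SameClass univ K K' → L.IsMVectorOperator univ K') ∧
      L.IsJetOperator univ Y ∧ L.IsConnectionOperator univ H ∧
      ∀ j, Represents (H j) (K j) ∧ (Y j).1 = H j) ∧
    ∀ c : AdaptedChart (V := Eu m) (F := Eu N) π.fibred.proj,
      ∃ (H₀ : L.TensorAlong) (G : Fin (N * (m ^ 2 - 1)) → L.TensorAlong),
        L.IsSmoothTensor {j | j.pt ∈ c.top.source} H₀ ∧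
        (∀ i, L.IsSmoothTensor {j | j.pt ∈ c.top.source} (G i)) ∧
        (∀ j : Jet1 π.fibred, j.pt ∈ c.top.source → LinearIndependent ℝ fun i => G i j) ∧
        ∀ S : Set (Jet1 π.fibred), IsOpen S → S ⊆ {j | j.pt ∈ c.top.source} →
          (∀ K : L.MVectorAlong, L.IsMVectorOperator S K ↔
            ∃ (f : Jet1 π.fibred → ℝ) (g : Jet1 π.fibred → Fin (N * (m ^ 2 - 1)) → ℝ),
              ContMDiffOn 𝓘(ℝ, JetModel m (Eu N)) 𝓘(ℝ, ℝ) ∞ f S ∧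
              ContMDiffOn 𝓘(ℝ, JetModel m (Eu N)) 𝓘(ℝ, Fin (N * (m ^ 2 - 1)) → ℝ) ∞ g S ∧
              ∀ j ∈ S, f j ≠ 0 ∧ K j = f j • L.wedge c (L.family H₀ G g) j) ∧
          (∀ Y : L.JetAlong, L.IsJetOperator S Y ↔
            ∃ g : Jet1 π.fibred → Fin (N * (m ^ 2 - 1)) → ℝ,
              ContMDiffOn 𝓘(ℝ, JetModel m (Eu N)) 𝓘(ℝ, Fin (N * (m ^ 2 - 1)) → ℝ) ∞ g S ∧
              ∀ j ∈ S, (Y j).1 = L.family H₀ G g j) ∧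
          (∀ H : L.TensorAlong,
            (L.IsConnectionOperator S H ∧
              ∃ K, L.IsMVectorOperator S K ∧ ∀ j ∈ S, Represents (H j) (K j)) ↔
            ∃ g : Jet1 π.fibred → Fin (N * (m ^ 2 - 1)) → ℝ,
              ContMDiffOn 𝓘(ℝ, JetModel m (Eu N)) 𝓘(ℝ, Fin (N * (m ^ 2 - 1)) → ℝ) ∞ g S ∧
              ∀ j ∈ S, H j = L.family H₀ G g j) := by
  have hF : Module.finrank ℝ (Eu N) = N := finrank_euclideanSpace_fin
  exact ⟨exists_global_operators hm L, fun c => local_multiplicity hm hF L c⟩
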